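/- **Circuit model.** A circuit acts on data qubits and on finitely many ancilla qubits, which are supplied in the states $|0\rangle$, $|+\rangle$, $T|+\rangle$ and $CCZ|{+}{+}{+}\rangle$. It is a finite sequence of instructions of the following kinds: measurement of a two-qubit Pauli operator (any element of $\{I,X,Y,Z\}^{\otimes 2}$ on two distinct qubits); measurement of one qubit in the $X$ or $Z$ basis; a single-qubit Pauli gate; a two-input Boolean gate on classical bits (all of which start as $0$). Measurement bases and Pauli gates may depend on classical bits, and hence on earlier outcomes. A two-qubit Pauli measurement takes one logical cycle; the other instructions take none. $\mathrm{LogicalDepth}(V)$ is the number of logical cycles when each instruction of $V$ is executed as soon as its qubits are free from the earlier instructions and the classical bits it reads are known. The size of a circuit is its number of supplied ancilla states plus its number of instructions. For a circuit $V$ with measurement outcomes $o$, let $K_o$ be the (linear) map from data states to unnormalized final states of data and ancilla qubits. $V$ *implements* a unitary $U$ with accuracy $\delta$ if there are ancilla vectors $\chi_o$, independent of the input, with $\sum_o\|\chi_o\|^2=1$ and $\sum_o\|K_o\varphi-U\varphi\otimes\chi_o\|^2\le\delta^2\|\varphi\|^2$ for all $\varphi$. $V$ is *$Z$-equivalent*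 to $U$ with accuracy $\delta$ if the same holds after $K_o$ is replaced by $Z^{a(o)}K_o$, where $Z^{a(o)}$ is a product of Pauli-$Z$ gates on data qubits, each controlled by a sum modulo 2 of classical bits held by $V$ at its end. For $\delta=0$ the implementation or $Z$-equivalence is exact. **Phaser.** Let $C_1,\dots,C_m$ be disjunctions of $k$ literals in $n$ Boolean variables, let $Q_j$ be the set of qubits of the variables in $C_j$, and for $\gamma\in\mathbb R$ let $$U_j=\sum_{x\in\{0,1\}^n}e^{-i\gamma C_j(x)}|x\rangle\langle x|,\qquad U_C=\prod_{j=1}^m U_j .$$ **Statement.** There is a universal constant $A$ such that the following holds for all $n,m,k\ge 0$, all $\gamma\in\mathbb R$, $\delta\ge0$ and all clauses as above. Suppose that $\{C_1,\dots,C_m\}$ (indexed by $j$) is partitioned into $c$ parts such that $Q_i\cap Q_j=\emptyset$ whenever $i\ne j$ and $C_i,C_j$ lie in the same part. Let $P$ be a circuit of logical depth $n_P$ that implements the single-qubit phase gate $P_1(\gamma)=e^{i\gamma|1\rangle\langle1|}$ with accuracy $\delta$. Then there are circuits $V_1,\dots,V_m$, each $V_j$ being $Z$-equivalent to $U_j$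 with accuracy $\delta$ and of size at most $A\,(k+\mathrm{size}(P)+1)^A$, such that their product $V_C=\prod_jV_j$ (composition in a suitable order, on shared data qubits and separate ancilla qubits and classical bits) is $Z$-equivalent to the phaser $U_C$ with accuracy $m\delta$ and satisfies $$\mathrm{LogicalDepth}(V_C)\le c+n_P+4\lceil\log_2k\rceil,$$ where $\lceil\log_2 0\rceil$ is read as $0$. In particular, if $\delta=0$ then $V_j$ and $V_C$ are exactly $Z$-equivalent to $U_j$ and $U_C$. -/

import Mathlib

/-! ## Adaptive lattice-surgery circuits

A circuit acts on a set `D` of data qubits and on ancilla qubits that start out in `|0⟩`, `|+⟩`,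
`T` or `CCZ` states.  It is a list of (adaptive) Pauli measurements, conditional Pauli gates and
classical Boolean gates.  A two-qubit Pauli measurement takes one logical cycle. -/

namespace LatticeSurgery

/-- The states in which ancilla qubits can be supplied. -/
inductive AncillaState : Type
  | zero
  | plus
  | tState
  | cczState

/-- The number of qubits of an ancilla state. -/
def AncillaState.arity : AncillaState → ℕ
  | .zero => 1
  | .plus => 1
  | .tState => 1
  | .cczState => 3

/-- Amplitudes in the computational basis of `|0⟩`, `|+⟩`, `T|+⟩` and `CCZ|+++⟩`. -/
noncomputable def AncillaState.amplitude : (s : AncillaState) → (Fin s.arity → Bool) → ℂ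
  | .zero, y => if y = fun _ => false then 1 else 0
  | .plus, _ => 1 / (Real.sqrt 2 : ℂ)
  | .tState, y =>
      (if y = fun _ => true then Complex.exp (Complex.I * (Real.pi / 4 : ℝ)) else 1)
        / (Real.sqrt 2 : ℂ)
  | .cczState, y => (if y = fun _ => true then -1 else 1) / (Real.sqrt 8 : ℂ)

/-- Instructions on qubits `Q` and classical bits `B`.  All measurement bases and all Pauli gates
may depend on classical bits, and hence on earlier measurement outcomes. -/
inductive Instr (Q B : Type) : Type
  /-- Measure the Pauli operator `σ(x,z)` on `q` times `σ(x',z')` on `q'`, where the four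
  bits are read from classical memory and `σ(0,0) = I`, `σ(1,0) = X`, `σ(0,1) = Z`, `σ(1,1) = Y`;
  store the outcome in `out`. -/
  | measure2 (q q' : Q) (hq : q ≠ q') (x z x' z' out : B)
  /-- Measure `q` in the `X` basis if the bit `basis` is set, and in the `Z` basis otherwise;
  store the outcome in `out`. -/
  | measure1 (q : Q) (basis out : B)
  /-- Apply `σ(x,z)` to `q`, with `x` and `z` read from classical memory. -/
  | pauli (q : Q) (x z : B)
  /-- Set the bit `out` to `f a b`. -/
  | classical (f : Bool → Bool → Bool) (a b out : B)

namespace Instr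

variable {Q B Q' B' : Type}

/-- Rename qubits and classical bits. -/
def relabel (f : Q ↪ Q') (g : B → B') : Instr Q B → Instr Q' B'
  | .measure2 q q' hq x z x' z' out =>
      .measure2 (f q) (f q') (fun h => hq (f.injective h)) (g x) (g z) (g x') (g z') (g out)
  | .measure1 q basis out => .measure1 (f q) (g basis) (g out)
  | .pauli q x z => .pauli (f q) (g x) (g z)
  | .classical h a b out => .classical h (g a) (g b) (g out)

def isMeasurement : Instr Q B → Bool
  | .measure2 .. => true
  | .measure1 .. => true
  | .pauli .. => false
  | .classical .. => false

end Instr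

section Semantics

variable {Q B : Type} [DecidableEq Q] [DecidableEq B]

/-- The Pauli operator `σ(x,z)` on qubit `q`, acting on amplitude functions. -/
noncomputable def pauliOp (x z : Bool) (q : Q) (ψ : (Q → Bool) → ℂ) : (Q → Bool) → ℂ :=
  fun s => (if z && s q then -1 else 1) * (if x && z then -Complex.I else 1) *
    ψ (if x then Function.update s q (!(s q)) else s)

/-- Contents of the classical memory, and the unnormalized quantum state of one branch. -/
structure Config (Q B : Type) : Type where
  mem : B → Bool
  amp : (Q → Bool) → ℂ

/-- Execute one instruction.  If it is a measurement of `P`, then `o` is the outcome of the branch,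
and the state is multiplied by the projector `(1 + (-1)^o P) / 2`. -/
noncomputable def Instr.step : Instr Q B → Bool → Config Q B → Config Q B
  | .measure2 q q' _ x z x' z' out, o, c =>
      { mem := Function.update c.mem out o
        amp := fun s => (c.amp s + (if o then -1 else 1) *
          pauliOp (c.mem x) (c.mem z) q (pauliOp (c.mem x') (c.mem z') q' c.amp) s) / 2 }
  | .measure1 q basis out, o, c =>
      { mem := Function.update c.mem out o
        amp := fun s => (c.amp s + (if o then -1 else 1) *
          pauliOp (c.mem basis) (!(c.mem basis)) q c.amp s) / 2 }
  | .pauli q x z, _, c => { mem := c.mem, amp := pauliOp (c.mem x) (c.mem z) q c.amp }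
  | .classical f a b out, _, c =>
      { mem := Function.update c.mem out (f (c.mem a) (c.mem b)), amp := c.amp }

/-- Execute a list of instructions along the branch with the given list of outcomes. -/
noncomputable def run : List (Instr Q B) → List Bool → Config Q B → Config Q B
  | [], _, c => c
  | I :: l, os, c =>
      if I.isMeasurement then run l os.tail (I.step (os.headD false) c)
      else run l os (I.step false c)

/-- The logical cycle after which each qubit is free, and each classical bit is known. -/
structure Clock (Q B : Type) : Type where
  qubit : Q → ℕ
  bit : B → ℕ

/-- Schedule one instruction as early as its qubits and the classical bits it reads allow.
A two-qubit measurement takes one logical cycle; single-qubit `X` and `Z` measurements, Pauli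
gates (which are only tracked) and classical gates take none. -/
def Instr.tick (t : Clock Q B) : Instr Q B → Clock Q B
  | .measure2 q q' _ x z x' z' out =>
      let e := max (max (t.qubit q) (t.qubit q'))
        (max (max (t.bit x) (t.bit z)) (max (t.bit x') (t.bit z'))) + 1
      { qubit := Function.update (Function.update t.qubit q e) q' e
        bit := Function.update t.bit out e }
  | .measure1 q basis out =>
      let e := max (t.qubit q) (t.bit basis)
      { qubit := Function.update t.qubit q e, bit := Function.update t.bit out e }
  | .pauli q x z =>
      let e := max (t.qubit q) (max (t.bit x) (t.bit z))
      { qubit := Function.update t.qubit q e, bit := t.bit }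
  | .classical _ a b out =>
      { qubit := t.qubit, bit := Function.update t.bit out (max (t.bit a) (t.bit b)) }

end Semantics

/-- A circuit on the data qubits `D`, with finitely many ancilla states indexed by `R`,
classical bits `B`, and a list of instructions. -/
structure Circuit (D : Type) : Type 1 where
  R : Type
  B : Type
  fintypeR : Fintype R
  decEqR : DecidableEq R
  decEqB : DecidableEq B
  res : R → AncillaState
  instrs : List (Instr (D ⊕ (Σ r : R, Fin (res r).arity)) B)

attribute [instance] Circuit.fintypeR Circuit.decEqR Circuit.decEqB

namespace Circuit

variable {D : Type}

/-- The ancilla qubits of a circuit. -/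
abbrev Anc (V : Circuit D) : Type := Σ r : V.R, Fin (V.res r).arity

/-- The number of ancilla states and instructions (classical gates included). -/
def size (V : Circuit D) : ℕ := Fintype.card V.R + V.instrs.length

/-- The sequences of measurement outcomes. -/
abbrev Outcome (V : Circuit D) : Type := Fin (V.instrs.countP Instr.isMeasurement) → Bool

/-- The total number of logical cycles, when every instruction is executed as early as possible. -/
def logicalDepth [Fintype D] [DecidableEq D] (V : Circuit D) : ℕ :=
  Finset.univ.sup
    (V.instrs.foldl Instr.tick { qubit := fun _ => 0, bit := fun _ => 0 }).qubit

/-- Run the circuit on data state `φ` along the branch `o`: all classical bits start as `0`. -/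
noncomputable def exec [DecidableEq D] (V : Circuit D) (o : V.Outcome) (φ : (D → Bool) → ℂ) :
    Config (D ⊕ V.Anc) V.B :=
  run V.instrs (List.ofFn o)
    { mem := fun _ => false
      amp := fun s => φ (fun d => s (.inl d)) *
        ∏ r, (V.res r).amplitude (fun i => s (.inr ⟨r, i⟩)) }

/-- The state of branch `o` after the Pauli corrections `∏_d ∏_{b ∈ corr d} Z_d ^ b`. -/
noncomputable def corrected [Fintype D] [DecidableEq D] (V : Circuit D)
    (corr : D → Finset V.B) (o : V.Outcome) (φ : (D → Bool) → ℂ) (s : D ⊕ V.Anc → Bool) : ℂ :=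
  (∏ d, ∏ b ∈ corr d, if (V.exec o φ).mem b && s (.inl d) then -1 else 1) * (V.exec o φ).amp s

/-- The circuit `V`, followed by the `Z` corrections `corr`, acts on the data qubits as `U` with
accuracy `δ`: as an isometry into data qubits, ancilla qubits and outcome record it is within
`δ`, in operator norm, of `U ⊗ |χ⟩` for a unit vector `χ` that does not depend on the input. -/
def Realizes [Fintype D] [DecidableEq D] (V : Circuit D) (corr : D → Finset V.B)
    (U : Matrix (D → Bool) (D → Bool) ℂ) (δ : ℝ) : Prop :=
  ∃ χ : V.Outcome → (V.Anc → Bool) → ℂ, (∑ o, ∑ y, ‖χ o y‖ ^ 2 = 1) ∧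
    ∀ φ : (D → Bool) → ℂ,
      ∑ o, ∑ s : D ⊕ V.Anc → Bool,
        ‖V.corrected corr o φ s -
          U.mulVec φ (fun d => s (.inl d)) * χ o (fun a => s (.inr a))‖ ^ 2
        ≤ δ ^ 2 * ∑ x, ‖φ x‖ ^ 2

/-- `V` implements `U` with accuracy `δ`, without any pending correction. -/
def Implements [Fintype D] [DecidableEq D] (V : Circuit D)
    (U : Matrix (D → Bool) (D → Bool) ℂ) (δ : ℝ) : Prop :=
  V.Realizes (fun _ => ∅) U δ

/-- `V` is `Z`-equivalent to `U` with accuracy `δ` (exactly so if `δ = 0`): `U` is `V` followed by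
single-qubit `Z` gates, controlled by sums modulo 2 of classical bits that `V` has computed. -/
def ZEquivalent [Fintype D] [DecidableEq D] (V : Circuit D)
    (U : Matrix (D → Bool) (D → Bool) ℂ) (δ : ℝ) : Prop :=
  ∃ corr : D → Finset V.B, V.Realizes corr U δ

/-- The composition of the circuits `V j` in the order `V (σ 0), V (σ 1), …`.  They share the
data qubits, and each has ancilla qubits and classical bits of its own. -/
def product {m : ℕ} (V : Fin m → Circuit D) (σ : Equiv.Perm (Fin m)) : Circuit D where
  R := Σ j, (V j).R
  B := Σ j, (V j).B
  fintypeR := inferInstance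
  decEqR := inferInstance
  decEqB := inferInstance
  res := fun r => (V r.1).res r.2
  instrs := (List.ofFn σ).flatMap fun j =>
    (V j).instrs.map (Instr.relabel
      ((Function.Embedding.refl D).sumMap
        ⟨fun a => ⟨⟨j, a.1⟩, a.2⟩, by rintro ⟨r, i⟩ ⟨r', i'⟩ h; cases h; rfl⟩)
      (Sigma.mk j))

end Circuit

/-! ## k-SAT phasers -/

/-- A disjunction of `k` literals in `n` variables: `(i, true)` is the literal `xᵢ`,
and `(i, false)` is the literal `¬xᵢ`. -/
abbrev Clause (n k : ℕ) : Type := Fin k → Fin n × Bool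

namespace Clause

variable {n k : ℕ}

/-- The qubits that the clause addresses. -/
def qubits (C : Clause n k) : Finset (Fin n) := Finset.univ.image fun i => (C i).1

/-- `1` if the assignment satisfies the clause, and `0` otherwise. -/
def value (C : Clause n k) (x : Fin n → Bool) : ℕ := if ∃ i, x (C i).1 = (C i).2 then 1 else 0

end Clause

/-- The exponentiated clause `∑_x exp(-iγ C(x)) |x⟩⟨x|`. -/
noncomputable def clauseUnitary {n k : ℕ} (γ : ℝ) (C : Clause n k) :
    Matrix (Fin n → Bool) (Fin n → Bool) ℂ :=
  Matrix.diagonal fun x => Complex.exp (-Complex.I * γ * (C.value x : ℂ))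

/-- The phaser `∏_j U_j`, that is, `∑_x exp(-iγ ∑_j C_j(x)) |x⟩⟨x|`. -/
noncomputable def phaser {n m k : ℕ} (γ : ℝ) (C : Fin m → Clause n k) :
    Matrix (Fin n → Bool) (Fin n → Bool) ℂ :=
  Matrix.diagonal fun x => Complex.exp (-Complex.I * γ * ∑ j, ((C j).value x : ℂ))

/-- The single-qubit phase gate `exp(iγ |1⟩⟨1|)`. -/
noncomputable def phaseGate (γ : ℝ) : Matrix (Unit → Bool) (Unit → Bool) ℂ :=
  Matrix.diagonal fun x => if x () then Complex.exp (Complex.I * γ) else 1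

end LatticeSurgery

open Function

set_option linter.constructorNameAsVariable false
set_option synthInstance.maxSize 2000
set_option linter.unusedSectionVars false

namespace LatticeSurgery

/-! A clause fails exactly when all its literals are false, so `exp(-iγ C(x)) = exp(-iγ) * exp(iγ
f(x))`, where `f` is the conjunction of the negated literals. The constant phase is absorbed into
the ancilla vectors. It remains to write `f x` into an ancilla qubit (the root), to run `P` on the
root, and to erase the root.

Computing. One `ZZ` measurement copies each variable to an ancilla qubit; no later instruction
touches a data qubit. A balanced binary tree of depth `L ≤ ⌈log₂ k⌉` joins the copies. Each node
consumes one CCZ state and adds two cycles (`andPre_amp`, `andPre_clock`).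

Erasing. Measuring the root in the `X` basis with outcome `r` leaves the sign `(-1)^(r f(x))`. At a
node with `f = a ∧ b` this is a `CZ^r` on the two child qubits. Measuring `X ⊗ Z^r` and `Z^r ⊗ X` on
them cancels it and leaves `(-1)^(r₁ a + r₂ b)`, which is the same task one level lower
(`andPost_run`), again for two cycles per level. At the leaves the sign is a Pauli `Z` on a data
qubit, which stays pending as a correction. `Evaluator` packages both passes, `Evaluator.conj` is
the inductive step, and `exists_evaluator` builds the tree.

Accuracy. In every branch the circuit is diagonal on the data, so it suffices to bound the error for
each basis state (`DiagRealizes`, `DiagRealizes.zEquivalent`). Uncomputation is linear in each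
branch and conserves total probability, so it passes on the error of `P` unchanged
(`core_diagRealizes`). Errors of successive circuits add up (`DiagRealizes.append`).

Depth. Delaying all inputs of a list of instructions by `k` cycles delays its outputs by at most `k`
(`foldl_tick_relabel`), so each gadget is timed once, from time zero. A clause circuit needs `1 + 2L
+ n_P + 2L` cycles but holds its data qubits for the first cycle only (`core_clock`). Hence the
circuits of part number `ρ` can start by time `ρ`, their ancilla work overlaps with later parts, and
all is done by `c + n_P + 4⌈log₂ k⌉` (`Circuit.product_clock`). -/

/-! ### Sums over measurement records -/

/-- The sum of `F` over all records of `n` measurement outcomes. -/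
def recordSum {M : Type*} [AddCommMonoid M] (n : ℕ) (F : List Bool → M) : M :=
  ∑ o : Fin n → Bool, F (List.ofFn o)

theorem recordSum_zero {M : Type*} [AddCommMonoid M] (F : List Bool → M) :
    recordSum 0 F = F [] := by
  simp [recordSum]

theorem recordSum_congr {M : Type*} [AddCommMonoid M] {n : ℕ} {F G : List Bool → M}
    (h : ∀ o, o.length = n → F o = G o) : recordSum n F = recordSum n G :=
  Finset.sum_congr rfl fun o _ => h _ (by simp)

theorem recordSum_add {M : Type*} [AddCommMonoid M] (a b : ℕ) (F : List Bool → M) :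
    recordSum (a + b) F = recordSum a fun o => recordSum b fun o' => F (o ++ o') := by
  unfold recordSum
  rw [← Fintype.sum_prod_type', ← (Fin.appendEquiv a b).sum_comp]
  refine Finset.sum_congr rfl fun p _ => ?_
  simp [Fin.appendEquiv, List.ofFn_fin_append]

theorem recordSum_one {M : Type*} [AddCommMonoid M] (F : List Bool → M) :
    recordSum 1 F = F [true] + F [false] := by
  unfold recordSum
  rw [← (Equiv.funUnique (Fin 1) Bool).symm.sum_comp]
  simp

theorem recordSum_mul_left (n : ℕ) (F : List Bool → ℝ) (a : ℝ) :
    recordSum n (fun o => a * F o) = a * recordSum n F := by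
  simp [recordSum, Finset.mul_sum]

theorem recordSum_mul_right (n : ℕ) (F : List Bool → ℝ) (a : ℝ) :
    recordSum n (fun o => F o * a) = recordSum n F * a := by
  simp [recordSum, Finset.sum_mul]

theorem recordSum_mono {n : ℕ} {F G : List Bool → ℝ} (h : ∀ o, F o ≤ G o) :
    recordSum n F ≤ recordSum n G :=
  Finset.sum_le_sum fun _ _ => h _

/-- The squared norm of an amplitude function. -/
noncomputable def normSq {Y : Type} [Fintype Y] (ψ : Y → ℂ) : ℝ := ∑ s, ‖ψ s‖ ^ 2

/-! ### Branches of a run: concatenation, memory, linearity. -/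

section Run

variable {Q B : Type} [DecidableEq Q] [DecidableEq B]

theorem run_append (l₁ l₂ : List (Instr Q B)) (o : List Bool) (c : Config Q B) :
    run (l₁ ++ l₂) o c = run l₂ (o.drop (l₁.countP Instr.isMeasurement)) (run l₁ o c) := by
  induction l₁ generalizing o c with
  | nil => simp [run]
  | cons I l ih =>
    by_cases h : I.isMeasurement = true
    · simp [run, h, ih, Nat.add_comm]
    · simp [run, h, ih]

theorem run_append_left (l : List (Instr Q B)) (o o' : List Bool) (c : Config Q B)
    (h : o.length = l.countP Instr.isMeasurement) : run l (o ++ o') c = run l o c := by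
  induction l generalizing o c with
  | nil => simp [run]
  | cons I l ih =>
    by_cases hI : I.isMeasurement = true
    · cases o with
      | nil => simp [hI] at h
      | cons b o =>
        simp only [List.length_cons, hI, List.countP_cons_of_pos, Nat.add_right_cancel_iff] at h
        simp [run, hI, ih _ _ h]
    · simp only [hI, List.countP_cons_of_neg, not_false_eq_true, Bool.false_eq_true] at h
      simp [run, hI, ih _ _ h]

theorem run_append_append (l₁ l₂ : List (Instr Q B)) (o o' : List Bool) (c : Config Q B)
    (h : o.length = l₁.countP Instr.isMeasurement) :
    run (l₁ ++ l₂) (o ++ o') c = run l₂ o' (run l₁ o c) := by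
  rw [run_append, run_append_left _ _ _ _ h, ← h, List.drop_left]

/-- The Pauli operator as a linear map. -/
noncomputable def pauliLin (x z : Bool) (q : Q) : ((Q → Bool) → ℂ) →ₗ[ℂ] ((Q → Bool) → ℂ) where
  toFun := pauliOp x z q
  map_add' a b := by funext s; simp only [pauliOp, Pi.add_apply]; ring
  map_smul' a b := by funext s; simp only [pauliOp, Pi.smul_apply, smul_eq_mul, RingHom.id_apply]; ring

theorem Instr.step_mem_congr (I : Instr Q B) (o : Bool) (m : B → Bool) (a a' : (Q → Bool) → ℂ) :
    (I.step o ⟨m, a⟩).mem = (I.step o ⟨m, a'⟩).mem := by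
  cases I <;> rfl

/-- Once the outcomes are fixed, no instruction lets a classical bit depend on the amplitudes. So
the bits that control corrections are a function of the record alone and may be computed with zero
amplitudes. -/
theorem run_mem_congr (l : List (Instr Q B)) (o : List Bool) (c c' : Config Q B)
    (h : c.mem = c'.mem) : (run l o c).mem = (run l o c').mem := by
  induction l generalizing o c c' with
  | nil => simpa [run] using h
  | cons I l ih =>
    obtain ⟨m, a⟩ := c
    obtain ⟨m', a'⟩ := c'
    obtain rfl : m = m' := h
    simp only [run]
    split_ifs
    · exact ih _ _ _ (I.step_mem_congr _ _ _ _)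
    · exact ih _ _ _ (I.step_mem_congr _ _ _ _)

theorem Instr.exists_linear_step (I : Instr Q B) (o : Bool) (m : B → Bool) :
    ∃ T : ((Q → Bool) → ℂ) →ₗ[ℂ] ((Q → Bool) → ℂ), ∀ a, (I.step o ⟨m, a⟩).amp = T a := by
  cases I with
  | measure2 q q' hq x z x' z' out =>
    refine ⟨(2 : ℂ)⁻¹ • (LinearMap.id + (if o then (-1 : ℂ) else 1) •
      (pauliLin (m x) (m z) q ∘ₗ pauliLin (m x') (m z') q')), fun a => ?_⟩
    funext s
    simp only [Instr.step, LinearMap.smul_apply, LinearMap.add_apply, Pi.smul_apply,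
      Pi.add_apply, smul_eq_mul, LinearMap.id_apply, LinearMap.comp_apply, pauliLin,
      LinearMap.coe_mk, AddHom.coe_mk]
    ring
  | measure1 q basis out =>
    refine ⟨(2 : ℂ)⁻¹ • (LinearMap.id + (if o then (-1 : ℂ) else 1) •
      pauliLin (m basis) (!(m basis)) q), fun a => ?_⟩
    funext s
    simp only [Instr.step, LinearMap.smul_apply, LinearMap.add_apply, Pi.smul_apply,
      Pi.add_apply, smul_eq_mul, LinearMap.id_apply, pauliLin, LinearMap.coe_mk, AddHom.coe_mk]
    ring
  | pauli q x z => exact ⟨pauliLin (m x) (m z) q, fun a => rfl⟩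
  | classical f a b out => exact ⟨LinearMap.id, fun a => rfl⟩

/-- The record and the initial memory determine every basis and every Pauli gate, so a branch is a
composition of fixed linear maps. This serves both to superpose basis states and to propagate the
error of `P`. -/
theorem exists_linear_run (l : List (Instr Q B)) (o : List Bool) (m : B → Bool) :
    ∃ T : ((Q → Bool) → ℂ) →ₗ[ℂ] ((Q → Bool) → ℂ), ∀ a, (run l o ⟨m, a⟩).amp = T a := by
  induction l generalizing o m with
  | nil => exact ⟨LinearMap.id, fun a => rfl⟩
  | cons I l ih =>
    have key : ∀ b o', ∃ T : ((Q → Bool) → ℂ) →ₗ[ℂ] ((Q → Bool) → ℂ),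
        ∀ a, (run l o' (I.step b ⟨m, a⟩)).amp = T a := by
      intro b o'
      obtain ⟨T₁, h₁⟩ := I.exists_linear_step b m
      obtain ⟨T₂, h₂⟩ := ih o' (I.step b ⟨m, fun _ => 0⟩).mem
      refine ⟨T₂ ∘ₗ T₁, fun a => ?_⟩
      rw [LinearMap.comp_apply, ← h₁, ← h₂, I.step_mem_congr b m _ a]
    simp only [run]
    split_ifs
    · exact key _ _
    · exact key _ _

end Run

/-! ### Conservation of probability. -/

section Norm

variable {Q B : Type} [Fintype Q] [DecidableEq Q] [DecidableEq B]

theorem normSq_pauliOp (x z : Bool) (q : Q) (ψ : (Q → Bool) → ℂ) :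
    normSq (pauliOp x z q ψ) = normSq ψ := by
  have hn : ∀ s, ‖pauliOp x z q ψ s‖ ^ 2 =
      ‖ψ (if x then update s q (!(s q)) else s)‖ ^ 2 := by
    intro s
    simp only [pauliOp, norm_mul]
    have h1 : ‖(if (z && s q) = true then (-1 : ℂ) else 1)‖ = 1 := by split_ifs <;> simp
    have h2 : ‖(if (x && z) = true then -Complex.I else 1)‖ = 1 := by split_ifs <;> simp
    rw [h1, h2, one_mul, one_mul]
  unfold normSq
  simp only [hn]
  cases x with
  | false => simp
  | true =>
    have hinv : Function.Involutive fun s : Q → Bool => update s q (!(s q)) := by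
      intro s; simp
    simpa using Equiv.sum_comp (hinv.toPerm _) (fun s => ‖ψ s‖ ^ 2)

/-- This is the parallelogram law; it needs only that the Pauli operator preserves the norm, not
that `(1 ± P) / 2` are projections. -/
theorem normSq_projectors (ψ P : (Q → Bool) → ℂ) (h : normSq P = normSq ψ) :
    normSq (fun s => (ψ s + (-1) * P s) / 2) + normSq (fun s => (ψ s + 1 * P s) / 2)
      = normSq ψ := by
  have key : ∀ s, ‖(ψ s + (-1) * P s) / 2‖ ^ 2 + ‖(ψ s + 1 * P s) / 2‖ ^ 2
      = (‖ψ s‖ ^ 2 + ‖P s‖ ^ 2) / 2 := by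
    intro s
    have := parallelogram_law_with_norm ℝ (ψ s) (P s)
    rw [norm_div, norm_div, neg_one_mul, one_mul, ← sub_eq_add_neg, Complex.norm_ofNat]
    nlinarith
  unfold normSq at *
  rw [← Finset.sum_add_distrib, Finset.sum_congr rfl fun s _ => key s, ← Finset.sum_div,
    Finset.sum_add_distrib, h]
  ring

theorem Instr.normSq_step_measurement (I : Instr Q B) (hI : I.isMeasurement = true)
    (c : Config Q B) :
    normSq (I.step true c).amp + normSq (I.step false c).amp = normSq c.amp := by
  cases I with
  | measure2 q q' hq x z x' z' out =>
    simpa [Instr.step] using normSq_projectors c.amp _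
      ((normSq_pauliOp _ _ q _).trans (normSq_pauliOp (c.mem x') (c.mem z') q' c.amp))
  | measure1 q basis out =>
    simpa [Instr.step] using normSq_projectors c.amp _
      (normSq_pauliOp (c.mem basis) (!(c.mem basis)) q c.amp)
  | pauli => simp [Instr.isMeasurement] at hI
  | classical => simp [Instr.isMeasurement] at hI

theorem Instr.normSq_step_of_not_measurement (I : Instr Q B) (hI : ¬ I.isMeasurement = true)
    (o : Bool) (c : Config Q B) : normSq (I.step o c).amp = normSq c.amp := by
  cases I with
  | measure2 => simp [Instr.isMeasurement] at hI
  | measure1 => simp [Instr.isMeasurement] at hI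
  | pauli => exact normSq_pauliOp _ _ _ _
  | classical => rfl

/-- The total probability of all branches is conserved. -/
theorem recordSum_normSq_run (l : List (Instr Q B)) (c : Config Q B) :
    recordSum (l.countP Instr.isMeasurement) (fun o => normSq (run l o c).amp)
      = normSq c.amp := by
  induction l generalizing c with
  | nil => simp [recordSum_zero, run]
  | cons I l ih =>
    by_cases hI : I.isMeasurement = true
    · rw [List.countP_cons_of_pos hI, Nat.add_comm, recordSum_add, recordSum_one]
      simp only [run, hI, if_true, List.cons_append, List.nil_append, List.tail_cons,
        List.headD_cons]
      rw [ih, ih, I.normSq_step_measurement hI]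
    · rw [List.countP_cons_of_neg hI]
      simp only [run, hI, if_false, Bool.false_eq_true]
      rw [ih, I.normSq_step_of_not_measurement hI]

end Norm

/-! ### Frame rules: running a gadget inside a larger system. -/

section Relabel

variable {Q B Q' B' : Type}

theorem Instr.isMeasurement_relabel (f : Q ↪ Q') (g : B → B') (I : Instr Q B) :
    (I.relabel f g).isMeasurement = I.isMeasurement := by
  cases I <;> rfl

theorem countP_map_relabel (f : Q ↪ Q') (g : B → B') (l : List (Instr Q B)) :
    (l.map (Instr.relabel f g)).countP Instr.isMeasurement = l.countP Instr.isMeasurement := by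
  rw [List.countP_map]
  exact List.countP_congr fun I _ => by simp [Instr.isMeasurement_relabel]

theorem Instr.relabel_relabel {Q'' B'' : Type} (f : Q ↪ Q') (g : B → B') (f' : Q' ↪ Q'')
    (g' : B' → B'') (I : Instr Q B) :
    (I.relabel f g).relabel f' g' = I.relabel (f.trans f') (g' ∘ g) := by
  cases I <;> rfl

variable [DecidableEq Q] [DecidableEq B] [DecidableEq Q'] [DecidableEq B']

/-- `c'` looks like `c` on the qubits and bits that are relabelled by `f` and `g`; the remaining
qubits contribute the factor `R`. -/
structure Extends (f : Q ↪ Q') (g : B → B') (c : Config Q B) (c' : Config Q' B')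
    (R : (Q' → Bool) → ℂ) : Prop where
  mem : ∀ b, c'.mem (g b) = c.mem b
  amp : ∀ s, c'.amp s = c.amp (s ∘ f) * R s

theorem pauliOp_relabel (f : Q ↪ Q') (R : (Q' → Bool) → ℂ)
    (hR : ∀ s q v, R (update s (f q) v) = R s) (x z : Bool) (q : Q) (a : (Q → Bool) → ℂ)
    (a' : (Q' → Bool) → ℂ) (h : ∀ s, a' s = a (s ∘ f) * R s) (s : Q' → Bool) :
    pauliOp x z (f q) a' s = pauliOp x z q a (s ∘ f) * R s := by
  have hu : ∀ v, update s (f q) v ∘ f = update (s ∘ f) q v := fun v =>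
    update_comp_eq_of_injective s f.injective q v
  cases x <;> simp [pauliOp, h, hR, hu, mul_assoc]

theorem Instr.step_relabel (f : Q ↪ Q') (g : B → B') (hg : Injective g) (R : (Q' → Bool) → ℂ)
    (hR : ∀ s q v, R (update s (f q) v) = R s) (I : Instr Q B) (o : Bool) (c : Config Q B)
    (c' : Config Q' B') (h : Extends f g c c' R) :
    Extends f g (I.step o c) ((I.relabel f g).step o c') R ∧
      ∀ b', b' ∉ Set.range g → ((I.relabel f g).step o c').mem b' = c'.mem b' := by
  have hmem : ∀ (m' : B' → Bool) (m : B → Bool) (out : B) (v : Bool),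
      (∀ b, m' (g b) = m b) → ∀ b, update m' (g out) v (g b) = update m out v b := by
    intro m' m out v h b
    by_cases hb : b = out
    · subst hb; simp
    · rw [update_of_ne hb, update_of_ne (hg.ne hb), h]
  have hout : ∀ (m' : B' → Bool) (out : B) (v : Bool) (b' : B'), b' ∉ Set.range g →
      update m' (g out) v b' = m' b' := by
    intro m' out v b' hb
    rw [update_of_ne]
    rintro rfl
    exact hb ⟨out, rfl⟩
  cases I with
  | measure2 q q' hq x z x' z' out =>
    refine ⟨⟨hmem _ _ _ _ h.mem, fun s => ?_⟩, hout _ _ _⟩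
    simp only [Instr.step, Instr.relabel, h.mem]
    rw [pauliOp_relabel f R hR _ _ q _ _
      (fun s => pauliOp_relabel f R hR _ _ q' _ _ h.amp s), h.amp]
    ring
  | measure1 q basis out =>
    refine ⟨⟨hmem _ _ _ _ h.mem, fun s => ?_⟩, hout _ _ _⟩
    simp only [Instr.step, Instr.relabel, h.mem]
    rw [pauliOp_relabel f R hR _ _ q _ _ h.amp, h.amp]
    ring
  | pauli q x z =>
    refine ⟨⟨h.mem, fun s => ?_⟩, fun _ _ => rfl⟩
    simp only [Instr.step, Instr.relabel, h.mem]
    rw [pauliOp_relabel f R hR _ _ q _ _ h.amp]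
  | classical k a b out =>
    refine ⟨⟨?_, h.amp⟩, hout _ _ _⟩
    simp only [Instr.step, Instr.relabel, h.mem]
    exact hmem _ _ _ _ h.mem

/-- Frame rule: instructions on relabelled qubits and bits leave the rest of the state alone. -/
theorem run_relabel (f : Q ↪ Q') (g : B → B') (hg : Injective g) (R : (Q' → Bool) → ℂ)
    (hR : ∀ s q v, R (update s (f q) v) = R s) (l : List (Instr Q B)) (o : List Bool)
    (c : Config Q B) (c' : Config Q' B') (h : Extends f g c c' R) :
    Extends f g (run l o c) (run (l.map (Instr.relabel f g)) o c') R ∧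
      ∀ b', b' ∉ Set.range g → (run (l.map (Instr.relabel f g)) o c').mem b' = c'.mem b' := by
  induction l generalizing o c c' with
  | nil => exact ⟨h, fun _ _ => rfl⟩
  | cons I l ih =>
    simp only [run, List.map_cons, Instr.isMeasurement_relabel]
    have key : ∀ v o', Extends f g (run l o' (I.step v c))
        (run (l.map (Instr.relabel f g)) o' ((I.relabel f g).step v c')) R ∧
        ∀ b', b' ∉ Set.range g → (run (l.map (Instr.relabel f g)) o'
          ((I.relabel f g).step v c')).mem b' = c'.mem b' := by
      intro v o'
      have h1 := I.step_relabel f g hg R hR v c c' h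
      have h2 := ih o' _ _ h1.1
      exact ⟨h2.1, fun b' hb => (h2.2 b' hb).trans (h1.2 b' hb)⟩
    split_ifs
    · exact key _ _
    · exact key _ _

end Relabel

/-- Frame rule for the contents of the classical memory alone. -/
theorem run_relabel_mem {Q B Q' B' : Type} [DecidableEq Q] [DecidableEq B] [DecidableEq Q']
    [DecidableEq B'] (f : Q ↪ Q') (g : B → B') (hg : Injective g) (l : List (Instr Q B))
    (o : List Bool) (c : Config Q B) (c' : Config Q' B') (h : ∀ b, c'.mem (g b) = c.mem b) :
    (∀ b, (run (l.map (Instr.relabel f g)) o c').mem (g b) = (run l o c).mem b) ∧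
      ∀ b', b' ∉ Set.range g → (run (l.map (Instr.relabel f g)) o c').mem b' = c'.mem b' := by
  -- Zero amplitudes with the factor `R = 0` make the amplitude half of `Extends` trivial, and
  -- memory does not see amplitudes.
  have key := run_relabel f g hg (fun _ => 0) (fun _ _ _ => rfl) l o c ⟨c'.mem, fun _ => 0⟩
    ⟨h, fun s => by simp⟩
  rw [run_mem_congr _ _ c' ⟨c'.mem, fun _ => 0⟩ rfl]
  exact ⟨key.1.mem, key.2⟩

/-! ### Scheduling -/

/-- All qubits and classical bits are available at time `0`. -/
def Clock.zero (Q B : Type) : Clock Q B := { qubit := fun _ => 0, bit := fun _ => 0 }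

section Clock

variable {Q B Q' B' : Type}

/-- On the relabelled qubits and bits, `t'` is at most `k` cycles behind `t`. -/
structure Clock.Delayed (f : Q → Q') (g : B → B') (k : ℕ) (t : Clock Q B) (t' : Clock Q' B') :
    Prop where
  qubit : ∀ q, t'.qubit (f q) ≤ t.qubit q + k
  bit : ∀ b, t'.bit (g b) ≤ t.bit b + k

/-- `t'` and `t''` agree on the qubits and bits that do not come from `f` and `g`. -/
structure Clock.AgreeOff (f : Q → Q') (g : B → B') (t' t'' : Clock Q' B') : Prop where
  qubit : ∀ q, q ∉ Set.range f → t''.qubit q = t'.qubit q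
  bit : ∀ b, b ∉ Set.range g → t''.bit b = t'.bit b

variable [DecidableEq Q] [DecidableEq B] [DecidableEq Q'] [DecidableEq B']

theorem update_le_update_add {α β : Type} [DecidableEq α] [DecidableEq β] (f : α → β)
    (hf : Injective f) (t : α → ℕ) (t' : β → ℕ) (k : ℕ) (h : ∀ a, t' (f a) ≤ t a + k)
    (a₀ : α) (v v' : ℕ) (hv : v' ≤ v + k) (a : α) :
    update t' (f a₀) v' (f a) ≤ update t a₀ v a + k := by
  by_cases ha : a = a₀
  · subst ha; simpa using hv
  · rw [update_of_ne ha, update_of_ne (hf.ne ha)]; exact h a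

theorem update_apply_of_notMem_range {α β γ : Type} [DecidableEq β] (f : α → β) (t : β → γ)
    (a : α) (v : γ) (b : β) (hb : b ∉ Set.range f) : update t (f a) v b = t b := by
  rw [update_of_ne]
  rintro rfl
  exact hb ⟨a, rfl⟩

theorem max_le_max_add {a b a' b' k : ℕ} (ha : a' ≤ a + k) (hb : b' ≤ b + k) :
    max a' b' ≤ max a b + k := by
  omega

/-- Clock updates use only maxima and the increment by one, and both commute with adding a constant
delay `k`. -/
theorem Instr.tick_relabel (f : Q ↪ Q') (g : B → B') (hg : Injective g) (k : ℕ) (I : Instr Q B)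
    (t : Clock Q B) (t' : Clock Q' B') (h : Clock.Delayed f g k t t') :
    Clock.Delayed f g k (I.tick t) ((I.relabel f g).tick t') ∧
      Clock.AgreeOff f g t' ((I.relabel f g).tick t') := by
  have hq := h.qubit
  have hb := h.bit
  cases I with
  | measure2 q q' hqq x z x' z' out =>
    have he := Nat.add_le_add_right (max_le_max_add (max_le_max_add (hq q) (hq q'))
      (max_le_max_add (max_le_max_add (hb x) (hb z)) (max_le_max_add (hb x') (hb z')))) 1
    rw [Nat.add_right_comm] at he
    simp only [Instr.tick, Instr.relabel]
    refine ⟨⟨fun a => ?_, fun b => ?_⟩, ⟨fun a ha => ?_, fun b hb => ?_⟩⟩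
    · apply update_le_update_add f f.injective
      · intro a
        apply update_le_update_add f f.injective _ _ k hq
        exact he
      · exact he
    · apply update_le_update_add g hg _ _ k hb
      exact he
    · dsimp only
      rw [update_apply_of_notMem_range f _ _ _ _ ha, update_apply_of_notMem_range f _ _ _ _ ha]
    · exact update_apply_of_notMem_range g _ _ _ _ hb
  | measure1 q basis out =>
    have := hq q; have := hb basis
    simp only [Instr.tick, Instr.relabel]
    refine ⟨⟨fun a => ?_, fun b => ?_⟩, ⟨fun a ha => ?_, fun b hb => ?_⟩⟩
    · apply update_le_update_add f f.injective _ _ k hq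
      omega
    · apply update_le_update_add g hg _ _ k hb
      omega
    · exact update_apply_of_notMem_range f _ _ _ _ ha
    · exact update_apply_of_notMem_range g _ _ _ _ hb
  | pauli q x z =>
    have := hq q; have := hb x; have := hb z
    simp only [Instr.tick, Instr.relabel]
    refine ⟨⟨fun a => ?_, hb⟩, ⟨fun a ha => ?_, fun b hb => rfl⟩⟩
    · apply update_le_update_add f f.injective _ _ k hq
      omega
    · exact update_apply_of_notMem_range f _ _ _ _ ha
  | classical F a b out =>
    have := hb a; have := hb b
    simp only [Instr.tick, Instr.relabel]
    refine ⟨⟨hq, fun b => ?_⟩, ⟨fun a ha => rfl, fun b hb => ?_⟩⟩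
    · apply update_le_update_add g hg _ _ k hb
      omega
    · exact update_apply_of_notMem_range g _ _ _ _ hb

theorem foldl_tick_relabel (f : Q ↪ Q') (g : B → B') (hg : Injective g) (k : ℕ)
    (l : List (Instr Q B)) (t : Clock Q B) (t' : Clock Q' B') (h : Clock.Delayed f g k t t') :
    Clock.Delayed f g k (l.foldl Instr.tick t)
        ((l.map (Instr.relabel f g)).foldl Instr.tick t') ∧
      Clock.AgreeOff f g t' ((l.map (Instr.relabel f g)).foldl Instr.tick t') := by
  induction l generalizing t t' with
  | nil => exact ⟨h, fun _ _ => rfl, fun _ _ => rfl⟩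
  | cons I l ih =>
    have h1 := I.tick_relabel f g hg k t t' h
    have h2 := ih _ _ h1.1
    exact ⟨h2.1, fun q hq => (h2.2.qubit q hq).trans (h1.2.qubit q hq),
      fun b hb => (h2.2.bit b hb).trans (h1.2.bit b hb)⟩

end Clock

/-! ### Gadgets -/

/-- `1` if the two bits agree, and `0` otherwise. -/
def ind (b c : Bool) : ℂ := if b = c then 1 else 0

/-- `(-1) ^ b`. -/
def sgn (b : Bool) : ℂ := if b then -1 else 1

@[simp] theorem sgn_true : sgn true = -1 := rfl
@[simp] theorem sgn_false : sgn false = 1 := rfl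
@[simp] theorem ind_self (b : Bool) : ind b b = 1 := by simp [ind]
@[simp] theorem ind_true_false : ind true false = 0 := rfl
@[simp] theorem ind_false_true : ind false true = 0 := rfl

/-- The amplitude of `|0⟩` and of `|1⟩` in `|+⟩`. -/
noncomputable def plusAmp : ℂ := 1 / (Real.sqrt 2 : ℂ)

inductive AndQubit
  | p | q | x | y | z | t | u
  deriving DecidableEq

inductive AndBit
  | zero | one | px | qy | zt | z | tu | xt | x | yu | y | u | a₁ | a₂ | a₃ | a₄
  deriving DecidableEq

open AndQubit in
/-- Computes into `t` the conjunction of the bits of `p` and `q`, consuming a CCZ state on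
`x, y, z`, a state `|+⟩` on `t`, and a state `|0⟩` on `u`. -/
def andPre : List (Instr AndQubit AndBit) :=
  [ .classical (fun _ _ => true) .zero .zero .one,
    .measure2 p x (by decide) .zero .one .zero .one .px,
    .measure2 q y (by decide) .zero .one .zero .one .qy,
    .measure2 z t (by decide) .one .zero .zero .one .zt,
    .measure1 z .zero .z,
    .pauli t .zt .zero,
    .pauli t .zero .z,
    .measure2 t u (by decide) .one .zero .one .zero .tu,
    .measure2 x t (by decide) .one .zero .qy .zero .xt,
    .measure1 x .zero .x,
    .measure2 y u (by decide) .one .zero .px .zero .yu,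
    .measure1 y .zero .y,
    .measure1 u .zero .u,
    .classical and .px .qy .a₁,
    .classical and .px .y .a₂,
    .classical and .qy .x .a₃,
    .classical and .px .tu .a₄,
    .pauli t .u .zero,
    .pauli t .a₁ .zero,
    .pauli t .a₂ .zero,
    .pauli t .a₃ .zero,
    .pauli p .zero .xt,
    .pauli q .zero .yu,
    .pauli q .zero .a₄ ]

theorem pauliOp_Z {Q : Type} [DecidableEq Q] (z : Bool) (q : Q) (ψ : (Q → Bool) → ℂ)
    (s : Q → Bool) : pauliOp false z q ψ s = sgn (z && s q) * ψ s := by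
  simp [pauliOp, sgn]

theorem pauliOp_X {Q : Type} [DecidableEq Q] (x : Bool) (q : Q) (ψ : (Q → Bool) → ℂ)
    (s : Q → Bool) : pauliOp x false q ψ s = ψ (update s q (s q ^^ x)) := by
  cases x <;> simp [pauliOp]

/-- The projection onto the outcome `o` of the measurement of `σ(x,z)` on `q`. -/
noncomputable def proj1 {Q : Type} [DecidableEq Q] (x z : Bool) (q : Q) (o : Bool)
    (ψ : (Q → Bool) → ℂ) : (Q → Bool) → ℂ :=
  fun s => (ψ s + sgn o * pauliOp x z q ψ s) / 2

/-- The projection onto the outcome `o` of the measurement of `σ(x,z)` on `q` times `σ(x',z')`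
on `q'`. -/
noncomputable def proj2 {Q : Type} [DecidableEq Q] (x z : Bool) (q : Q) (x' z' : Bool) (q' : Q)
    (o : Bool) (ψ : (Q → Bool) → ℂ) : (Q → Bool) → ℂ :=
  fun s => (ψ s + sgn o * pauliOp x z q (pauliOp x' z' q' ψ) s) / 2

section Step

variable {Q B : Type} [DecidableEq Q] [DecidableEq B]

theorem run_measure2 (q q' : Q) (hq : q ≠ q') (x z x' z' out : B) (l : List (Instr Q B))
    (o : List Bool) (m : B → Bool) (ψ : (Q → Bool) → ℂ) :
    run (.measure2 q q' hq x z x' z' out :: l) o ⟨m, ψ⟩ =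
      run l o.tail ⟨update m out (o.headD false),
        proj2 (m x) (m z) q (m x') (m z') q' (o.headD false) ψ⟩ := rfl

theorem run_measure1 (q : Q) (basis out : B) (l : List (Instr Q B))
    (o : List Bool) (m : B → Bool) (ψ : (Q → Bool) → ℂ) :
    run (.measure1 q basis out :: l) o ⟨m, ψ⟩ =
      run l o.tail ⟨update m out (o.headD false),
        proj1 (m basis) (!(m basis)) q (o.headD false) ψ⟩ := rfl

theorem run_pauli (q : Q) (x z : B) (l : List (Instr Q B))
    (o : List Bool) (m : B → Bool) (ψ : (Q → Bool) → ℂ) :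
    run (.pauli q x z :: l) o ⟨m, ψ⟩ = run l o ⟨m, pauliOp (m x) (m z) q ψ⟩ := rfl

theorem run_classical (f : Bool → Bool → Bool) (a b out : B) (l : List (Instr Q B))
    (o : List Bool) (m : B → Bool) (ψ : (Q → Bool) → ℂ) :
    run (.classical f a b out :: l) o ⟨m, ψ⟩ = run l o ⟨update m out (f (m a) (m b)), ψ⟩ := rfl

theorem run_nil (o : List Bool) (c : Config Q B) : run [] o c = c := rfl

theorem proj2_ZZ (q q' : Q) (o : Bool) (ψ : (Q → Bool) → ℂ) :
    proj2 false true q false true q' o ψ = fun s => ψ s * ind (s q ^^ s q') o := by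
  funext s
  simp only [proj2, pauliOp_Z]
  cases s q <;> cases s q' <;> cases o <;> simp

theorem proj1_Z (q : Q) (o : Bool) (ψ : (Q → Bool) → ℂ) :
    proj1 false true q o ψ = fun s => ψ s * ind (s q) o := by
  funext s
  simp only [proj1, pauliOp_Z]
  cases s q <;> cases o <;> simp

end Step

theorem sgn_and_mul (o b c : Bool) : sgn (o && b) * sgn (o && c) = sgn (o && (b ^^ c)) := by
  cases o <;> cases b <;> cases c <;> simp

theorem xor_xor_cancel (b c : Bool) : (b ^^ (b ^^ c)) = c := by
  cases b <;> cases c <;> rfl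

theorem ind_xor_left (b c d : Bool) : ind (b ^^ c) d = ind b (d ^^ c) := by
  cases b <;> cases c <;> cases d <;> rfl

/-- With `X = p ⊕ o₁` and `Y = q ⊕ o₂` this is `pq = XY ⊕ o₂X ⊕ o₁Y ⊕ o₁o₂`. The measurements have
added `o₂(X ⊕ o₆)` and `o₁(Y ⊕ o₈)`; the remaining terms are known bits, which `X` gates on `t`
supply. -/
theorem ind_and_correction (p q o₁ o₂ o₆ o₈ t u : Bool) :
    ind (t ^^ (o₂ && o₆) ^^ (o₁ && o₈) ^^ (o₁ && o₂) ^^ u)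
      (((p ^^ o₁) && (q ^^ o₂)) ^^ (u ^^ (o₁ && (q ^^ o₂ ^^ o₈))) ^^ (o₂ && (p ^^ o₁ ^^ o₆)))
      = ind t (p && q) := by
  have h : ∀ p q o₁ o₂ o₆ o₈ t u : Bool,
      ((t ^^ (o₂ && o₆) ^^ (o₁ && o₈) ^^ (o₁ && o₂) ^^ u) =
        (((p ^^ o₁) && (q ^^ o₂)) ^^ (u ^^ (o₁ && (q ^^ o₂ ^^ o₈))) ^^
          (o₂ && (p ^^ o₁ ^^ o₆)))) ↔ t = (p && q) := by
    decide
  simp only [ind, h p q o₁ o₂ o₆ o₈ t u]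

/-- The residual factor `J` is chosen before `a` and `b`: all by-products are independent of the
inputs, as the input-independent vectors `χ` will require. The scalar `κ` carries normalizations,
among them the uniform amplitude of `|+⟩` on `t`. -/
theorem andPre_amp (o : List Bool) : ∃ J : Bool → Bool → Bool → Bool → ℂ,
    ∀ (a b : Bool) (κ : ℂ), (run andPre o ⟨fun _ => false, fun s =>
      ind (s .p) a * ind (s .q) b * sgn (s .x && s .y && s .z) * ind (s .u) false * κ⟩).amp =
      fun s => ind (s .p) a * ind (s .q) b * ind (s .t) (a && b) *
        (J (s .x) (s .y) (s .z) (s .u) * κ) := by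
  simp only [andPre, run_measure2, run_measure1, run_pauli, run_classical, run_nil]
  -- In order of measurement the outcomes belong to `px`, `qy`, `zt`, `z`, `tu`, `xt`, `x`, `yu`,
  -- `y`, `u`, and are named `o₁, o₂, o₃, o₀, o₄, …, o₉`.
  generalize o.headD false = o₁
  generalize o.tail.headD false = o₂
  generalize o.tail.tail.headD false = o₃
  generalize o.tail.tail.tail.headD false = o₀
  generalize o.tail.tail.tail.tail.headD false = o₄
  generalize o.tail.tail.tail.tail.tail.headD false = o₅
  generalize o.tail.tail.tail.tail.tail.tail.headD false = o₆
  generalize o.tail.tail.tail.tail.tail.tail.tail.headD false = o₇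
  generalize o.tail.tail.tail.tail.tail.tail.tail.tail.headD false = o₈
  generalize o.tail.tail.tail.tail.tail.tail.tail.tail.tail.headD false = o₉
  simp only [ne_eq, reduceCtorEq, not_false_eq_true, update_of_ne, update_self,
    Bool.not_false]
  refine ⟨fun x y z u => ind x o₆ * ind y o₈ * ind z o₀ * ind u o₉ * (1 / 8) *
    sgn (o₅ && (o₁ ^^ o₆)) * sgn (o₇ && (o₂ ^^ o₈)) * sgn (o₄ && (o₉ ^^ (o₁ && (o₂ ^^ o₈)))),
    fun a b κ => ?_⟩
  -- The two `ZZ` measurements fix `x = a ⊕ o₁` and `y = b ⊕ o₂`, so the CCZ sign leaves `z` in an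
  -- `X` eigenstate that encodes their product.
  have h₁ : (fun s : AndQubit → Bool => ind (s .p) a * ind (s .q) b *
      sgn (s .x && s .y && s .z) * ind (s .u) false * κ * ind (s .p ^^ s .x) o₁ *
      ind (s .q ^^ s .y) o₂) = fun s => ind (s .p) a * ind (s .q) b * ind (s .x) (a ^^ o₁) *
      ind (s .y) (b ^^ o₂) * (sgn ((a ^^ o₁) && (b ^^ o₂) && s .z) * ind (s .u) false * κ) := by
    funext s
    generalize s .p = p; generalize s .q = q; generalize s .x = x; generalize s .y = y
    by_cases hp : p = a
    · by_cases hq : q = b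
      · subst hp hq
        cases p <;> cases x <;> cases o₁ <;> simp <;> cases q <;> cases y <;> cases o₂ <;> simp
      · simp [ind, hq]
    · simp [ind, hp]
  rw [proj2_ZZ, proj2_ZZ, h₁]
  clear h₁
  generalize hX : (a ^^ o₁) = X
  generalize hY : (b ^^ o₂) = Y
  -- Measuring `X_z Z_t` and then `Z_z` transfers the product from the `X` basis of `z` to the `Z`
  -- basis of `t`, up to a bit flip `o₃` and a sign `(-1)^(o₀ XY)`, which `h₃` removes.
  have h₂ : proj1 false true AndQubit.z o₀ (proj2 true false .z false true .t o₃
      fun s => ind (s .p) a * ind (s .q) b * ind (s .x) X * ind (s .y) Y *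
        (sgn (X && Y && s .z) * ind (s .u) false * κ)) = fun s =>
      ind (s .p) a * ind (s .q) b * ind (s .x) X * ind (s .y) Y *
        (sgn (o₀ && (X && Y)) * ind (s .z) o₀ * ind (s .t) ((X && Y) ^^ o₃) *
          ind (s .u) false * κ) := by
    rw [proj1_Z]
    funext s
    simp only [proj2, pauliOp_X, pauliOp_Z, ne_eq, reduceCtorEq, not_false_eq_true,
      update_of_ne, update_self, Bool.true_and]
    generalize (X && Y) = v
    generalize s .z = z; generalize s .t = t
    by_cases hz : z = o₀
    · subst hz
      cases v <;> cases z <;> cases t <;> cases o₃ <;> simp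
    · simp [ind, hz]
  have h₃ : pauliOp false o₀ AndQubit.t (pauliOp o₃ false .t fun s =>
      ind (s .p) a * ind (s .q) b * ind (s .x) X * ind (s .y) Y *
        (sgn (o₀ && (X && Y)) * ind (s .z) o₀ * ind (s .t) ((X && Y) ^^ o₃) *
          ind (s .u) false * κ)) = fun s =>
      ind (s .p) a * ind (s .q) b * ind (s .x) X * ind (s .y) Y *
        (ind (s .z) o₀ * ind (s .t) (X && Y) * ind (s .u) false * κ) := by
    funext s
    simp only [pauliOp_X, pauliOp_Z, ne_eq, reduceCtorEq, not_false_eq_true,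
      update_of_ne, update_self]
    generalize (X && Y) = v
    generalize s .t = t
    cases v <;> cases t <;> cases o₃ <;> simp <;> cases o₀ <;> simp
  rw [h₂, h₃]
  clear h₂ h₃
  generalize hv : (X && Y) = v
  -- The `XX` measurement spreads `v` over the parity of `t` and `u`. The two linear corrections can
  -- then act on different qubits in the same cycle.
  have h₄ : proj2 true false AndQubit.t true false .u o₄ (fun s =>
      ind (s .p) a * ind (s .q) b * ind (s .x) X * ind (s .y) Y *
        (ind (s .z) o₀ * ind (s .t) v * ind (s .u) false * κ)) = fun s =>
      ind (s .p) a * ind (s .q) b * ind (s .x) X * ind (s .y) Y *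
        (ind (s .z) o₀ * ind (s .t) (v ^^ s .u) * sgn (o₄ && s .u) * (κ / 2)) := by
    funext s
    simp only [proj2, pauliOp_X, ne_eq, reduceCtorEq, not_false_eq_true,
      update_of_ne, update_self]
    generalize s .t = t; generalize s .u = u
    cases v <;> cases t <;> cases u <;> cases o₄ <;> simp <;> ring
  -- Measuring `X_x X_t^{o₂}` and then `Z_x` consumes `x` and adds `o₂(X ⊕ o₆)` to `t`, at the cost
  -- of the sign `(-1)^(o₅(X ⊕ o₆))`. In `h₆`, `y` acts on `u` in the same way.
  have h₅ : proj1 false true AndQubit.x o₆ (proj2 true false .x o₂ false .t o₅ fun s =>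
      ind (s .p) a * ind (s .q) b * ind (s .x) X * ind (s .y) Y *
        (ind (s .z) o₀ * ind (s .t) (v ^^ s .u) * sgn (o₄ && s .u) * (κ / 2))) = fun s =>
      ind (s .p) a * ind (s .q) b * ind (s .x) o₆ * ind (s .y) Y *
        (ind (s .z) o₀ * ind (s .t) (v ^^ s .u ^^ (o₂ && (X ^^ o₆))) * sgn (o₄ && s .u) *
          sgn (o₅ && (X ^^ o₆)) * (κ / 4)) := by
    rw [proj1_Z]
    funext s
    simp only [proj2, pauliOp_X, ne_eq, reduceCtorEq, not_false_eq_true,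
      update_of_ne, update_self]
    generalize s .t = t; generalize sgn (o₄ && s .u) = g
    generalize (v ^^ s .u) = w
    generalize s .x = x
    by_cases hx : x = o₆
    · subst hx
      cases x <;> cases X <;> simp only [Bool.xor_self, Bool.xor_true, Bool.xor_false,
        Bool.not_false, Bool.and_true, Bool.and_false, ind_self, ind_true_false,
        ind_false_true, sgn_false, ind_xor_left] <;> ring
    · simp [ind, hx]
  have h₆ : proj1 false true AndQubit.y o₈ (proj2 true false .y o₁ false .u o₇ fun s =>
      ind (s .p) a * ind (s .q) b * ind (s .x) o₆ * ind (s .y) Y *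
        (ind (s .z) o₀ * ind (s .t) (v ^^ s .u ^^ (o₂ && (X ^^ o₆))) * sgn (o₄ && s .u) *
          sgn (o₅ && (X ^^ o₆)) * (κ / 4))) = fun s =>
      ind (s .p) a * ind (s .q) b * ind (s .x) o₆ * ind (s .y) o₈ *
        (ind (s .z) o₀ * ind (s .t) (v ^^ (s .u ^^ (o₁ && (Y ^^ o₈))) ^^ (o₂ && (X ^^ o₆))) *
          sgn (o₄ && (s .u ^^ (o₁ && (Y ^^ o₈)))) * sgn (o₅ && (X ^^ o₆)) *
          sgn (o₇ && (Y ^^ o₈)) * (κ / 8)) := by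
    rw [proj1_Z]
    funext s
    simp only [proj2, pauliOp_X, ne_eq, reduceCtorEq, not_false_eq_true,
      update_of_ne, update_self]
    generalize s .t = t; generalize sgn (o₅ && (X ^^ o₆)) = g
    generalize (o₂ && (X ^^ o₆)) = w
    generalize s .y = y
    by_cases hy : y = o₈
    · subst hy
      cases y <;> cases Y <;> simp only [Bool.xor_self, Bool.xor_true, Bool.xor_false,
        Bool.not_false, Bool.and_true, Bool.and_false, ind_self, ind_true_false,
        ind_false_true, sgn_false] <;> ring
    · simp [ind, hy]
  rw [h₄, h₅, h₆, proj1_Z]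
  clear h₄ h₅ h₆
  funext s
  simp only [pauliOp_X, pauliOp_Z, ne_eq, reduceCtorEq, not_false_eq_true,
      update_of_ne, update_self]
  generalize s .u = u; generalize s .t = t; generalize s .p = p; generalize s .q = q
  by_cases hu : u = o₉
  · by_cases hp : p = a
    · by_cases hq : q = b
      · subst hu hp hq
        have e₁ : ind (t ^^ (o₂ && o₆) ^^ (o₁ && o₈) ^^ (o₁ && o₂) ^^ u)
            (v ^^ (u ^^ (o₁ && (Y ^^ o₈))) ^^ (o₂ && (X ^^ o₆))) = ind t (p && q) := by
          rw [← hv, ← hX, ← hY]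
          exact ind_and_correction _ _ _ _ _ _ _ _
        -- The signs that depend on the inputs are cancelled by `Z` gates on `p` and `q`; in `e₂`,
        -- `e₃` and `e₄` only outcomes remain on the right.
        have e₂ : sgn (o₅ && p) * sgn (o₅ && (X ^^ o₆)) = sgn (o₅ && (o₁ ^^ o₆)) := by
          rw [← hX, sgn_and_mul, Bool.xor_assoc, xor_xor_cancel]
        have e₃ : sgn (o₇ && q) * sgn (o₇ && (Y ^^ o₈)) = sgn (o₇ && (o₂ ^^ o₈)) := by
          rw [← hY, sgn_and_mul, Bool.xor_assoc, xor_xor_cancel]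
        have e₄ : sgn (o₁ && o₄ && q) * sgn (o₄ && (u ^^ (o₁ && (Y ^^ o₈))))
            = sgn (o₄ && (u ^^ (o₁ && (o₂ ^^ o₈)))) := by
          rw [← hY, Bool.and_comm o₁ o₄, Bool.and_assoc, sgn_and_mul, Bool.xor_assoc q,
            Bool.and_xor_distrib_left o₁ q, Bool.xor_left_comm u, xor_xor_cancel]
        rw [← e₁, ← e₂, ← e₃, ← e₄]
        simp only [ind_self]
        ring
      · simp [ind, hq]
    · simp [ind, hp]
  · simp [ind, hu]

/-- The outcomes of the gadget that undoes `andPre`. -/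
inductive UnandBit
  | zero | one | pend | left | right
  deriving DecidableEq

/-- Measures the qubits of the conjuncts (`true` and `false`) in a basis of graph states if `pend`
is set, and in the `X` basis otherwise. -/
def andPost : List (Instr Bool UnandBit) :=
  [ .classical (fun _ _ => true) .zero .zero .one,
    .measure2 true false (by decide) .one .zero .zero .pend .left,
    .measure2 true false (by decide) .zero .pend .one .zero .right ]

/-- The measured operators `X ⊗ Z^r` and `Z^r ⊗ X` are the two single-qubit `X` operators conjugated
by `CZ^r`. A basis state `|a b⟩` therefore overlaps their eigenvectors with the sign `(-1)^(r a b)`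
times the usual `X`-basis signs. As `F`, `r₁`, `r₂` precede `a` and `b`, nothing else depends on the
inputs. -/
theorem andPost_run (o : List Bool) (r : Bool) : ∃ (F : (Bool → Bool) → ℂ) (r₁ r₂ : Bool),
    ∀ (a b : Bool) (m : UnandBit → Bool), m .zero = false → m .pend = r →
      (run andPost o ⟨m, fun s => ind (s true) a * ind (s false) b⟩).mem .left = r₁ ∧
      (run andPost o ⟨m, fun s => ind (s true) a * ind (s false) b⟩).mem .right = r₂ ∧
      (run andPost o ⟨m, fun s => ind (s true) a * ind (s false) b⟩).amp = fun s =>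
        sgn (r && (a && b)) * sgn (r₁ && a) * sgn (r₂ && b) * F s := by
  simp only [andPost, run_measure2, run_classical, run_nil]
  generalize o.headD false = o₁
  generalize o.tail.headD false = o₂
  refine ⟨fun s => sgn (r && (s true && s false)) * sgn (o₁ && s true) * sgn (o₂ && s false) / 4,
    o₁, o₂, fun a b m h0 hr => ?_⟩
  simp only [ne_eq, reduceCtorEq, not_false_eq_true, update_of_ne, update_self, h0, hr,
    true_and]
  funext s
  simp only [proj2, pauliOp_X, pauliOp_Z, ne_eq, not_false_eq_true, update_of_ne, update_self,
    Bool.true_eq_false, Bool.false_eq_true, Bool.xor_true]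
  generalize s true = p; generalize s false = q
  cases r <;> cases a <;> cases p <;> cases b <;> cases q <;> cases o₁ <;> cases o₂ <;> norm_num

inductive LeafBit
  | zero | one | out | pend
  deriving DecidableEq

/-- Copies the data qubit, negated if `b` is set, to the ancilla qubit. -/
def literalPre (b : Bool) : List (Instr (Unit ⊕ Option Empty) LeafBit) :=
  [ .classical (fun _ _ => true) .zero .zero .one,
    .measure2 (.inl ()) (.inr none) (by decide) .zero .one .zero .one .out,
    .pauli (.inr none) .out .zero,
    .pauli (.inr none) (if b then .one else .zero) .zero ]

theorem literalPre_amp (b : Bool) (o : List Bool) (a : Bool) (κ : ℂ) :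
    (run (literalPre b) o ⟨fun _ => false, fun s => ind (s (.inl ())) a * κ⟩).amp =
      fun s => ind (s (.inl ())) a * ind (s (.inr none)) (a ^^ b) * κ := by
  simp only [literalPre, run_measure2, run_classical, run_pauli, run_nil]
  generalize o.headD false = o₁
  simp only [ne_eq, reduceCtorEq, not_false_eq_true, update_of_ne, update_self, proj2_ZZ]
  funext s
  cases b <;>
    simp only [pauliOp_X, ne_eq, reduceCtorEq, not_false_eq_true, update_of_ne, update_self,
      if_true, Bool.false_eq_true, if_false] <;>
    generalize s (.inl ()) = p <;> generalize s (.inr none) = q <;>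
    cases a <;> cases p <;> cases q <;> cases o₁ <;> simp

/-- Prepares the ancilla qubit in the basis state `b`. -/
def constPre (b : Bool) : List (Instr (Empty ⊕ Option Empty) LeafBit) :=
  [ .classical (fun _ _ => true) .zero .zero .one,
    .measure1 (.inr none) .zero .out,
    .pauli (.inr none) .out .zero,
    .pauli (.inr none) (if b then .one else .zero) .zero ]

theorem constPre_amp (b : Bool) (o : List Bool) (κ : ℂ) :
    (run (constPre b) o ⟨fun _ => false, fun _ => κ⟩).amp =
      fun s => ind (s (.inr none)) b * κ := by
  simp only [constPre, run_measure1, run_classical, run_pauli, run_nil]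
  generalize o.headD false = o₁
  simp only [ne_eq, reduceCtorEq, not_false_eq_true, update_of_ne, update_self, proj1_Z,
    Bool.not_false]
  funext s
  cases b <;>
    simp only [pauliOp_X, ne_eq, reduceCtorEq, not_false_eq_true, update_of_ne, update_self,
      if_true, Bool.false_eq_true, if_false] <;>
    generalize s (.inr none) = q <;> cases q <;> cases o₁ <;> simp

/-- Measures a qubit in the `X` basis and stores the outcome in the bit `false`. -/
def measureX : List (Instr Unit Bool) :=
  [ .classical (fun _ _ => true) true true true, .measure1 () true false ]

theorem measureX_run (o : List Bool) (m : Bool → Bool) (a : Bool) :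
    run measureX o ⟨m, fun s => ind (s ()) a⟩ =
      ⟨update (update m true true) false (o.headD false),
        fun s => sgn (o.headD false && a) * (sgn (o.headD false && s ()) / 2)⟩ := by
  simp only [measureX, run_measure1, run_classical, run_nil]
  generalize o.headD false = o₁
  simp only [update_self, Bool.not_true]
  congr 1
  funext s
  simp only [proj1, pauliOp_X, update_self]
  cases o₁ <;> cases a <;> cases h : s () <;> norm_num

/-- The clocks of `p` and `q` start at `1` because copying the literals takes a cycle. The
measurements on `z, t` and `t, u` need no input and finish no later than those on `p, x` and `q, y`.
One more cycle then suffices, so a node costs two. -/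
theorem andPre_clock : ((∀ q, (andPre.foldl Instr.tick
      ⟨fun q => if q = .p ∨ q = .q then 1 else 0, fun _ => 0⟩).qubit q ≤ 3) ∧
    ∀ b, (andPre.foldl Instr.tick
      ⟨fun q => if q = .p ∨ q = .q then 1 else 0, fun _ => 0⟩).bit b ≤ 3) := by
  constructor
  · intro s; cases s <;> decide
  · intro b; cases b <;> decide

theorem andPost_clock : (∀ q, (andPost.foldl Instr.tick (Clock.zero _ _)).qubit q ≤ 2) ∧
    ∀ b, (andPost.foldl Instr.tick (Clock.zero _ _)).bit b ≤ 2 := by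
  constructor
  · intro s; cases s <;> decide
  · intro b; cases b <;> decide

/-! ### Supplies of ancilla states -/

/-- `init` is a product of at most `N` of the ancilla states that can be supplied. -/
def IsSupply {A : Type} (init : (A → Bool) → ℂ) (N : ℕ) : Prop :=
  ∃ (R : Type) (_ : Fintype R) (_ : DecidableEq R) (res : R → AncillaState)
    (e : (Σ r, Fin (res r).arity) ≃ A),
    (∀ s, init s = ∏ r, (res r).amplitude fun i => s (e ⟨r, i⟩)) ∧ Fintype.card R ≤ N

theorem IsSupply.empty : IsSupply (fun _ : Empty → Bool => 1) 0 :=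
  ⟨Empty, inferInstance, inferInstance, Empty.elim, Equiv.equivOfIsEmpty _ _, by simp, by simp⟩

theorem IsSupply.mono {A : Type} {init : (A → Bool) → ℂ} {N N' : ℕ} (h : IsSupply init N)
    (hN : N ≤ N') : IsSupply init N' := by
  obtain ⟨R, _, _, res, e, h1, h2⟩ := h
  exact ⟨R, _, ‹_›, res, e, h1, h2.trans hN⟩

theorem IsSupply.sum {A A' : Type} {init : (A → Bool) → ℂ} {init' : (A' → Bool) → ℂ} {N N' : ℕ}
    (h : IsSupply init N) (h' : IsSupply init' N') :
    IsSupply (fun s : A ⊕ A' → Bool => init (fun a => s (.inl a)) * init' fun a => s (.inr a))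
      (N + N') := by
  obtain ⟨R, _, _, res, e, h1, h2⟩ := h
  obtain ⟨R', _, _, res', e', h1', h2'⟩ := h'
  refine ⟨R ⊕ R', inferInstance, inferInstance, Sum.elim res res',
    (Equiv.sumSigmaDistrib fun r => Fin (Sum.elim res res' r).arity).trans
      (Equiv.sumCongr (α₁ := Σ r, Fin (res r).arity) (β₁ := Σ r, Fin (res' r).arity) e e'),
    fun s => ?_, ?_⟩
  · rw [Fintype.prod_sum_type]
    exact congrArg₂ (· * ·) (h1 _) (h1' _)
  · rw [Fintype.card_sum]
    omega

theorem IsSupply.congr {A A' : Type} {init : (A → Bool) → ℂ} {N : ℕ}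
    (h : IsSupply init N) (e : A ≃ A') :
    IsSupply (fun s : A' → Bool => init (fun a => s (e a))) N := by
  obtain ⟨R, _, _, res, e', h1, h2⟩ := h
  exact ⟨R, _, ‹_›, res, e'.trans e, fun s => h1 _, h2⟩

theorem IsSupply.single (r : AncillaState) : IsSupply r.amplitude 1 :=
  ⟨Unit, inferInstance, inferInstance, fun _ => r, Equiv.uniqueSigma _, fun s => by simp; rfl,
    by simp⟩

theorem IsSupply.circuit {D : Type} (P : Circuit D) : IsSupply (A := P.Anc)
    (fun s => ∏ r, (P.res r).amplitude fun i => s ⟨r, i⟩) (Fintype.card P.R) :=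
  ⟨P.R, inferInstance, inferInstance, P.res, Equiv.refl _, fun _ => rfl, le_rfl⟩

theorem IsSupply.plus : IsSupply (fun _ : Unit → Bool => plusAmp) 1 :=
  (IsSupply.single .plus).congr (A' := Unit) (Equiv.ofUnique (Fin 1) Unit)

theorem IsSupply.zero : IsSupply (fun s : Unit → Bool => ind (s ()) false) 1 := by
  have h := (IsSupply.single .zero).congr (A' := Unit) (Equiv.ofUnique (Fin 1) Unit)
  have e : (fun s : Unit → Bool => ind (s ()) false) = fun s : Unit → Bool =>
      AncillaState.zero.amplitude fun a => s (Equiv.ofUnique (Fin 1) Unit a) := by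
    funext s
    simp [ind, AncillaState.amplitude, funext_iff, AncillaState.arity]
  rw [e]
  exact h

theorem IsSupply.ccz : IsSupply (fun s : Fin 3 → Bool =>
    sgn (s 0 && s 1 && s 2) * (1 / (Real.sqrt 8 : ℂ))) 1 := by
  have e : (fun s : Fin 3 → Bool => sgn (s 0 && s 1 && s 2) * (1 / (Real.sqrt 8 : ℂ)))
      = AncillaState.cczState.amplitude := by
    funext s
    have : (s = fun _ => true) ↔ (s 0 && s 1 && s 2) = true := by
      simp [funext_iff, Fin.forall_fin_succ, and_assoc]
    rw [mul_one_div]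
    refine congrArg (· / (Real.sqrt 8 : ℂ)) ?_
    by_cases h : (s 0 && s 1 && s 2) = true
    · rw [sgn, if_pos h]
      exact (if_pos (this.2 h)).symm
    · rw [sgn, if_neg h]
      exact (if_neg fun h' => h (this.1 h')).symm
  rw [e]
  exact IsSupply.single .cczState

theorem AncillaState.normSq_amplitude (r : AncillaState) : normSq r.amplitude = 1 := by
  have h2 : ‖(Real.sqrt 2 : ℂ)‖ ^ 2 = 2 := by
    rw [Complex.norm_real, Real.norm_eq_abs, sq_abs, Real.sq_sqrt (by norm_num)]
  have h8 : ‖(Real.sqrt 8 : ℂ)‖ ^ 2 = 8 := by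
    rw [Complex.norm_real, Real.norm_eq_abs, sq_abs, Real.sq_sqrt (by norm_num)]
  have hcard : ∀ n, Fintype.card (Fin n → Bool) = 2 ^ n := by simp
  cases r with
  | zero =>
    have : ∀ s : Fin AncillaState.zero.arity → Bool, ‖AncillaState.zero.amplitude s‖ ^ 2
        = if s = fun _ => false then 1 else 0 := by
      intro s
      simp only [AncillaState.amplitude]
      split_ifs <;> simp
    simp only [normSq, this]
    simp
  | plus =>
    simp only [normSq, AncillaState.amplitude, norm_div, norm_one, div_pow, h2,
      Finset.sum_const, Finset.card_univ, hcard]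
    norm_num [AncillaState.arity]
  | tState =>
    have : ∀ s : Fin AncillaState.tState.arity → Bool, ‖AncillaState.tState.amplitude s‖ ^ 2
        = 1 / 2 := by
      intro s
      simp only [AncillaState.amplitude, norm_div, div_pow, h2]
      congr 1
      split_ifs
      · rw [mul_comm, Complex.norm_exp_ofReal_mul_I, one_pow]
      · simp
    simp only [normSq, this, Finset.sum_const, Finset.card_univ, hcard]
    norm_num [AncillaState.arity]
  | cczState =>
    have : ∀ s : Fin AncillaState.cczState.arity → Bool,
        ‖AncillaState.cczState.amplitude s‖ ^ 2 = 1 / 8 := by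
      intro s
      simp only [AncillaState.amplitude, norm_div, div_pow, h8]
      congr 1
      split_ifs <;> simp
    simp only [normSq, this, Finset.sum_const, Finset.card_univ, hcard]
    norm_num [AncillaState.arity]

theorem IsSupply.normSq {A : Type} [Fintype A] [DecidableEq A] {init : (A → Bool) → ℂ} {N : ℕ}
    (h : IsSupply init N) : normSq init = 1 := by
  obtain ⟨R, _, _, res, e, h1, -⟩ := h
  have key : ∑ p : ∀ r, Fin (res r).arity → Bool, ∏ r, ‖(res r).amplitude (p r)‖ ^ 2 = 1 := by
    rw [← Fintype.piFinset_univ, ← Finset.prod_univ_sum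
      (fun r => (Finset.univ : Finset (Fin (res r).arity → Bool)))
      (fun r a => ‖(res r).amplitude a‖ ^ 2)]
    exact Finset.prod_eq_one fun r _ => (res r).normSq_amplitude
  -- Currying turns an assignment of all ancilla qubits into one assignment per supplied state, and
  -- the norm factorizes.
  rw [LatticeSurgery.normSq, ← key,
    ← ((e.arrowCongr (Equiv.refl Bool)).symm.trans (Equiv.piCurry fun _ _ => Bool)).sum_comp]
  refine Finset.sum_congr rfl fun s _ => ?_
  rw [h1, norm_prod, Finset.prod_pow]
  rfl

/-! ### Computing and uncomputing a Boolean function -/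

/-- The basis state `x`. -/
noncomputable def ket {E : Type} (x s : E → Bool) : ℂ := open Classical in if s = x then 1 else 0

theorem ket_sum {E E' : Type} (x s : E ⊕ E' → Bool) :
    ket x s = ket (fun e => x (.inl e)) (fun e => s (.inl e)) *
      ket (fun e => x (.inr e)) (fun e => s (.inr e)) := by
  have h : s = x ↔ (fun e => s (.inl e)) = (fun e => x (.inl e)) ∧
      (fun e => s (.inr e)) = (fun e => x (.inr e)) := by
    simp [funext_iff]
  by_cases h1 : (fun e => s (.inl e)) = (fun e => x (.inl e))
  · by_cases h2 : (fun e => s (.inr e)) = (fun e => x (.inr e))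
    · simp [ket, h1, h2, h]
    · simp [ket, h2, h]
  · simp [ket, h1, h]

theorem ket_unit (x s : Unit → Bool) : ket x s = ind (s ()) (x ()) := by
  simp only [ket, ind, funext_iff]
  congr 1
  exact propext ⟨fun h => h (), fun h _ => h⟩

theorem ket_empty (x s : Empty → Bool) : ket x s = 1 := by
  simp [ket, funext_iff]

/-- A circuit that writes `f x` into a qubit `none`, for data in the basis state `x`, together with
a circuit that removes the by-products after that qubit has been measured in the `X` basis with
outcome `pend`.  The data qubits need single-qubit `Z` corrections, controlled by the bits `corr`.
It has at most `N` ancilla states and at most `N` instructions. -/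
structure Evaluator (E : Type) [Fintype E] [DecidableEq E] (f : (E → Bool) → Bool) (L N : ℕ) where
  A : Type
  B : Type
  [decEqA : DecidableEq A]
  [decEqB : DecidableEq B]
  [fintypeA : Fintype A]
  init : (A → Bool) → ℂ
  supply : IsSupply init N
  pre : List (Instr (E ⊕ Option A) B)
  -- Uncomputation uses neither data qubits nor the root `none`, which is measured beforehand by
  -- whoever uses the evaluator.
  post : List (Instr A B)
  length_le : pre.length + post.length ≤ N
  pend : B
  corr : E → B
  mem : List Bool → B → Bool
  state : List Bool → (E → Bool) → (A → Bool) → ℂ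
  final : List Bool → List Bool → Bool → (A → Bool) → ℂ
  finalMem : List Bool → List Bool → Bool → B → Bool
  pre_mem : ∀ o a, (run pre o ⟨fun _ => false, a⟩).mem = mem o
  pre_amp : ∀ o x, (run pre o ⟨fun _ => false, fun s => ket x (fun e => s (.inl e)) *
      (plusAmp * init fun a => s (.inr (some a)))⟩).amp = fun s => ket x (fun e => s (.inl e)) *
      ind (s (.inr none)) (f x) * state o x fun a => s (.inr (some a))
  post_mem : ∀ o o' r a, (run post o' ⟨update (mem o) pend r, a⟩).mem = finalMem o o' r
  -- The sign `sgn (r && f x)` cancels the one that the measurement of the root produces, and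
  -- `final` does not depend on `x`.
  post_amp : ∀ o o' x r, (run post o' ⟨update (mem o) pend r, state o x⟩).amp = fun s =>
      sgn (r && f x) * (∏ e, sgn (finalMem o o' r (corr e) && x e)) * final o o' r s
  pre_clock_data : ∀ e, (pre.foldl Instr.tick (Clock.zero _ _)).qubit (.inl e) ≤ 1
  pre_clock_anc : ∀ a, (pre.foldl Instr.tick (Clock.zero _ _)).qubit (.inr a) ≤ 1 + 2 * L
  pre_clock_bit : ∀ b, (pre.foldl Instr.tick (Clock.zero _ _)).bit b ≤ 1 + 2 * L
  post_clock_qubit : ∀ a, (post.foldl Instr.tick (Clock.zero _ _)).qubit a ≤ 2 * L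
  post_clock_bit : ∀ b, (post.foldl Instr.tick (Clock.zero _ _)).bit b ≤ 2 * L

attribute [instance] Evaluator.decEqA Evaluator.decEqB Evaluator.fintypeA

theorem sgn_mul_self (b : Bool) : sgn b * sgn b = 1 := by
  cases b <;> simp

/-- Evaluates a literal. -/
noncomputable def Evaluator.literal (b : Bool) : Evaluator Unit (fun x => x () ^^ b) 0 4 where
  A := Empty
  B := LeafBit
  init := fun _ => 1
  supply := IsSupply.empty.mono (by norm_num)
  pre := literalPre b
  post := []
  length_le := by simp [literalPre]
  pend := .pend
  corr := fun _ => .pend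
  mem := fun o => (run (literalPre b) o ⟨fun _ => false, fun _ => 0⟩).mem
  state := fun _ _ _ => plusAmp
  -- The sign of `r(x ⊕ b)` splits into that of `r x`, a pending `Z` on the data qubit, and that of
  -- `r b`, which is constant.
  final := fun _ _ r _ => sgn (r && b) * plusAmp
  finalMem := fun o _ r => update (run (literalPre b) o ⟨fun _ => false, fun _ => 0⟩).mem .pend r
  pre_mem := fun o a => run_mem_congr _ _ _ _ rfl
  pre_amp := fun o x => by
    have h := literalPre_amp b o (x ()) (plusAmp * 1)
    simp only [ket_unit]
    rw [h, mul_one]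
  post_mem := fun o o' r a => rfl
  post_amp := fun o o' x r => by
    funext s
    simp only [run, Finset.univ_unique, Finset.prod_singleton, update_self]
    cases r <;> cases x () <;> cases b <;> simp
  pre_clock_data := fun e => by cases b <;> cases e <;> decide
  pre_clock_anc := fun a => by
    cases a with
    | none => cases b <;> decide
    | some a => exact a.elim
  pre_clock_bit := fun c => by cases b <;> cases c <;> decide
  post_clock_qubit := fun a => a.elim
  post_clock_bit := fun c => by simp [Clock.zero]

/-- Evaluates a constant. -/
noncomputable def Evaluator.const (b : Bool) : Evaluator Empty (fun _ => b) 0 4 where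
  A := Empty
  B := LeafBit
  init := fun _ => 1
  supply := IsSupply.empty.mono (by norm_num)
  pre := constPre b
  post := []
  length_le := by simp [constPre]
  pend := .pend
  corr := fun _ => .pend
  mem := fun o => (run (constPre b) o ⟨fun _ => false, fun _ => 0⟩).mem
  state := fun _ _ _ => plusAmp
  final := fun _ _ r _ => sgn (r && b) * plusAmp
  finalMem := fun o _ r => update (run (constPre b) o ⟨fun _ => false, fun _ => 0⟩).mem .pend r
  pre_mem := fun o a => run_mem_congr _ _ _ _ rfl
  pre_amp := fun o x => by
    have h := constPre_amp b o (plusAmp * 1)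
    simp only [ket_empty, one_mul]
    rw [h, mul_one]
  post_mem := fun o o' r a => rfl
  post_amp := fun o o' x r => by
    funext s
    simp only [run, Finset.univ_eq_empty, Finset.prod_empty, mul_one, ← mul_assoc, sgn_mul_self,
      one_mul]
  pre_clock_data := fun e => e.elim
  pre_clock_anc := fun a => by
    cases a with
    | none => cases b <;> decide
    | some a => exact a.elim
  pre_clock_bit := fun c => by cases b <;> cases c <;> decide
  post_clock_qubit := fun a => a.elim
  post_clock_bit := fun c => by simp [Clock.zero]

/-! ### Conjunctions -/

namespace Evaluator

section Conj

variable {E₁ E₂ : Type} [Fintype E₁] [DecidableEq E₁] [Fintype E₂] [DecidableEq E₂]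
  {f₁ : (E₁ → Bool) → Bool} {f₂ : (E₂ → Bool) → Bool} {L N₁ N₂ : ℕ}
  (C₁ : Evaluator E₁ f₁ L N₁) (C₂ : Evaluator E₂ f₂ L N₂)

/-- The ancilla qubits for a conjunction: those of the conjuncts, the qubits that hold the values
of the conjuncts, a CCZ state, and one further qubit. -/
abbrev ConjAnc : Type := C₁.A ⊕ C₂.A ⊕ (Unit ⊕ Unit) ⊕ (Fin 3 ⊕ Unit)

/-- The classical bits for a conjunction. -/
abbrev ConjBit : Type := C₁.B ⊕ C₂.B ⊕ AndBit ⊕ UnandBit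

instance : DecidableEq (ConjAnc C₁ C₂) := inferInstance

instance : Fintype (ConjAnc C₁ C₂) := inferInstance

def conjLeft : E₁ ⊕ Option C₁.A ↪ (E₁ ⊕ E₂) ⊕ Option (ConjAnc C₁ C₂) where
  toFun
    | .inl e => .inl (.inl e)
    | .inr none => .inr (some (.inr (.inr (.inl (.inl ())))))
    | .inr (some a) => .inr (some (.inl a))
  inj' := by rintro (_ | _ | _) (_ | _ | _) h <;> simp_all

def conjRight : E₂ ⊕ Option C₂.A ↪ (E₁ ⊕ E₂) ⊕ Option (ConjAnc C₁ C₂) where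
  toFun
    | .inl e => .inl (.inr e)
    | .inr none => .inr (some (.inr (.inr (.inl (.inr ())))))
    | .inr (some a) => .inr (some (.inr (.inl a)))
  inj' := by rintro (_ | _ | _) (_ | _ | _) h <;> simp_all

def conjAnd : AndQubit ↪ (E₁ ⊕ E₂) ⊕ Option (ConjAnc C₁ C₂) where
  toFun
    | .p => .inr (some (.inr (.inr (.inl (.inl ())))))
    | .q => .inr (some (.inr (.inr (.inl (.inr ())))))
    | .x => .inr (some (.inr (.inr (.inr (.inl 0)))))
    | .y => .inr (some (.inr (.inr (.inr (.inl 1)))))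
    | .z => .inr (some (.inr (.inr (.inr (.inl 2)))))
    | .t => .inr none
    | .u => .inr (some (.inr (.inr (.inr (.inr ())))))
  inj' := by intro a b h; cases a <;> cases b <;> simp_all

@[simp] theorem conjLeft_inl (e : E₁) : conjLeft C₁ C₂ (.inl e) = .inl (.inl e) := rfl

@[simp] theorem conjLeft_none :
    conjLeft C₁ C₂ (.inr none) = .inr (some (.inr (.inr (.inl (.inl ()))))) := rfl

@[simp] theorem conjLeft_some (a : C₁.A) :
    conjLeft C₁ C₂ (.inr (some a)) = .inr (some (.inl a)) := rfl

@[simp] theorem conjRight_inl (e : E₂) : conjRight C₁ C₂ (.inl e) = .inl (.inr e) := rfl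

@[simp] theorem conjRight_none :
    conjRight C₁ C₂ (.inr none) = .inr (some (.inr (.inr (.inl (.inr ()))))) := rfl

@[simp] theorem conjRight_some (a : C₂.A) :
    conjRight C₁ C₂ (.inr (some a)) = .inr (some (.inr (.inl a))) := rfl

@[simp] theorem conjAnd_p :
    conjAnd C₁ C₂ .p = .inr (some (.inr (.inr (.inl (.inl ()))))) := rfl

@[simp] theorem conjAnd_q :
    conjAnd C₁ C₂ .q = .inr (some (.inr (.inr (.inl (.inr ()))))) := rfl

@[simp] theorem conjAnd_x :
    conjAnd C₁ C₂ .x = .inr (some (.inr (.inr (.inr (.inl 0))))) := rfl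

@[simp] theorem conjAnd_y :
    conjAnd C₁ C₂ .y = .inr (some (.inr (.inr (.inr (.inl 1))))) := rfl

@[simp] theorem conjAnd_z :
    conjAnd C₁ C₂ .z = .inr (some (.inr (.inr (.inr (.inl 2))))) := rfl

@[simp] theorem conjAnd_t : conjAnd C₁ C₂ .t = .inr none := rfl

@[simp] theorem conjAnd_u :
    conjAnd C₁ C₂ .u = .inr (some (.inr (.inr (.inr (.inr ()))))) := rfl

def conjUnand : Bool ↪ ConjAnc C₁ C₂ where
  toFun
    | true => .inr (.inr (.inl (.inl ())))
    | false => .inr (.inr (.inl (.inr ())))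
  inj' := by intro a b h; cases a <;> cases b <;> simp_all

@[simp] theorem conjUnand_true :
    conjUnand C₁ C₂ true = .inr (.inr (.inl (.inl ()))) := rfl

@[simp] theorem conjUnand_false :
    conjUnand C₁ C₂ false = .inr (.inr (.inl (.inr ()))) := rfl

def conjUnandBit : UnandBit → ConjBit C₁ C₂
  | .left => .inl C₁.pend
  | .right => .inr (.inl C₂.pend)
  | b => .inr (.inr (.inr b))

theorem conjUnandBit_injective : Injective (conjUnandBit C₁ C₂) := by
  intro a b h
  cases a <;> cases b <;> simp_all [conjUnandBit]

def conjPre : List (Instr ((E₁ ⊕ E₂) ⊕ Option (ConjAnc C₁ C₂)) (ConjBit C₁ C₂)) :=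
  C₁.pre.map (Instr.relabel (conjLeft C₁ C₂) .inl) ++
  (C₂.pre.map (Instr.relabel (conjRight C₁ C₂) (.inr ∘ .inl)) ++
  andPre.map (Instr.relabel (conjAnd C₁ C₂) (.inr ∘ .inr ∘ .inl)))

def conjPost : List (Instr (ConjAnc C₁ C₂) (ConjBit C₁ C₂)) :=
  andPost.map (Instr.relabel (conjUnand C₁ C₂) (conjUnandBit C₁ C₂)) ++
  (C₁.post.map (Instr.relabel .inl .inl) ++
  C₂.post.map (Instr.relabel (Function.Embedding.inl.trans Function.Embedding.inr)
    (.inr ∘ .inl)))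

theorem inr_inl_injective {α β γ : Type} :
    Injective ((.inr ∘ .inl : β → α ⊕ β ⊕ γ)) :=
  Sum.inr_injective.comp Sum.inl_injective

theorem inr_inr_inl_injective {α β γ δ : Type} :
    Injective ((.inr ∘ .inr ∘ .inl : γ → α ⊕ β ⊕ γ ⊕ δ)) :=
  Sum.inr_injective.comp (Sum.inr_injective.comp Sum.inl_injective)

/-- The three blocks write to disjoint sets of bits. The bits of `UnandBit` are still unset, and
`andPost` relies on its bit `zero` being so. -/
theorem conjPre_mem (o : List Bool) (a) :
    let m := (run (conjPre C₁ C₂) o ⟨fun _ => false, a⟩).mem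
    (∀ b, m (.inl b) = C₁.mem o b) ∧
    (∀ b, m (.inr (.inl b)) = C₂.mem (o.drop (C₁.pre.countP Instr.isMeasurement)) b) ∧
    ∀ b, m (.inr (.inr (.inr b))) = false := by
  intro m
  have hm : m = (run (conjPre C₁ C₂) o ⟨fun _ => false, a⟩).mem := rfl
  rw [conjPre, run_append, run_append, countP_map_relabel, countP_map_relabel] at hm
  have h1 := run_relabel_mem (B' := ConjBit C₁ C₂) (conjLeft C₁ C₂) Sum.inl Sum.inl_injective C₁.pre o
    ⟨fun _ => false, fun _ => 0⟩ ⟨fun _ => false, a⟩ (fun _ => rfl)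
  rw [C₁.pre_mem] at h1
  generalize run (B := ConjBit C₁ C₂) (C₁.pre.map (Instr.relabel (conjLeft C₁ C₂) Sum.inl)) o
    ⟨fun _ => false, a⟩ = c₁ at h1 hm
  generalize o.drop (C₁.pre.countP Instr.isMeasurement) = o₁ at hm ⊢
  have h2 := run_relabel_mem (B' := ConjBit C₁ C₂) (conjRight C₁ C₂) (.inr ∘ .inl) inr_inl_injective C₂.pre o₁
    ⟨fun _ => false, fun _ => 0⟩ c₁ (fun b => h1.2 _ (by simp))
  rw [C₂.pre_mem] at h2
  generalize run (B := ConjBit C₁ C₂) (C₂.pre.map (Instr.relabel (conjRight C₁ C₂) (.inr ∘ .inl))) o₁ c₁ = c₂ at h2 hm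
  have h3 := run_relabel_mem (B' := ConjBit C₁ C₂) (conjAnd C₁ C₂) (.inr ∘ .inr ∘ .inl) inr_inr_inl_injective andPre
    (o₁.drop (C₂.pre.countP Instr.isMeasurement))
    ⟨fun b => c₂.mem (.inr (.inr (.inl b))), fun _ => 0⟩ c₂ (fun _ => rfl)
  rw [← hm] at h3
  refine ⟨fun b => ?_, fun b => ?_, fun b => ?_⟩
  · rw [h3.2 _ (by simp), h2.2 _ (by simp), h1.1]
  · rw [h3.2 _ (by simp)]
    exact h2.1 b
  · rw [h3.2 _ (by simp), h2.2 _ (by simp), h1.2 _ (by simp)]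

/-- The initial state of the ancilla qubits for a conjunction. -/
noncomputable def conjInit (s : ConjAnc C₁ C₂ → Bool) : ℂ :=
  C₁.init (fun a => s (.inl a)) * (C₂.init (fun a => s (.inr (.inl a))) *
    ((plusAmp * plusAmp) * (sgn (s (.inr (.inr (.inr (.inl 0)))) && s (.inr (.inr (.inr (.inl 1))))
      && s (.inr (.inr (.inr (.inl 2))))) * (1 / (Real.sqrt 8 : ℂ)) *
        ind (s (.inr (.inr (.inr (.inr ()))))) false)))

theorem conjInit_isSupply : IsSupply (conjInit C₁ C₂) (N₁ + N₂ + 27) :=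
  (C₁.supply.sum (C₂.supply.sum ((IsSupply.plus.sum IsSupply.plus).sum
    (IsSupply.ccz.sum IsSupply.zero)))).mono (by omega)

/-- The frame rule is applied three times, each block regarding the others as a spectator factor.
The roots of the conjuncts keep their values; they become garbage that `andPost` removes. -/
theorem conjPre_amp (o : List Bool) : ∃ J : Bool → Bool → Bool → Bool → ℂ,
    ∀ x : E₁ ⊕ E₂ → Bool, (run (conjPre C₁ C₂) o ⟨fun _ => false, fun s =>
      ket x (fun e => s (.inl e)) * (plusAmp * conjInit C₁ C₂ fun a => s (.inr (some a)))⟩).amp =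
      fun s => ket x (fun e => s (.inl e)) *
        ind (s (.inr none)) (f₁ (fun e => x (.inl e)) && f₂ (fun e => x (.inr e))) *
        (C₁.state o (fun e => x (.inl e)) (fun a => s (.inr (some (.inl a)))) *
        C₂.state (o.drop (C₁.pre.countP Instr.isMeasurement)) (fun e => x (.inr e))
          (fun a => s (.inr (some (.inr (.inl a))))) *
        (ind (s (.inr (some (.inr (.inr (.inl (.inl ()))))))) (f₁ fun e => x (.inl e)) *
         ind (s (.inr (some (.inr (.inr (.inl (.inr ()))))))) (f₂ fun e => x (.inr e))) *
        J (s (.inr (some (.inr (.inr (.inr (.inl 0)))))))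
          (s (.inr (some (.inr (.inr (.inr (.inl 1)))))))
          (s (.inr (some (.inr (.inr (.inr (.inl 2)))))))
          (s (.inr (some (.inr (.inr (.inr (.inr ())))))))) := by
  set o₁ := o.drop (C₁.pre.countP Instr.isMeasurement) with ho₁
  set o₂ := o₁.drop (C₂.pre.countP Instr.isMeasurement) with ho₂
  obtain ⟨J, hJ⟩ := andPre_amp o₂
  -- These constants normalize the `|+⟩` on the new root and the CCZ state.
  refine ⟨fun a b c d => J a b c d * (plusAmp * (1 / (Real.sqrt 8 : ℂ))), fun x => ?_⟩
  rw [conjPre, run_append, run_append, countP_map_relabel, countP_map_relabel, ← ho₁, ← ho₂]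
  have h1 := run_relabel (B' := ConjBit C₁ C₂) (conjLeft C₁ C₂) Sum.inl Sum.inl_injective
    (fun s => ket (fun e => x (.inr e)) (fun e => s (.inl (.inr e))) *
      (C₂.init (fun a => s (.inr (some (.inr (.inl a))))) *
        (plusAmp * plusAmp * (sgn (s (.inr (some (.inr (.inr (.inr (.inl 0)))))) &&
          s (.inr (some (.inr (.inr (.inr (.inl 1)))))) &&
          s (.inr (some (.inr (.inr (.inr (.inl 2))))))) * (1 / (Real.sqrt 8 : ℂ)) *
        ind (s (.inr (some (.inr (.inr (.inr (.inr ()))))))) false))))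
    (by
      rintro s (e | _ | a) v <;> simp)
    C₁.pre o
    ⟨fun _ => false, fun s => ket (fun e => x (.inl e)) (fun e => s (.inl e)) *
      (plusAmp * C₁.init fun a => s (.inr (some a)))⟩
    ⟨fun _ => false, fun s =>
      ket x (fun e => s (.inl e)) * (plusAmp * conjInit C₁ C₂ fun a => s (.inr (some a)))⟩
    ⟨fun _ => rfl, fun s => by
      simp only [ket_sum x, conjInit, comp_apply, conjLeft_inl, conjLeft_some]
      ring⟩
  generalize run (B := ConjBit C₁ C₂) (C₁.pre.map (Instr.relabel (conjLeft C₁ C₂) Sum.inl)) o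
    ⟨fun _ => false, _⟩ = c₁ at h1
  have h1a := h1.1.amp
  rw [C₁.pre_amp] at h1a
  have h2 := run_relabel (B' := ConjBit C₁ C₂) (conjRight C₁ C₂) (.inr ∘ .inl) inr_inl_injective
    (fun s => ket (fun e => x (.inl e)) (fun e => s (.inl (.inl e))) *
      (C₁.state o (fun e => x (.inl e)) (fun a => s (.inr (some (.inl a)))) *
        ind (s (.inr (some (.inr (.inr (.inl (.inl ()))))))) (f₁ fun e => x (.inl e)) *
        (plusAmp * (sgn (s (.inr (some (.inr (.inr (.inr (.inl 0)))))) &&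
          s (.inr (some (.inr (.inr (.inr (.inl 1)))))) &&
          s (.inr (some (.inr (.inr (.inr (.inl 2))))))) * (1 / (Real.sqrt 8 : ℂ)) *
        ind (s (.inr (some (.inr (.inr (.inr (.inr ()))))))) false))))
    (by
      rintro s (e | _ | a) v <;> simp)
    C₂.pre o₁
    ⟨fun _ => false, fun s => ket (fun e => x (.inr e)) (fun e => s (.inl e)) *
      (plusAmp * C₂.init fun a => s (.inr (some a)))⟩
    c₁
    ⟨fun b => h1.2 _ (by simp), fun s => by
      rw [h1a]
      simp only [comp_apply, conjLeft_inl, conjLeft_none,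
        conjLeft_some, conjRight_inl, conjRight_some]
      ring⟩
  generalize run (B := ConjBit C₁ C₂) (C₂.pre.map (Instr.relabel (conjRight C₁ C₂) (.inr ∘ .inl))) o₁ c₁ = c₂ at h2
  have h2a := h2.1.amp
  rw [C₂.pre_amp] at h2a
  have h3 := run_relabel (B' := ConjBit C₁ C₂) (conjAnd C₁ C₂) (.inr ∘ .inr ∘ .inl) inr_inr_inl_injective
    (fun s => ket x (fun e => s (.inl e)) *
      (C₁.state o (fun e => x (.inl e)) (fun a => s (.inr (some (.inl a)))) *
        C₂.state o₁ (fun e => x (.inr e)) (fun a => s (.inr (some (.inr (.inl a)))))))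
    (by
      intro s q v; cases q <;> simp)
    andPre o₂ ⟨fun _ => false, fun s =>
      ind (s .p) (f₁ fun e => x (.inl e)) * ind (s .q) (f₂ fun e => x (.inr e)) *
        sgn (s .x && s .y && s .z) * ind (s .u) false * (plusAmp * (1 / (Real.sqrt 8 : ℂ)))⟩
    c₂
    ⟨fun b => (h2.2 _ (by simp)).trans (h1.2 _ (by simp)), fun s => by
      rw [h2a]
      simp only [ket_sum x, comp_apply, conjRight_inl, conjRight_none,
        conjRight_some, conjAnd_p, conjAnd_q, conjAnd_x, conjAnd_y, conjAnd_z, conjAnd_u]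
      ring⟩
  funext s
  rw [h3.1.amp, hJ]
  simp only [comp_apply, conjAnd_p, conjAnd_q, conjAnd_x, conjAnd_y, conjAnd_z, conjAnd_t,
    conjAnd_u]
  ring

/-- `conjUnandBit` makes `andPost` write its outcomes into the bits `pend` of the conjuncts, whose
own uncomputation then starts exactly as if their roots had been measured in the `X` basis. -/
theorem conjPost_run (o : List Bool) (r : Bool) : ∃ (F : (Bool → Bool) → ℂ) (r₁ r₂ : Bool),
    ∀ (m : ConjBit C₁ C₂ → Bool) (o₀ o₁ : List Bool) (J : Bool → Bool → Bool → Bool → ℂ)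
      (_ : ∀ b, m (.inl b) = C₁.mem o₀ b) (_ : ∀ b, m (.inr (.inl b)) = C₂.mem o₁ b)
      (_ : m (.inr (.inr (.inr .zero))) = false) (_ : m (.inr (.inr (.inr .pend))) = r)
      (x : E₁ ⊕ E₂ → Bool),
    let o' := o.drop (andPost.countP Instr.isMeasurement)
    let o'' := o'.drop (C₁.post.countP Instr.isMeasurement)
    let c := run (conjPost C₁ C₂) o ⟨m, fun s =>
      C₁.state o₀ (fun e => x (.inl e)) (fun a => s (.inl a)) *
        C₂.state o₁ (fun e => x (.inr e)) (fun a => s (.inr (.inl a))) *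
        (ind (s (.inr (.inr (.inl (.inl ()))))) (f₁ fun e => x (.inl e)) *
         ind (s (.inr (.inr (.inl (.inr ()))))) (f₂ fun e => x (.inr e))) *
        J (s (.inr (.inr (.inr (.inl 0))))) (s (.inr (.inr (.inr (.inl 1)))))
          (s (.inr (.inr (.inr (.inl 2))))) (s (.inr (.inr (.inr (.inr ())))))⟩
    (∀ b, c.mem (.inl b) = C₁.finalMem o₀ o' r₁ b) ∧
    (∀ b, c.mem (.inr (.inl b)) = C₂.finalMem o₁ o'' r₂ b) ∧
    c.amp = fun s => sgn (r && (f₁ (fun e => x (.inl e)) && f₂ (fun e => x (.inr e)))) *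
      ((∏ e, sgn (C₁.finalMem o₀ o' r₁ (C₁.corr e) && x (.inl e))) *
       ∏ e, sgn (C₂.finalMem o₁ o'' r₂ (C₂.corr e) && x (.inr e))) *
      (C₁.final o₀ o' r₁ (fun a => s (.inl a)) * C₂.final o₁ o'' r₂ (fun a => s (.inr (.inl a))) *
       F (fun b => s (conjUnand C₁ C₂ b)) *
        J (s (.inr (.inr (.inr (.inl 0))))) (s (.inr (.inr (.inr (.inl 1)))))
          (s (.inr (.inr (.inr (.inl 2))))) (s (.inr (.inr (.inr (.inr ())))))) := by
  obtain ⟨F, r₁, r₂, hF⟩ := andPost_run o r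
  refine ⟨F, r₁, r₂, fun m o₀ o₁ J hm1 hm2 hm3 hm4 x => ?_⟩
  intro o' o'' c
  have hc : c = run (conjPost C₁ C₂) o _ := rfl
  rw [conjPost, run_append, run_append, countP_map_relabel, countP_map_relabel] at hc
  change c = run _ o'' (run _ o' (run _ o _)) at hc
  obtain ⟨hF1, hF2, hF3⟩ := hF (f₁ fun e => x (.inl e)) (f₂ fun e => x (.inr e))
    (fun b => m (conjUnandBit C₁ C₂ b)) hm3 hm4
  have h1 := run_relabel (B' := ConjBit C₁ C₂) (conjUnand C₁ C₂) (conjUnandBit C₁ C₂)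
    (conjUnandBit_injective C₁ C₂)
    (fun s => C₁.state o₀ (fun e => x (.inl e)) (fun a => s (.inl a)) *
        C₂.state o₁ (fun e => x (.inr e)) (fun a => s (.inr (.inl a))) *
        J (s (.inr (.inr (.inr (.inl 0))))) (s (.inr (.inr (.inr (.inl 1)))))
          (s (.inr (.inr (.inr (.inl 2))))) (s (.inr (.inr (.inr (.inr ()))))))
    (by rintro s (_ | _) v <;> simp)
    andPost o ⟨fun b => m (conjUnandBit C₁ C₂ b), fun s =>
      ind (s true) (f₁ fun e => x (.inl e)) * ind (s false) (f₂ fun e => x (.inr e))⟩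
    ⟨m, fun s =>
      C₁.state o₀ (fun e => x (.inl e)) (fun a => s (.inl a)) *
        C₂.state o₁ (fun e => x (.inr e)) (fun a => s (.inr (.inl a))) *
        (ind (s (.inr (.inr (.inl (.inl ()))))) (f₁ fun e => x (.inl e)) *
         ind (s (.inr (.inr (.inl (.inr ()))))) (f₂ fun e => x (.inr e))) *
        J (s (.inr (.inr (.inr (.inl 0))))) (s (.inr (.inr (.inr (.inl 1)))))
          (s (.inr (.inr (.inr (.inl 2))))) (s (.inr (.inr (.inr (.inr ())))))⟩
    ⟨fun _ => rfl, fun s => by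
      simp only [comp_apply, conjUnand_true, conjUnand_false]
      ring⟩
  generalize run (B := ConjBit C₁ C₂)
    (andPost.map (Instr.relabel (conjUnand C₁ C₂) (conjUnandBit C₁ C₂))) o ⟨m, _⟩ = c₁ at h1 hc
  have h1a := h1.1.amp
  have h1l := h1.1.mem .left
  have h1r := h1.1.mem .right
  rw [hF1] at h1l
  rw [hF2] at h1r
  rw [hF3] at h1a
  change c₁.mem (.inl C₁.pend) = r₁ at h1l
  change c₁.mem (.inr (.inl C₂.pend)) = r₂ at h1r
  have hc1 : ∀ b, c₁.mem (.inl b) = update (C₁.mem o₀) C₁.pend r₁ b := by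
    intro b
    by_cases hb : b = C₁.pend
    · rw [hb, h1l, update_self]
    · rw [update_of_ne hb, ← hm1]
      refine h1.2 _ ?_
      rintro ⟨b', hb'⟩
      cases b' <;> simp [conjUnandBit] at hb'
      exact hb hb'.symm
  have hc2 : ∀ b, c₁.mem (.inr (.inl b)) = update (C₂.mem o₁) C₂.pend r₂ b := by
    intro b
    by_cases hb : b = C₂.pend
    · rw [hb, h1r, update_self]
    · rw [update_of_ne hb, ← hm2]
      refine h1.2 _ ?_
      rintro ⟨b', hb'⟩
      cases b' <;> simp [conjUnandBit] at hb'
      exact hb hb'.symm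
  have h2 := run_relabel (Q' := ConjAnc C₁ C₂) (B' := ConjBit C₁ C₂) Function.Embedding.inl Sum.inl
    Sum.inl_injective
    (fun s => sgn (r && (f₁ (fun e => x (.inl e)) && f₂ (fun e => x (.inr e)))) *
      sgn (r₁ && f₁ fun e => x (.inl e)) * sgn (r₂ && f₂ fun e => x (.inr e)) *
      F (fun b => s (conjUnand C₁ C₂ b)) *
      (C₂.state o₁ (fun e => x (.inr e)) (fun a => s (.inr (.inl a))) *
        J (s (.inr (.inr (.inr (.inl 0))))) (s (.inr (.inr (.inr (.inl 1)))))
          (s (.inr (.inr (.inr (.inl 2))))) (s (.inr (.inr (.inr (.inr ())))))))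
    (by
      intro s a v
      have : (fun b => update s (Function.Embedding.inl a) v (conjUnand C₁ C₂ b)) =
          fun b => s (conjUnand C₁ C₂ b) := by
        funext b; cases b <;> simp
      rw [this]
      simp)
    C₁.post o' ⟨update (C₁.mem o₀) C₁.pend r₁, C₁.state o₀ fun e => x (.inl e)⟩ c₁
    ⟨hc1, fun s => by
      rw [h1a]
      change _ = C₁.state o₀ (fun e => x (.inl e)) (fun a => s (.inl a)) * _
      simp only [comp_def]
      ring⟩
  generalize run (B := ConjBit C₁ C₂) (C₁.post.map (Instr.relabel
    (Function.Embedding.inl : _ ↪ ConjAnc C₁ C₂) Sum.inl)) o' c₁ = c₂ at h2 hc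
  have h2a := h2.1.amp
  rw [C₁.post_amp] at h2a
  have h3 := run_relabel (Q' := ConjAnc C₁ C₂) (B' := ConjBit C₁ C₂)
    (Function.Embedding.inl.trans Function.Embedding.inr) (.inr ∘ .inl) inr_inl_injective
    (fun s => sgn (r && (f₁ (fun e => x (.inl e)) && f₂ (fun e => x (.inr e)))) *
      sgn (r₂ && f₂ fun e => x (.inr e)) *
      F (fun b => s (conjUnand C₁ C₂ b)) *
      ((∏ e, sgn (C₁.finalMem o₀ o' r₁ (C₁.corr e) && x (.inl e))) *
        C₁.final o₀ o' r₁ (fun a => s (.inl a)) *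
        J (s (.inr (.inr (.inr (.inl 0))))) (s (.inr (.inr (.inr (.inl 1)))))
          (s (.inr (.inr (.inr (.inl 2))))) (s (.inr (.inr (.inr (.inr ())))))))
    (by
      intro s a v
      have : (fun b => update s ((Function.Embedding.inl.trans Function.Embedding.inr) a) v
          (conjUnand C₁ C₂ b)) = fun b => s (conjUnand C₁ C₂ b) := by
        funext b; cases b <;> simp
      rw [this]
      simp)
    C₂.post o'' ⟨update (C₂.mem o₁) C₂.pend r₂, C₂.state o₁ fun e => x (.inr e)⟩ c₂
    ⟨fun b => (h2.2 _ (by simp)).trans (hc2 b), fun s => by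
      rw [h2a]
      have e₁ : (fun a => s (.inl a)) = s ∘ (Function.Embedding.inl : C₁.A ↪ ConjAnc C₁ C₂) := rfl
      change _ = C₂.state o₁ (fun e => x (.inr e)) (fun a => s (.inr (.inl a))) * _
      rw [e₁]
      -- The sign of `r₁ f₁` occurs twice, from `andPost` and from the uncomputation of the first
      -- conjunct, and cancels.
      linear_combination (exp := 1) (sgn (r && (f₁ (fun e => x (.inl e)) && f₂ (fun e => x (.inr e)))) *
        sgn (r₂ && f₂ fun e => x (.inr e)) *
      F (fun b => s (conjUnand C₁ C₂ b)) *
      ((∏ e, sgn (C₁.finalMem o₀ o' r₁ (C₁.corr e) && x (.inl e))) *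
        C₁.final o₀ o' r₁ (s ∘ (Function.Embedding.inl : C₁.A ↪ ConjAnc C₁ C₂)) *
        J (s (.inr (.inr (.inr (.inl 0))))) (s (.inr (.inr (.inr (.inl 1)))))
          (s (.inr (.inr (.inr (.inl 2))))) (s (.inr (.inr (.inr (.inr ()))))))) *
        C₂.state o₁ (fun e => x (.inr e)) (fun a => s (.inr (.inl a))) *
        sgn_mul_self (r₁ && f₁ fun e => x (.inl e))⟩
  rw [← hc] at h3
  refine ⟨fun b => ?_, fun b => ?_, ?_⟩
  · rw [h3.2 _ (by simp), h2.1.mem, C₁.post_mem]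
  · have := h3.1.mem b
    rwa [C₂.post_mem] at this
  · funext s
    rw [h3.1.amp, C₂.post_amp]
    change sgn _ * _ * C₂.final o₁ o'' r₂ (fun a => s (.inr (.inl a))) * _ = _
    linear_combination (exp := 1) (sgn (r && (f₁ (fun e => x (.inl e)) && f₂ (fun e => x (.inr e)))) *
      F (fun b => s (conjUnand C₁ C₂ b)) *
      ((∏ e, sgn (C₁.finalMem o₀ o' r₁ (C₁.corr e) && x (.inl e))) *
       (∏ e, sgn (C₂.finalMem o₁ o'' r₂ (C₂.corr e) && x (.inr e))) *
        C₁.final o₀ o' r₁ (fun a => s (.inl a)) * C₂.final o₁ o'' r₂ (fun a => s (.inr (.inl a))) *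
        J (s (.inr (.inr (.inr (.inl 0))))) (s (.inr (.inr (.inr (.inl 1)))))
          (s (.inr (.inr (.inr (.inl 2))))) (s (.inr (.inr (.inr (.inr ()))))))) *
        sgn_mul_self (r₂ && f₂ fun e => x (.inr e))

/-- The conjuncts share no qubits and bits, so the second is not delayed by the first; only `andPre`
has to wait, until the roots of the conjuncts are ready. -/
theorem conjPre_clock :
    let t := (conjPre C₁ C₂).foldl Instr.tick (Clock.zero _ _)
    (∀ e, t.qubit (.inl e) ≤ 1) ∧ (∀ a, t.qubit (.inr a) ≤ 1 + 2 * (L + 1)) ∧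
      ∀ b, t.bit b ≤ 1 + 2 * (L + 1) := by
  intro t
  have ht : t = (conjPre C₁ C₂).foldl Instr.tick (Clock.zero _ _) := rfl
  rw [conjPre, List.foldl_append, List.foldl_append] at ht
  obtain ⟨⟨d1, d1'⟩, ⟨a1, a1'⟩⟩ := foldl_tick_relabel (B' := ConjBit C₁ C₂) (conjLeft C₁ C₂) Sum.inl
    Sum.inl_injective 0 C₁.pre (Clock.zero _ _) (Clock.zero _ _)
    ⟨fun _ => Nat.zero_le _, fun _ => Nat.zero_le _⟩
  generalize (C₁.pre.map (Instr.relabel (conjLeft C₁ C₂) Sum.inl)).foldl Instr.tick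
    (Clock.zero _ (ConjBit C₁ C₂)) = t₁ at d1 d1' a1 a1' ht
  have r1 : ∀ e : E₂, Sum.inl (Sum.inr e) ∉ Set.range (conjLeft C₁ C₂) := by
    rintro e ⟨_ | _ | _, h⟩ <;> simp at h
  have r1' : ∀ a, Sum.inr (some (Sum.inr (Sum.inl a))) ∉ Set.range (conjLeft C₁ C₂) := by
    rintro e ⟨_ | _ | _, h⟩ <;> simp at h
  have r1'' : ∀ a, Sum.inr (some (Sum.inr (Sum.inr (Sum.inr a)))) ∉
      Set.range (conjLeft C₁ C₂) := by
    rintro e ⟨_ | _ | _, h⟩ <;> simp at h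
  have r1q : Sum.inr (some (Sum.inr (Sum.inr (Sum.inl (Sum.inr ()))))) ∉
      Set.range (conjLeft C₁ C₂) := by
    rintro ⟨_ | _ | _, h⟩ <;> simp at h
  have r1t : Sum.inr none ∉ Set.range (conjLeft C₁ C₂) := by
    rintro ⟨_ | _ | _, h⟩ <;> simp at h
  obtain ⟨⟨d2, d2'⟩, ⟨a2, a2'⟩⟩ := foldl_tick_relabel (B' := ConjBit C₁ C₂) (conjRight C₁ C₂)
    (.inr ∘ .inl) inr_inl_injective 0 C₂.pre (Clock.zero _ _) t₁
    ⟨by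
      rintro (e | _ | a)
      · exact (a1 _ (r1 e)).le
      · exact (a1 _ r1q).le
      · exact (a1 _ (r1' a)).le, fun b => (a1' _ (by simp)).le⟩
  generalize (C₂.pre.map (Instr.relabel (conjRight C₁ C₂) (.inr ∘ .inl))).foldl Instr.tick t₁ = t₂
    at d2 d2' a2 a2' ht
  have r2 : ∀ e : E₁, Sum.inl (Sum.inl e) ∉ Set.range (conjRight C₁ C₂) := by
    rintro e ⟨_ | _ | _, h⟩ <;> simp at h
  have r2' : ∀ a, Sum.inr (some (Sum.inl a)) ∉ Set.range (conjRight C₁ C₂) := by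
    rintro e ⟨_ | _ | _, h⟩ <;> simp at h
  have r2'' : ∀ a, Sum.inr (some (Sum.inr (Sum.inr (Sum.inr a)))) ∉
      Set.range (conjRight C₁ C₂) := by
    rintro e ⟨_ | _ | _, h⟩ <;> simp at h
  have r2p : Sum.inr (some (Sum.inr (Sum.inr (Sum.inl (Sum.inl ()))))) ∉
      Set.range (conjRight C₁ C₂) := by
    rintro ⟨_ | _ | _, h⟩ <;> simp at h
  have r2t : Sum.inr none ∉ Set.range (conjRight C₁ C₂) := by
    rintro ⟨_ | _ | _, h⟩ <;> simp at h
  have hp : t₂.qubit (.inr (some (.inr (.inr (.inl (.inl ())))))) ≤ 1 + 2 * L := by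
    rw [a2 _ r2p]
    exact (d1 (.inr none)).trans (C₁.pre_clock_anc none)
  have hq : t₂.qubit (.inr (some (.inr (.inr (.inl (.inr ())))))) ≤ 1 + 2 * L :=
    (d2 (.inr none)).trans (C₂.pre_clock_anc none)
  -- The bound `1 + 2 * L` on the roots is read as the initial clock `1` of `p` and `q`, delayed by
  -- `2 * L`.
  obtain ⟨⟨d3, d3'⟩, ⟨a3, a3'⟩⟩ := foldl_tick_relabel (B' := ConjBit C₁ C₂) (conjAnd C₁ C₂)
    (.inr ∘ .inr ∘ .inl) inr_inr_inl_injective (2 * L) andPre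
    ⟨fun q => if q = .p ∨ q = .q then 1 else 0, fun _ => 0⟩ t₂
    ⟨by
      intro q
      cases q
      · exact hp
      · exact hq
      · exact ((a2 _ (r2'' _)).trans (a1 _ (r1'' _))).le.trans (Nat.zero_le _)
      · exact ((a2 _ (r2'' _)).trans (a1 _ (r1'' _))).le.trans (Nat.zero_le _)
      · exact ((a2 _ (r2'' _)).trans (a1 _ (r1'' _))).le.trans (Nat.zero_le _)
      · exact ((a2 _ r2t).trans (a1 _ r1t)).le.trans (Nat.zero_le _)
      · exact ((a2 _ (r2'' _)).trans (a1 _ (r1'' _))).le.trans (Nat.zero_le _),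
      fun b => ((a2' _ (by simp)).trans (a1' _ (by simp))).le.trans (Nat.zero_le _)⟩
  rw [← ht] at d3 d3' a3 a3'
  have r3 : ∀ e, Sum.inl e ∉ Set.range (conjAnd C₁ C₂) := by
    rintro e ⟨q, h⟩; cases q <;> simp at h
  have r3' : ∀ a, Sum.inr (some (Sum.inl a)) ∉ Set.range (conjAnd C₁ C₂) := by
    rintro e ⟨q, h⟩; cases q <;> simp at h
  have r3'' : ∀ a, Sum.inr (some (Sum.inr (Sum.inl a))) ∉ Set.range (conjAnd C₁ C₂) := by
    rintro e ⟨q, h⟩; cases q <;> simp at h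
  have hA : ∀ q, t.qubit (conjAnd C₁ C₂ q) ≤ 1 + 2 * (L + 1) := fun q =>
    (d3 q).trans (by have := andPre_clock.1 q; omega)
  refine ⟨?_, ?_, ?_⟩
  · rintro (e | e)
    · rw [a3 _ (r3 _), a2 _ (r2 e)]
      exact (d1 (.inl e)).trans (C₁.pre_clock_data e)
    · rw [a3 _ (r3 _)]
      exact (d2 (.inl e)).trans (C₂.pre_clock_data e)
  · rintro (_ | a | a | (⟨⟩ | ⟨⟩) | i | ⟨⟩)
    · exact hA .t
    · rw [a3 _ (r3' a), a2 _ (r2' a)]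
      exact (d1 (.inr (some a))).trans ((C₁.pre_clock_anc _).trans (by omega))
    · rw [a3 _ (r3'' a)]
      exact (d2 (.inr (some a))).trans ((C₂.pre_clock_anc _).trans (by omega))
    · exact hA .p
    · exact hA .q
    · fin_cases i
      · exact hA .x
      · exact hA .y
      · exact hA .z
    · exact hA .u
  · rintro (b | b | b | b)
    · rw [a3' _ (by simp), a2' _ (by simp)]
      exact (d1' b).trans ((C₁.pre_clock_bit _).trans (by omega))
    · rw [a3' _ (by simp)]
      exact (d2' b).trans ((C₂.pre_clock_bit _).trans (by omega))
    · exact (d3' b).trans (by have := andPre_clock.2 b; omega)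
    · rw [a3' _ (by simp), a2' _ (by simp), a1' _ (by simp)]
      exact Nat.zero_le _

theorem foldl_tick_le {Q B Q' B' : Type} [DecidableEq Q] [DecidableEq B] [DecidableEq Q']
    [DecidableEq B'] (f : Q ↪ Q') (g : B → B') (hg : Injective g) (k k' K : ℕ)
    (l : List (Instr Q B)) (hq : ∀ q, (l.foldl Instr.tick (Clock.zero _ _)).qubit q ≤ k')
    (hb : ∀ b, (l.foldl Instr.tick (Clock.zero _ _)).bit b ≤ k') (t : Clock Q' B')
    (ht : ∀ q, t.qubit q ≤ K) (ht' : ∀ b, t.bit b ≤ K) (h : ∀ q, t.qubit (f q) ≤ k)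
    (h' : ∀ b, t.bit (g b) ≤ k) (hK : k' + k ≤ K) :
    (∀ q, ((l.map (Instr.relabel f g)).foldl Instr.tick t).qubit q ≤ K) ∧
      ∀ b, ((l.map (Instr.relabel f g)).foldl Instr.tick t).bit b ≤ K := by
  obtain ⟨⟨d, d'⟩, ⟨a, a'⟩⟩ := foldl_tick_relabel f g hg k l (Clock.zero _ _) t
    ⟨fun q => (h q).trans (Nat.le_add_left _ _), fun b => (h' b).trans (Nat.le_add_left _ _)⟩
  constructor
  · intro q
    by_cases hq' : q ∈ Set.range f
    · obtain ⟨q, rfl⟩ := hq'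
      have := d q
      have := hq q
      omega
    · rw [a q hq']
      exact ht q
  · intro b
    by_cases hb' : b ∈ Set.range g
    · obtain ⟨b, rfl⟩ := hb'
      have := d' b
      have := hb b
      omega
    · rw [a' b hb']
      exact ht' b

/-- After the two cycles of `andPost` the conjuncts are uncomputed in parallel, each delayed by `2`.
-/
theorem conjPost_clock :
    let t := (conjPost C₁ C₂).foldl Instr.tick (Clock.zero _ _)
    (∀ a, t.qubit a ≤ 2 * (L + 1)) ∧ ∀ b, t.bit b ≤ 2 * (L + 1) := by
  intro t
  have ht : t = (conjPost C₁ C₂).foldl Instr.tick (Clock.zero _ _) := rfl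
  rw [conjPost, List.foldl_append, List.foldl_append] at ht
  obtain ⟨h1, h1'⟩ := foldl_tick_le (B' := ConjBit C₁ C₂) (conjUnand C₁ C₂) (conjUnandBit C₁ C₂)
    (conjUnandBit_injective C₁ C₂) 0 2 2 andPost andPost_clock.1 andPost_clock.2 (Clock.zero _ _)
    (fun _ => Nat.zero_le _) (fun _ => Nat.zero_le _) (fun _ => Nat.zero_le _)
    (fun _ => Nat.zero_le _) le_rfl
  generalize List.foldl Instr.tick _ (andPost.map
    (Instr.relabel (conjUnand C₁ C₂) (conjUnandBit C₁ C₂))) = t₁ at h1 h1' ht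
  obtain ⟨-, ⟨a, a'⟩⟩ := foldl_tick_relabel (Q' := ConjAnc C₁ C₂) (B' := ConjBit C₁ C₂)
    Function.Embedding.inl Sum.inl Sum.inl_injective 2 C₁.post (Clock.zero _ _) t₁
    ⟨fun q => (h1 _).trans (Nat.le_add_left _ _), fun b => (h1' _).trans (Nat.le_add_left _ _)⟩
  obtain ⟨h2, h2'⟩ := foldl_tick_le (Q' := ConjAnc C₁ C₂) (B' := ConjBit C₁ C₂)
    Function.Embedding.inl Sum.inl Sum.inl_injective 2 (2 * L) (2 * (L + 1)) C₁.post
    C₁.post_clock_qubit C₁.post_clock_bit t₁ (fun q => (h1 q).trans (by omega))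
    (fun b => (h1' b).trans (by omega)) (fun _ => h1 _) (fun _ => h1' _) (by omega)
  generalize List.foldl Instr.tick t₁ (C₁.post.map
    (Instr.relabel (Function.Embedding.inl : _ ↪ ConjAnc C₁ C₂) Sum.inl)) = t₂
    at h2 h2' a a' ht
  obtain ⟨h3, h3'⟩ := foldl_tick_le (Q' := ConjAnc C₁ C₂) (B' := ConjBit C₁ C₂)
    (Function.Embedding.inl.trans Function.Embedding.inr) (.inr ∘ .inl) inr_inl_injective
    2 (2 * L) (2 * (L + 1)) C₂.post
    C₂.post_clock_qubit C₂.post_clock_bit t₂ h2 h2'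
    (fun q => by rw [a _ (by simp)]; exact h1 _) (fun b => by rw [a' _ (by simp)]; exact h1' _)
    (by omega)
  rw [← ht] at h3 h3'
  exact ⟨h3, h3'⟩

/-- Evaluates a conjunction. -/
noncomputable def conj : Evaluator (E₁ ⊕ E₂)
    (fun x => f₁ (fun e => x (.inl e)) && f₂ (fun e => x (.inr e))) (L + 1) (N₁ + N₂ + 27) where
  A := ConjAnc C₁ C₂
  B := ConjBit C₁ C₂
  init := conjInit C₁ C₂
  supply := conjInit_isSupply C₁ C₂
  pre := conjPre C₁ C₂
  post := conjPost C₁ C₂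
  length_le := by
    have := C₁.length_le
    have := C₂.length_le
    -- The node overhead is `24 + 3 = 27` instructions; `27` also exceeds the four ancilla states of
    -- a node.
    have : andPre.length = 24 := rfl
    have : andPost.length = 3 := rfl
    simp only [conjPre, conjPost, List.length_append, List.length_map]
    omega
  pend := .inr (.inr (.inr .pend))
  corr := Sum.elim (fun e => .inl (C₁.corr e)) fun e => .inr (.inl (C₂.corr e))
  mem := fun o => (run (conjPre C₁ C₂) o ⟨fun _ => false, fun _ => 0⟩).mem
  state := fun o x s =>
    C₁.state o (fun e => x (.inl e)) (fun a => s (.inl a)) *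
      C₂.state (o.drop (C₁.pre.countP Instr.isMeasurement)) (fun e => x (.inr e))
        (fun a => s (.inr (.inl a))) *
      (ind (s (.inr (.inr (.inl (.inl ()))))) (f₁ fun e => x (.inl e)) *
        ind (s (.inr (.inr (.inl (.inr ()))))) (f₂ fun e => x (.inr e))) *
      (conjPre_amp C₁ C₂ o).choose (s (.inr (.inr (.inr (.inl 0)))))
        (s (.inr (.inr (.inr (.inl 1))))) (s (.inr (.inr (.inr (.inl 2)))))
        (s (.inr (.inr (.inr (.inr ())))))
  final := fun o o' r s =>
    C₁.final o (o'.drop (andPost.countP Instr.isMeasurement))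
        (conjPost_run C₁ C₂ o' r).choose_spec.choose (fun a => s (.inl a)) *
      C₂.final (o.drop (C₁.pre.countP Instr.isMeasurement))
        ((o'.drop (andPost.countP Instr.isMeasurement)).drop (C₁.post.countP Instr.isMeasurement))
        (conjPost_run C₁ C₂ o' r).choose_spec.choose_spec.choose (fun a => s (.inr (.inl a))) *
      (conjPost_run C₁ C₂ o' r).choose (fun b => s (conjUnand C₁ C₂ b)) *
      (conjPre_amp C₁ C₂ o).choose (s (.inr (.inr (.inr (.inl 0)))))
        (s (.inr (.inr (.inr (.inl 1))))) (s (.inr (.inr (.inr (.inl 2)))))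
        (s (.inr (.inr (.inr (.inr ())))))
  finalMem := fun o o' r => (run (conjPost C₁ C₂) o'
    ⟨update (run (conjPre C₁ C₂) o ⟨fun _ => false, fun _ => 0⟩).mem (.inr (.inr (.inr .pend))) r,
      fun _ => 0⟩).mem
  pre_mem := fun o a => run_mem_congr _ _ _ _ rfl
  pre_amp := fun o x => (conjPre_amp C₁ C₂ o).choose_spec x
  post_mem := fun o o' r a => run_mem_congr _ _ _ _ rfl
  post_amp := fun o o' x r => by
    obtain ⟨m1, m2, m3⟩ := conjPre_mem C₁ C₂ o fun _ => 0
    have key := (conjPost_run C₁ C₂ o' r).choose_spec.choose_spec.choose_spec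
      (update (run (conjPre C₁ C₂) o ⟨fun _ => false, fun _ => 0⟩).mem
        (.inr (.inr (.inr .pend))) r) o (o.drop (C₁.pre.countP Instr.isMeasurement))
      (conjPre_amp C₁ C₂ o).choose
      (fun b => by rw [update_of_ne (by simp), m1])
      (fun b => by rw [update_of_ne (by simp), m2])
      (by rw [update_of_ne (by simp), m3]) (update_self _ _ _) x
    obtain ⟨k1, k2, k3⟩ := key
    rw [Fintype.prod_sum_type]
    simp only [Sum.elim_inl, Sum.elim_inr]
    have hm := fun ψ => run_mem_congr (conjPost C₁ C₂) o'
      ⟨update (run (conjPre C₁ C₂) o ⟨fun _ => false, fun _ => 0⟩).mem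
        (.inr (.inr (.inr .pend))) r, ψ⟩
      ⟨update (run (conjPre C₁ C₂) o ⟨fun _ => false, fun _ => 0⟩).mem
        (.inr (.inr (.inr .pend))) r, fun _ => 0⟩ rfl
    rw [hm] at k1 k2
    simp only [k1, k2]
    exact k3
  pre_clock_data := (conjPre_clock C₁ C₂).1
  pre_clock_anc := (conjPre_clock C₁ C₂).2.1
  pre_clock_bit := (conjPre_clock C₁ C₂).2.2
  post_clock_qubit := (conjPost_clock C₁ C₂).1
  post_clock_bit := (conjPost_clock C₁ C₂).2

end Conj

end Evaluator

/-- A conjunction of at most `2 ^ L` literals in distinct variables can be evaluated by a balanced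
tree. -/
theorem exists_evaluator {n : ℕ} (b : Fin n → Bool) (L : ℕ) (S : Finset (Fin n))
    (hS : S.card ≤ 2 ^ L) :
    ∃ (E : Type) (_ : Fintype E) (_ : DecidableEq E) (ι : E ↪ Fin n) (f : (E → Bool) → Bool)
      (N : ℕ), (∀ d, d ∈ Set.range ι ↔ d ∈ S) ∧
      (∀ x : Fin n → Bool, f (fun e => x (ι e)) = true ↔ ∀ d ∈ S, (x d ^^ b d) = true) ∧
      N + 27 ≤ 31 * 2 ^ L ∧ Nonempty (Evaluator E f L N) := by
  induction L generalizing S with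
  | zero =>
    -- An empty conjunction is the constant `true`. A leaf has size `4 = 31 - 27`; the summand `27`
    -- in the bound is what lets the overhead `27` per node be absorbed in the induction.
    obtain h | h : S.card = 0 ∨ S.card = 1 := by simp at hS; omega
    · obtain rfl := Finset.card_eq_zero.1 h
      exact ⟨Empty, inferInstance, inferInstance, ⟨Empty.elim, fun a => a.elim⟩, _, 4, by simp,
        by simp, by norm_num, ⟨Evaluator.const true⟩⟩
    · obtain ⟨d, rfl⟩ := Finset.card_eq_one.1 h
      refine ⟨Unit, inferInstance, inferInstance, ⟨fun _ => d, fun _ _ _ => rfl⟩, _, 4,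
        fun d' => ?_, fun x => ?_, by norm_num, ⟨Evaluator.literal (b d)⟩⟩
      · rw [Finset.mem_singleton]
        exact ⟨fun ⟨_, h⟩ => h.symm, fun h => ⟨(), h.symm⟩⟩
      · simp only [Finset.mem_singleton, forall_eq]
        exact Iff.rfl
  | succ L ih =>
    -- Halving the set leaves at most `2 ^ L` variables on either side.
    obtain ⟨S₁, hS₁, hc⟩ := Finset.exists_subset_card_eq (Nat.div_le_self S.card 2)
    have hc' := Finset.card_sdiff_add_card_eq_card hS₁
    rw [pow_succ] at hS
    obtain ⟨E₁, _, _, ι₁, f₁, N₁, r₁, h₁, hN₁, ⟨C₁⟩⟩ := ih S₁ (by omega)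
    obtain ⟨E₂, _, _, ι₂, f₂, N₂, r₂, h₂, hN₂, ⟨C₂⟩⟩ := ih (S \ S₁) (by omega)
    refine ⟨E₁ ⊕ E₂, inferInstance, inferInstance, ⟨Sum.elim ι₁ ι₂, ?_⟩, _, N₁ + N₂ + 27, ?_, ?_,
      ?_, ⟨C₁.conj C₂⟩⟩
    · refine Injective.sumElim ι₁.injective ι₂.injective fun a c h => ?_
      have h1 := (r₁ _).1 ⟨a, rfl⟩
      have h2 := (r₂ _).1 ⟨c, rfl⟩
      rw [← h] at h2
      exact (Finset.mem_sdiff.1 h2).2 h1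
    · intro d
      simp only [Embedding.coeFn_mk, Set.Sum.elim_range, Set.mem_union, r₁, r₂]
      constructor
      · rintro (h | h)
        · exact hS₁ h
        · exact (Finset.mem_sdiff.1 h).1
      · intro h
        by_cases h' : d ∈ S₁
        · exact Or.inl h'
        · exact Or.inr (Finset.mem_sdiff.2 ⟨h, h'⟩)
    · intro x
      simp only [Embedding.coeFn_mk, Sum.elim_inl, Sum.elim_inr, Bool.and_eq_true, h₁, h₂]
      constructor
      · rintro ⟨h, h'⟩ d hd
        by_cases hd' : d ∈ S₁
        · exact h d hd'
        · exact h' d (Finset.mem_sdiff.2 ⟨hd, hd'⟩)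
      · exact fun h => ⟨fun d hd => h d (hS₁ hd), fun d hd => h d (Finset.mem_sdiff.1 hd).1⟩
    · rw [pow_succ]
      omega

/-! ### Circuits that are diagonal on the data qubits -/

section Norm

theorem normSq_comp_equiv {A A' : Type} [Fintype A] [DecidableEq A] [Fintype A'] [DecidableEq A']
    (e : A ≃ A') (ψ : (A → Bool) → ℂ) :
    normSq (fun s : A' → Bool => ψ fun a => s (e a)) = normSq ψ := by
  unfold normSq
  rw [← (e.arrowCongr (Equiv.refl Bool)).sum_comp]
  refine Finset.sum_congr rfl fun s _ => ?_
  have : (fun a => e.arrowCongr (Equiv.refl Bool) s (e a)) = s := by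
    funext a
    simp [Equiv.arrowCongr]
  exact congrArg (fun t => ‖ψ t‖ ^ 2) this

theorem normSq_mul {Y Y' : Type} [Fintype Y] [Fintype Y'] (ψ : Y → ℂ) (ψ' : Y' → ℂ) :
    normSq (fun p : Y × Y' => ψ p.1 * ψ' p.2) = normSq ψ * normSq ψ' := by
  unfold normSq
  rw [Fintype.sum_prod_type, Finset.sum_mul_sum]
  simp only [norm_mul, mul_pow]

theorem normSq_sum {A A' : Type} [Fintype A] [DecidableEq A] [Fintype A'] [DecidableEq A']
    (ψ : (A → Bool) → ℂ) (ψ' : (A' → Bool) → ℂ) :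
    normSq (fun s : A ⊕ A' → Bool => ψ (fun a => s (.inl a)) * ψ' fun a => s (.inr a))
      = normSq ψ * normSq ψ' := by
  rw [← normSq_mul]
  unfold normSq
  exact (Equiv.sumArrowEquivProdArrow A A' Bool).sum_comp
    (fun p => ‖ψ p.1 * ψ' p.2‖ ^ 2)

theorem normSq_const_mul {Y : Type} [Fintype Y] (c : ℂ) (ψ : Y → ℂ) :
    normSq (fun y => c * ψ y) = ‖c‖ ^ 2 * normSq ψ := by
  unfold normSq
  simp only [norm_mul, mul_pow, Finset.mul_sum]

theorem normSq_ket {E : Type} [Fintype E] [DecidableEq E] (x : E → Bool) : normSq (ket x) = 1 := by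
  have : ∀ s, ‖ket x s‖ ^ 2 = if s = x then 1 else 0 := by
    intro s
    unfold ket
    split_ifs <;> simp
  simp [normSq, this]

theorem norm_sgn (b : Bool) : ‖sgn b‖ = 1 := by
  cases b <;> simp

theorem ket_self {E : Type} (x : E → Bool) : ket x x = 1 := if_pos rfl

end Norm

section Diagonal

variable {D A B : Type} [Fintype D] [DecidableEq D] [Fintype A] [DecidableEq A] [DecidableEq B]

/-- The initial state, for data in the basis state `x`. -/
noncomputable def start (B : Type) (init : (A → Bool) → ℂ) (x : D → Bool) : Config (D ⊕ A) B where
  mem := fun _ => false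
  amp := fun s => ket x (fun d => s (.inl d)) * init fun a => s (.inr a)

/-- The state of the ancilla qubits in the branch `o`, for data in the basis state `x`. -/
noncomputable def branch (l : List (Instr (D ⊕ A) B)) (init : (A → Bool) → ℂ) (o : List Bool)
    (x : D → Bool) (y : A → Bool) : ℂ :=
  (run l o (start B init x)).amp (Sum.elim x y)

/-- The classical memory at the end of the branch `o`. -/
noncomputable def memory (l : List (Instr (D ⊕ A) B)) (o : List Bool) : B → Bool :=
  (run l o ⟨fun _ => false, fun _ => 0⟩).mem

/-- The sign of the correction on data in the basis state `x`. -/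
noncomputable def corrSign (corr : D → Finset B) (m : B → Bool) (x : D → Bool) : ℂ :=
  ∏ d, ∏ b ∈ corr d, sgn (m b && x d)

/-- The list `l` of instructions preserves each basis state of the data qubits, and, up to the
corrections `corr`, it multiplies the basis state `x` by `u x`, with accuracy `δ`. -/
structure DiagRealizes (l : List (Instr (D ⊕ A) B)) (init : (A → Bool) → ℂ) (corr : D → Finset B)
    (u : (D → Bool) → ℂ) (δ : ℝ) : Prop where
  amp_eq : ∀ o x, o.length = l.countP Instr.isMeasurement → (run l o (start B init x)).amp =
    fun s => ket x (fun d => s (.inl d)) * branch l init o x fun a => s (.inr a)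
  exists_approx : ∃ χ : List Bool → (A → Bool) → ℂ,
    recordSum (l.countP Instr.isMeasurement) (fun o => normSq (χ o)) = 1 ∧
    ∀ x, recordSum (l.countP Instr.isMeasurement) (fun o => normSq fun y =>
      corrSign corr (memory l o) x * branch l init o x y - u x * χ o y) ≤ δ ^ 2

theorem branch_eq (l : List (Instr (D ⊕ A) B)) (init : (A → Bool) → ℂ) (o : List Bool)
    (x : D → Bool) (ψ : (A → Bool) → ℂ) (h : (run l o (start B init x)).amp =
      fun s => ket x (fun d => s (.inl d)) * ψ fun a => s (.inr a)) :
    branch l init o x = ψ := by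
  funext y
  rw [branch, h]
  simp only [Sum.elim_inl, Sum.elim_inr]
  rw [ket_self, one_mul]

theorem run_start_mem (l : List (Instr (D ⊕ A) B))
    (init : (A → Bool) → ℂ) (o : List Bool) (x : D → Bool) :
    (run l o (start B init x)).mem = memory l o :=
  run_mem_congr _ _ _ _ rfl

/-- Probability is conserved and the data factor `ket x` has norm one. This is used when a later
circuit multiplies the error of an earlier one. -/
theorem DiagRealizes.recordSum_branch {l : List (Instr (D ⊕ A) B)} {init : (A → Bool) → ℂ}
    {corr : D → Finset B} {u : (D → Bool) → ℂ} {δ : ℝ} (h : DiagRealizes l init corr u δ)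
    (hi : normSq init = 1) (x : D → Bool) :
    recordSum (l.countP Instr.isMeasurement) (fun o => normSq (branch l init o x)) = 1 := by
  have := recordSum_normSq_run l (start B init x)
  rw [start, normSq_sum (ket x) init, normSq_ket, hi, one_mul] at this
  rw [← this]
  refine recordSum_congr fun o ho => ?_
  rw [← start, h.amp_eq o x ho, normSq_sum (ket x), normSq_ket, one_mul]

theorem norm_corrSign (corr : D → Finset B) (m : B → Bool) (x : D → Bool) :
    ‖corrSign corr m x‖ = 1 := by
  simp [corrSign, norm_prod, norm_sgn]

end Diagonal

/-! ### Transport of diagonal circuits along embeddings, and global phases. -/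

section Transfer

variable {D A B D' A' B' : Type} [Fintype D] [DecidableEq D] [Fintype A] [DecidableEq A]
  [DecidableEq B] [Fintype D'] [DecidableEq D'] [Fintype A'] [DecidableEq A'] [DecidableEq B']

theorem ket_comp_mul (ι : D ↪ D') (x s : D' → Bool) :
    ket (fun d => x (ι d)) (fun d => s (ι d)) *
      (open Classical in if ∀ d, d ∉ Set.range ι → s d = x d then 1 else 0) = ket x s := by
  classical
  have h : s = x ↔ (fun d => s (ι d)) = (fun d => x (ι d)) ∧
      ∀ d, d ∉ Set.range ι → s d = x d := by
    constructor
    · rintro rfl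
      exact ⟨rfl, fun _ _ => rfl⟩
    · rintro ⟨h1, h2⟩
      funext d
      by_cases hd : d ∈ Set.range ι
      · obtain ⟨d, rfl⟩ := hd
        exact congrFun h1 d
      · exact h2 d hd
  by_cases h1 : (fun d => s (ι d)) = fun d => x (ι d)
  · by_cases h2 : ∀ d, d ∉ Set.range ι → s d = x d
    · rw [ket, ket, if_pos h1, if_pos (h.2 ⟨h1, h2⟩), if_pos h2, one_mul]
    · rw [ket, ket, if_pos h1, if_neg (fun h' => h2 (h.1 h').2), if_neg h2, one_mul]
  · rw [ket, ket, if_neg h1, if_neg (fun h' => h1 (h.1 h').1), zero_mul]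

theorem DiagRealizes.relabel {l : List (Instr (D ⊕ A) B)} {init : (A → Bool) → ℂ}
    {corr : D → Finset B} {u : (D → Bool) → ℂ} {δ : ℝ} (h : DiagRealizes l init corr u δ)
    (ι : D ↪ D') (e : A' ≃ A) (g : B ↪ B') (corr' : D' → Finset B')
    (hc : ∀ d, corr' (ι d) = (corr d).map g)
    (hc' : ∀ d, d ∉ Set.range ι → corr' d = ∅) :
    DiagRealizes (l.map (Instr.relabel (ι.sumMap e.symm.toEmbedding) g))
      (fun s => init fun a => s (e.symm a)) corr' (fun x => u fun d => x (ι d)) δ := by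
  classical
  set l' := l.map (Instr.relabel (ι.sumMap e.symm.toEmbedding) g) with hl'
  have hcount : l'.countP Instr.isMeasurement = l.countP Instr.isMeasurement :=
    countP_map_relabel _ _ _
  have hmem : ∀ o b, memory l' o (g b) = memory l o b := fun o b =>
    (run_relabel_mem (ι.sumMap e.symm.toEmbedding) g g.injective l o
      ⟨fun _ => false, fun _ => 0⟩ ⟨fun _ => false, fun _ => 0⟩ fun _ => rfl).1 b
  have hsign : ∀ o x, corrSign corr' (memory l' o) x =
      corrSign corr (memory l o) fun d => x (ι d) := by
    intro o x
    refine (Fintype.prod_of_injective ι ι.injective _ _ (fun d hd => ?_) fun d => ?_).symm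
    · rw [hc' d hd, Finset.prod_empty]
    · rw [hc, Finset.prod_map]
      simp only [hmem]
  have hamp : ∀ o x, o.length = l.countP Instr.isMeasurement →
      (run l' o (start B' (fun s => init fun a => s (e.symm a)) x)).amp =
      fun s => ket x (fun d => s (.inl d)) *
        branch l init o (fun d => x (ι d)) fun a => s (.inr (e.symm a)) := by
    intro o x ho
    have key := (run_relabel (ι.sumMap e.symm.toEmbedding) g g.injective
      -- The spectators are the data qubits outside the range of `ι`, which stay in their basis
      -- state.
      (fun s => if ∀ d, d ∉ Set.range ι → s (.inl d) = x d then 1 else 0)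
      (by
        rintro s (d | a) v
        · have : ∀ d', d' ∉ Set.range ι →
              update s ((ι.sumMap e.symm.toEmbedding) (.inl d)) v (.inl d') = s (.inl d') := by
            intro d' hd'
            rw [update_of_ne]
            rintro hh
            exact hd' ⟨d, (Sum.inl_injective hh).symm⟩
          exact if_congr (forall₂_congr fun d' hd' => by rw [this d' hd']) rfl rfl
        · rfl)
      l o (start B init fun d => x (ι d)) (start B' (fun s => init fun a => s (e.symm a)) x)
      ⟨fun _ => rfl, fun s => by
        simp only [start]
        rw [← ket_comp_mul ι x]
        change _ = ket (fun d => x (ι d)) (fun d => s (.inl (ι d))) *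
          init (fun a => s (.inr (e.symm a))) * _
        ring⟩).1.amp
    funext s
    rw [key, h.amp_eq o _ ho, ← ket_comp_mul ι x]
    change ket (fun d => x (ι d)) (fun d => s (.inl (ι d))) *
      branch l init o (fun d => x (ι d)) (fun a => s (.inr (e.symm a))) * _ = _
    ring
  have hbranch : ∀ o x, o.length = l.countP Instr.isMeasurement →
      branch l' (fun s => init fun a => s (e.symm a)) o x =
        fun y => branch l init o (fun d => x (ι d)) fun a => y (e.symm a) := fun o x ho =>
    branch_eq _ _ _ _ (fun y => branch l init o (fun d => x (ι d)) fun a => y (e.symm a))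
      (hamp o x ho)
  refine ⟨fun o x ho => ?_, ?_⟩
  · rw [hcount] at ho
    rw [hbranch o x ho]
    exact hamp o x ho
  · obtain ⟨χ, h1, h2⟩ := h.exists_approx
    refine ⟨fun o y => χ o fun a => y (e.symm a), ?_, fun x => ?_⟩
    · rw [hcount, ← h1]
      exact recordSum_congr fun o _ => normSq_comp_equiv e.symm (χ o)
    · rw [hcount]
      refine le_of_eq_of_le (recordSum_congr fun o ho => ?_) (h2 fun d => x (ι d))
      rw [hbranch o x ho, hsign]
      exact normSq_comp_equiv e.symm fun y =>
        corrSign corr (memory l o) (fun d => x (ι d)) * branch l init o (fun d => x (ι d)) y -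
          u (fun d => x (ι d)) * χ o y

/-- A global phase of the target is moved into `χ`, which is only required to be normalized. -/
theorem DiagRealizes.phase {l : List (Instr (D ⊕ A) B)} {init : (A → Bool) → ℂ}
    {corr : D → Finset B} {u u' : (D → Bool) → ℂ} {δ : ℝ} (h : DiagRealizes l init corr u δ)
    (ω ω' : ℂ) (hω : ‖ω'‖ = 1) (hωω : ω * ω' = 1) (hu : ∀ x, u' x = ω * u x) :
    DiagRealizes l init corr u' δ := by
  obtain ⟨h0, χ, h1, h2⟩ := h
  refine ⟨h0, fun o y => ω' * χ o y, ?_, fun x => ?_⟩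
  · rw [← h1]
    refine recordSum_congr fun o _ => ?_
    rw [normSq_const_mul, hω, one_pow, one_mul]
  · refine le_of_eq_of_le (recordSum_congr fun o _ => ?_) (h2 x)
    refine congrArg normSq (funext fun y => ?_)
    rw [hu]
    linear_combination -(u x * χ o y) * hωω

end Transfer

/-! ### From basis states to arbitrary inputs. -/

section ZEquivalent

variable {D : Type} [Fintype D] [DecidableEq D]

/-- The initial state of the ancilla qubits. -/
noncomputable def Circuit.init (V : Circuit D) (s : V.Anc → Bool) : ℂ :=
  ∏ r, (V.res r).amplitude fun i => s ⟨r, i⟩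

theorem eq_sum_ket (φ : (D → Bool) → ℂ) (s : D → Bool) : φ s = ∑ x, φ x * ket x s := by
  classical
  simp [ket]

theorem Circuit.exec_mem (V : Circuit D) (o : V.Outcome) (φ : (D → Bool) → ℂ) :
    (V.exec o φ).mem = memory V.instrs (List.ofFn o) :=
  run_mem_congr _ _ _ _ rfl

theorem DiagRealizes.exec_amp {V : Circuit D} {corr : D → Finset V.B} {u : (D → Bool) → ℂ} {δ : ℝ}
    (h : DiagRealizes V.instrs V.init corr u δ) (o : V.Outcome) (φ : (D → Bool) → ℂ)
    (s : D ⊕ V.Anc → Bool) : (V.exec o φ).amp s = φ (fun d => s (.inl d)) *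
      branch V.instrs V.init (List.ofFn o) (fun d => s (.inl d)) fun a => s (.inr a) := by
  obtain ⟨T, hT⟩ := exists_linear_run V.instrs (List.ofFn o) fun _ => false
  have h1 : (V.exec o φ).amp = T fun s => φ (fun d => s (.inl d)) * V.init fun a => s (.inr a) :=
    hT _
  have h2 : (fun s : D ⊕ V.Anc → Bool => φ (fun d => s (.inl d)) * V.init fun a => s (.inr a)) =
      ∑ x, φ x • (start V.B V.init x).amp := by
    funext s
    rw [eq_sum_ket φ, Finset.sum_mul, Finset.sum_apply]
    exact Finset.sum_congr rfl fun x _ => mul_assoc _ _ _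
  rw [h1, h2, map_sum, Finset.sum_apply]
  conv_rhs => rw [eq_sum_ket φ, Finset.sum_mul]
  refine Finset.sum_congr rfl fun x _ => ?_
  rw [map_smul, ← hT]
  change φ x * (run V.instrs (List.ofFn o) (start V.B V.init x)).amp s = _
  rw [h.amp_eq _ _ (by simp)]
  by_cases hx : (fun d => s (.inl d)) = x
  · subst hx
    ring
  · simp [ket, hx]

/-- The errors for different basis states are supported on orthogonal data states, so the squared
error for `φ` is their average with weights `‖φ x‖ ^ 2`. -/
theorem DiagRealizes.zEquivalent {V : Circuit D} {corr : D → Finset V.B} {u : (D → Bool) → ℂ}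
    {δ : ℝ} (h : DiagRealizes V.instrs V.init corr u δ) :
    V.ZEquivalent (Matrix.diagonal u) δ := by
  obtain ⟨χ, h1, h2⟩ := h.exists_approx
  refine ⟨corr, fun o y => χ (List.ofFn o) y, h1, fun φ => ?_⟩
  have key : ∀ o : V.Outcome, ∀ s : D ⊕ V.Anc → Bool,
      ‖V.corrected corr o φ s - (Matrix.diagonal u).mulVec φ (fun d => s (.inl d)) *
        χ (List.ofFn o) (fun a => s (.inr a))‖ ^ 2 =
      ‖φ (fun d => s (.inl d))‖ ^ 2 * ‖corrSign corr (memory V.instrs (List.ofFn o))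
        (fun d => s (.inl d)) * branch V.instrs V.init (List.ofFn o) (fun d => s (.inl d))
          (fun a => s (.inr a)) - u (fun d => s (.inl d)) *
            χ (List.ofFn o) fun a => s (.inr a)‖ ^ 2 := by
    intro o s
    rw [← mul_pow, ← norm_mul, Circuit.corrected, h.exec_amp, V.exec_mem, Matrix.mulVec_diagonal]
    congr 2
    simp only [corrSign, sgn]
    ring
  calc _ = ∑ o : V.Outcome, ∑ x, ‖φ x‖ ^ 2 * normSq fun y =>
          corrSign corr (memory V.instrs (List.ofFn o)) x * branch V.instrs V.init (List.ofFn o) x y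
            - u x * χ (List.ofFn o) y := by
        refine Finset.sum_congr rfl fun o _ => ?_
        rw [Finset.sum_congr rfl fun s _ => key o s,
          ← (Equiv.sumArrowEquivProdArrow D V.Anc Bool).symm.sum_comp, Fintype.sum_prod_type]
        refine Finset.sum_congr rfl fun x _ => ?_
        rw [normSq, Finset.mul_sum]
        rfl
    _ = ∑ x, ‖φ x‖ ^ 2 * recordSum (V.instrs.countP Instr.isMeasurement) fun o => normSq fun y =>
          corrSign corr (memory V.instrs o) x * branch V.instrs V.init o x y - u x * χ o y := by
        rw [Finset.sum_comm]
        refine Finset.sum_congr rfl fun x _ => ?_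
        rw [recordSum, Finset.mul_sum]
    _ ≤ ∑ x, ‖φ x‖ ^ 2 * δ ^ 2 :=
        Finset.sum_le_sum fun x _ => mul_le_mul_of_nonneg_left (h2 x) (by positivity)
    _ = δ ^ 2 * ∑ x, ‖φ x‖ ^ 2 := by rw [← Finset.sum_mul, mul_comm]

end ZEquivalent

/-! ### Exponentiated clauses -/

/-- The phase that `phaseGate γ` applies to the basis state `b`. -/
noncomputable def phase (γ : ℝ) (b : Bool) : ℂ := if b then Complex.exp (Complex.I * γ) else 1

theorem norm_phase (γ : ℝ) (b : Bool) : ‖phase γ b‖ = 1 := by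
  cases b
  · simp [phase]
  · rw [phase, if_pos rfl, mul_comm, Complex.norm_exp_ofReal_mul_I]

/-- Only basis states `|b⟩` are ever fed to `P`, since the root holds `f x`. `P` itself need not be
diagonal. -/
theorem Circuit.Implements.exists_approx {P : Circuit Unit} {γ δ : ℝ}
    (hP : P.Implements (phaseGate γ) δ) : ∃ χ : List Bool → (P.Anc → Bool) → ℂ,
    recordSum (P.instrs.countP Instr.isMeasurement) (fun o => normSq (χ o)) = 1 ∧
    ∀ b, recordSum (P.instrs.countP Instr.isMeasurement) (fun o => normSq fun s =>
      (run P.instrs o (start P.B P.init fun _ => b)).amp s -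
        phase γ b * (ind (s (.inl ())) b * χ o fun a => s (.inr a))) ≤ δ ^ 2 := by
  obtain ⟨χ, h1, h2⟩ := hP
  have hχ : ∀ o : P.Outcome, (fun i : Fin (P.instrs.countP Instr.isMeasurement) =>
      (List.ofFn o).getD i false) = o := fun o => by
    funext i
    simp
  -- The default `false` is never used, because all records in the sums have full length.
  refine ⟨fun o => χ fun i => o.getD i false, ?_, fun b => ?_⟩
  · rw [← h1]
    refine Finset.sum_congr rfl fun o _ => ?_
    simp only [hχ]
    rfl
  · have h3 := h2 (ket fun _ => b)
    have h4 : ∑ x, ‖ket (fun _ : Unit => b) x‖ ^ 2 = 1 := normSq_ket _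
    rw [h4, mul_one] at h3
    refine le_of_eq_of_le (Finset.sum_congr rfl fun o _ => ?_) h3
    refine Finset.sum_congr rfl fun s _ => ?_
    congr 2
    dsimp only
    rw [hχ, Circuit.corrected, phaseGate, Matrix.mulVec_diagonal, ket_unit]
    have h5 : (if s (.inl ()) = true then Complex.exp (Complex.I * γ) else 1) *
        ind (s (.inl ())) b = phase γ b * ind (s (.inl ())) b := by
      by_cases h : s (.inl ()) = b
      · rw [h, phase]
      · simp [ind, h]
    rw [h5, mul_assoc]
    simp only [Finset.prod_empty, Finset.prod_const_one, one_mul]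
    rfl

/-! ### The circuit of one clause: compute, apply the phase gate, uncompute. -/

section Core

variable {E : Type} [Fintype E] [DecidableEq E] {f : (E → Bool) → Bool} {L N : ℕ}
  (C : Evaluator E f L N) (P : Circuit Unit)

abbrev CoreAnc : Type := Option C.A ⊕ P.Anc

abbrev CoreBit : Type := C.B ⊕ P.B ⊕ Unit

instance : DecidableEq (CoreAnc C P) := inferInstance

instance : Fintype (CoreAnc C P) := inferInstance

def corePre : E ⊕ Option C.A ↪ E ⊕ CoreAnc C P :=
  (Function.Embedding.refl E).sumMap Function.Embedding.inl

def corePhase : Unit ⊕ P.Anc ↪ E ⊕ CoreAnc C P where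
  toFun
    | .inl _ => .inr (.inl none)
    | .inr a => .inr (.inr a)
  inj' := by rintro (_ | _) (_ | _) h <;> simp_all

def coreRoot : Unit ↪ CoreAnc C P := ⟨fun _ => .inl none, fun _ _ _ => rfl⟩

@[simp]
theorem coreRoot_apply (u : Unit) : coreRoot C P u = .inl none := rfl

def corePost : C.A ↪ CoreAnc C P := Function.Embedding.some.trans Function.Embedding.inl

@[simp]
theorem corePost_apply (a : C.A) : corePost C P a = .inl (some a) := rfl

@[simp]
theorem corePre_inl (e : E) : corePre C P (.inl e) = .inl e := rfl

@[simp]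
theorem corePre_inr (a : Option C.A) : corePre C P (.inr a) = .inr (.inl a) := rfl

@[simp]
theorem corePhase_inl (u : Unit) : corePhase C P (.inl u) = .inr (.inl none) := rfl

@[simp]
theorem corePhase_inr (a : P.Anc) : corePhase C P (.inr a) = .inr (.inr a) := rfl

def coreRootBit : Bool → CoreBit C P
  | true => .inr (.inr ())
  | false => .inl C.pend

theorem coreRootBit_injective : Injective (coreRootBit C P) := by
  intro a b h
  cases a <;> cases b <;> simp_all [coreRootBit]

/-- Measure the qubit that holds the value of `f`, and uncompute. -/
def uncompute : List (Instr (CoreAnc C P) (CoreBit C P)) :=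
  measureX.map (Instr.relabel (coreRoot C P) (coreRootBit C P)) ++
  C.post.map (Instr.relabel (corePost C P) .inl)

/-- Compute `f`, apply the phase gate, and uncompute. -/
def core : List (Instr (E ⊕ CoreAnc C P) (CoreBit C P)) :=
  C.pre.map (Instr.relabel (corePre C P) .inl) ++
  (P.instrs.map (Instr.relabel (corePhase C P) (.inr ∘ .inl)) ++
  (uncompute C P).map (Instr.relabel Function.Embedding.inr id))

/-- The initial state of the ancilla qubits. -/
noncomputable def coreInit (s : CoreAnc C P → Bool) : ℂ :=
  plusAmp * C.init (fun a => s (.inl (some a))) * P.init fun a => s (.inr a)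

theorem coreInit_isSupply : IsSupply (coreInit C P) (1 + N + Fintype.card P.R) := by
  have h := ((IsSupply.plus.sum C.supply).congr
    ((Equiv.sumComm Unit C.A).trans (Equiv.optionEquivSumPUnit C.A).symm)).sum
    (IsSupply.circuit P)
  exact h

/-- This is the ideal case, with the root exactly in the state `f x`: the sign from its `X`
measurement cancels against that of `post_amp`. Only the `Z` corrections then depend on `x`. -/
theorem uncompute_run (o₁ o₃ : List Bool) (x : E → Bool) (m : CoreBit C P → Bool)
    (hm : ∀ b, m (.inl b) = C.mem o₁ b) (ψ : (P.Anc → Bool) → ℂ) :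
    (∀ b, (run (uncompute C P) o₃ ⟨m, fun s => ind (s (.inl none)) (f x) *
      C.state o₁ x (fun a => s (.inl (some a))) * ψ fun a => s (.inr a)⟩).mem (.inl b) =
        C.finalMem o₁ (o₃.drop 1) (o₃.headD false) b) ∧
    (run (uncompute C P) o₃ ⟨m, fun s => ind (s (.inl none)) (f x) *
      C.state o₁ x (fun a => s (.inl (some a))) * ψ fun a => s (.inr a)⟩).amp =
      fun s => (∏ e, sgn (C.finalMem o₁ (o₃.drop 1) (o₃.headD false) (C.corr e) && x e)) *
        (sgn (o₃.headD false && s (.inl none)) / 2 *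
          C.final o₁ (o₃.drop 1) (o₃.headD false) (fun a => s (.inl (some a))) *
          ψ fun a => s (.inr a)) := by
  rw [uncompute, run_append, countP_map_relabel]
  have hcount : measureX.countP Instr.isMeasurement = 1 := rfl
  rw [hcount]
  have h1 := run_relabel (B' := CoreBit C P) (coreRoot C P) (coreRootBit C P)
    (coreRootBit_injective C P)
    (fun s => C.state o₁ x (fun a => s (.inl (some a))) * ψ fun a => s (.inr a))
    (by intro s q v; simp)
    measureX o₃ ⟨fun b => m (coreRootBit C P b), fun s => ind (s ()) (f x)⟩
    ⟨m, fun s => ind (s (.inl none)) (f x) *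
      C.state o₁ x (fun a => s (.inl (some a))) * ψ fun a => s (.inr a)⟩
    ⟨fun _ => rfl, fun s => mul_assoc _ _ _⟩
  generalize run (B := CoreBit C P) (measureX.map
    (Instr.relabel (coreRoot C P) (coreRootBit C P))) o₃ ⟨m, _⟩ = c₁ at h1 ⊢
  rw [measureX_run] at h1
  have h1a := h1.1.amp
  have h1r : c₁.mem (.inl C.pend) = o₃.headD false := (h1.1.mem false).trans (by simp)
  generalize o₃.headD false = r at *
  have hc1 : ∀ b, c₁.mem (.inl b) = update (C.mem o₁) C.pend r b := by
    intro b
    by_cases hb : b = C.pend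
    · rw [hb, h1r, update_self]
    · rw [update_of_ne hb, ← hm]
      refine h1.2 _ ?_
      rintro ⟨b', hb'⟩
      cases b' <;> simp [coreRootBit] at hb'
      exact hb hb'.symm
  have h2 := run_relabel (Q' := CoreAnc C P) (B' := CoreBit C P) (corePost C P) Sum.inl
    Sum.inl_injective
    (fun s => sgn (r && f x) * (sgn (r && s (.inl none)) / 2) * ψ fun a => s (.inr a))
    (by intro s a v; simp)
    C.post (o₃.drop 1) ⟨update (C.mem o₁) C.pend r, C.state o₁ x⟩ c₁
    ⟨hc1, fun s => by
      rw [h1a]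
      change sgn (r && f x) * (sgn (r && s (.inl none)) / 2) * _ =
        C.state o₁ x (fun a => s (.inl (some a))) * _
      ring⟩
  refine ⟨fun b => ?_, ?_⟩
  · rw [h2.1.mem, C.post_mem]
  · funext s
    rw [h2.1.amp, C.post_amp]
    change sgn _ * _ * C.final o₁ (o₃.drop 1) r (fun a => s (.inl (some a))) * _ = _
    linear_combination (exp := 1) ((∏ e, sgn (C.finalMem o₁ (o₃.drop 1) r (C.corr e) && x e)) *
        (sgn (r && s (.inl none)) / 2 *
          C.final o₁ (o₃.drop 1) r (fun a => s (.inl (some a))) *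
          ψ fun a => s (.inr a))) * sgn_mul_self (r && f x)

/-- Probability is conserved by `pre`, and the other factors of its final state, the data and the
root, are basis states. -/
theorem Evaluator.recordSum_state (x : E → Bool) :
    recordSum (C.pre.countP Instr.isMeasurement) (fun o => normSq (C.state o x)) = 1 := by
  have h := recordSum_normSq_run C.pre ⟨fun _ => false, fun s => ket x (fun e => s (.inl e)) *
      (plusAmp * C.init fun a => s (.inr (some a)))⟩
  have h1 : normSq (fun s : Option C.A → Bool => plusAmp * C.init fun a => s (some a)) = 1 :=
    ((IsSupply.plus.sum C.supply).congr
      ((Equiv.sumComm Unit C.A).trans (Equiv.optionEquivSumPUnit C.A).symm)).normSq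
  have h2 := normSq_sum (ket x) fun s : Option C.A → Bool =>
    plusAmp * C.init fun a => s (some a)
  rw [normSq_ket, h1, one_mul] at h2
  rw [← h2, ← h]
  refine recordSum_congr fun o _ => ?_
  rw [C.pre_amp]
  have h3 := normSq_sum (ket x) fun s : Option C.A → Bool =>
    ind (s none) (f x) * C.state o x fun a => s (some a)
  have h4 := normSq_comp_equiv
    ((Equiv.sumComm Unit C.A).trans (Equiv.optionEquivSumPUnit C.A).symm)
    fun s : Unit ⊕ C.A → Bool =>
      ket (fun _ : Unit => f x) (fun u => s (.inl u)) * C.state o x fun a => s (.inr a)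
  rw [normSq_sum, normSq_ket, one_mul] at h4
  simp only [ket_unit] at h4
  rw [normSq_ket, one_mul] at h3
  simp only [mul_assoc]
  exact h4.symm.trans h3.symm

/-- The output of the phase gate `P` in the branch `o`, for input `b`. -/
noncomputable def phaseOut (o : List Bool) (b : Bool) : (Unit ⊕ P.Anc → Bool) → ℂ :=
  (run P.instrs o (start P.B P.init fun _ => b)).amp

/-- The ancilla qubits before the uncomputation, grouped into those of the evaluator and those on
which `P` acts. -/
def coreEquiv : C.A ⊕ (Unit ⊕ P.Anc) ≃ CoreAnc C P where
  toFun
    | .inl a => .inl (some a)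
    | .inr (.inl _) => .inl none
    | .inr (.inr a) => .inr a
  invFun
    | .inl (some a) => .inl a
    | .inl none => .inr (.inl ())
    | .inr a => .inr (.inr a)
  left_inv := by rintro (_ | _ | _) <;> rfl
  right_inv := by rintro ((_ | _) | _) <;> rfl

/-- The state before the uncomputation. -/
noncomputable def coreMid (o₁ : List Bool) (x : E → Bool) (ψ : (Unit ⊕ P.Anc → Bool) → ℂ)
    (s : CoreAnc C P → Bool) : ℂ :=
  C.state o₁ x (fun a => s (coreEquiv C P (.inl a))) * ψ fun a => s (coreEquiv C P (.inr a))

theorem normSq_coreMid (o₁ : List Bool) (x : E → Bool) (ψ : (Unit ⊕ P.Anc → Bool) → ℂ) :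
    normSq (coreMid C P o₁ x ψ) = normSq (C.state o₁ x) * normSq ψ := by
  rw [← normSq_sum]
  exact normSq_comp_equiv (coreEquiv C P) fun s : C.A ⊕ (Unit ⊕ P.Anc) → Bool =>
    C.state o₁ x (fun a => s (.inl a)) * ψ fun a => s (.inr a)

/-- The classical memory before the uncomputation. -/
noncomputable def coreMidMem (o₁ o₂ : List Bool) : CoreBit C P → Bool :=
  (run (P.instrs.map (Instr.relabel (corePhase C P) (.inr ∘ .inl))) o₂
    (run (C.pre.map (Instr.relabel (corePre C P) .inl)) o₁
      ⟨fun _ => false, fun _ => 0⟩)).mem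

theorem inr_comp_inl_injective {α β γ : Type} :
    Injective (Sum.inr ∘ Sum.inl : β → α ⊕ β ⊕ γ) :=
  Sum.inr_injective.comp Sum.inl_injective

theorem coreMid_mem (o₁ o₂ : List Bool) (b : C.B) :
    coreMidMem C P o₁ o₂ (.inl b) = C.mem o₁ b := by
  have h1 := run_relabel_mem (B' := CoreBit C P) (corePre C P) Sum.inl Sum.inl_injective
    C.pre o₁ ⟨fun _ => false, fun _ => 0⟩ ⟨fun _ => false, fun _ => 0⟩ fun _ => rfl
  have h2 := run_relabel_mem (B' := CoreBit C P) (corePhase C P) (Sum.inr ∘ Sum.inl)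
    inr_comp_inl_injective P.instrs o₂ ⟨fun _ => false, fun _ => 0⟩ _
    fun b => h1.2 _ (by simp)
  rw [coreMidMem, h2.2 _ (by simp), h1.1, C.pre_mem]

theorem core_mid (o₁ o₂ : List Bool) (x : E → Bool) :
    run (P.instrs.map (Instr.relabel (corePhase C P) (.inr ∘ .inl))) o₂
      (run (C.pre.map (Instr.relabel (corePre C P) .inl)) o₁ (start _ (coreInit C P) x)) =
    ⟨coreMidMem C P o₁ o₂, fun s => ket x (fun e => s (.inl e)) *
      coreMid C P o₁ x (phaseOut P o₂ (f x)) fun a => s (.inr a)⟩ := by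
  have h1 := run_relabel (B' := CoreBit C P) (corePre C P) Sum.inl Sum.inl_injective
    (fun s => P.init fun a => s (.inr (.inr a)))
    (by rintro s (q | q) v <;> simp)
    C.pre o₁ ⟨fun _ => false, fun s => ket x (fun e => s (.inl e)) *
      (plusAmp * C.init fun a => s (.inr (some a)))⟩ (start _ (coreInit C P) x)
    ⟨fun _ => rfl, fun s => by
      simp only [start, coreInit, comp_apply, corePre_inl, corePre_inr]
      ring⟩
  have h2 := run_relabel (B' := CoreBit C P) (corePhase C P) (Sum.inr ∘ Sum.inl)
    inr_comp_inl_injective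
    (fun s => ket x (fun e => s (.inl e)) * C.state o₁ x fun a => s (.inr (.inl (some a))))
    (by rintro s (q | q) v <;> simp)
    P.instrs o₂ (start P.B P.init fun _ => f x)
    (run (C.pre.map (Instr.relabel (corePre C P) .inl)) o₁ (start _ (coreInit C P) x))
    ⟨fun b => h1.2 _ (by simp), fun s => by
      rw [h1.1.amp, C.pre_amp]
      simp only [start, comp_apply, corePre_inl, corePre_inr, corePhase_inl, corePhase_inr,
        ket_unit]
      ring⟩
  have hm : ∀ c : Config (E ⊕ CoreAnc C P) (CoreBit C P), c = ⟨c.mem, c.amp⟩ := fun _ => rfl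
  rw [hm (run _ o₂ _)]
  congr 1
  · exact run_mem_congr _ _ _ _ (run_mem_congr _ _ _ _ rfl)
  · funext s
    rw [h2.1.amp]
    have : s ∘ corePhase C P = fun a => s (.inr (coreEquiv C P (.inr a))) := by
      funext a
      rcases a with a | a <;> rfl
    rw [this, coreMid, phaseOut]
    change _ * (_ * C.state o₁ x fun a => s (.inr (.inl (some a)))) =
      _ * ((C.state o₁ x fun a => s (.inr (.inl (some a)))) * _)
    ring

theorem core_run (o₁ o₂ o₃ : List Bool) (x : E → Bool)
    (h₁ : o₁.length = C.pre.countP Instr.isMeasurement)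
    (h₂ : o₂.length = P.instrs.countP Instr.isMeasurement) :
    (∀ b, memory (core C P) (o₁ ++ (o₂ ++ o₃)) (.inl b) =
      C.finalMem o₁ (o₃.drop 1) (o₃.headD false) b) ∧
    (run (core C P) (o₁ ++ (o₂ ++ o₃)) (start _ (coreInit C P) x)).amp = fun s =>
      ket x (fun e => s (.inl e)) * (run (uncompute C P) o₃
        ⟨coreMidMem C P o₁ o₂, coreMid C P o₁ x (phaseOut P o₂ (f x))⟩).amp
          fun a => s (.inr a) := by
  rw [← run_start_mem (init := coreInit C P) (x := x), core,
    run_append_append _ _ _ _ _ (by rw [h₁, countP_map_relabel]),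
    run_append_append _ _ _ _ _ (by rw [h₂, countP_map_relabel]), core_mid]
  have h3 := run_relabel (Q' := E ⊕ CoreAnc C P) Function.Embedding.inr
    (id : CoreBit C P → CoreBit C P) injective_id (fun s => ket x fun e => s (.inl e))
    (by intro s q v; simp) (uncompute C P) o₃
    ⟨coreMidMem C P o₁ o₂, coreMid C P o₁ x (phaseOut P o₂ (f x))⟩
    ⟨coreMidMem C P o₁ o₂, fun s => ket x (fun e => s (.inl e)) *
      coreMid C P o₁ x (phaseOut P o₂ (f x)) fun a => s (.inr a)⟩
    ⟨fun _ => rfl, fun s => mul_comm _ _⟩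
  refine ⟨fun b => ?_, ?_⟩
  · have h4 := h3.1.mem (.inl b)
    refine h4.trans ?_
    rw [← (uncompute_run C P o₁ o₃ x (coreMidMem C P o₁ o₂) (coreMid_mem C P o₁ o₂)
      fun _ => 0).1 b]
    have h5 : ∀ a a', (run (uncompute C P) o₃ ⟨coreMidMem C P o₁ o₂, a⟩).mem =
        (run (uncompute C P) o₃ ⟨coreMidMem C P o₁ o₂, a'⟩).mem :=
      fun a a' => run_mem_congr _ _ _ _ rfl
    exact congrFun (h5 _ _) _
  · funext s
    rw [h3.1.amp, mul_comm]
    rfl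

/-- The ideal state of the ancilla qubits at the end. -/
noncomputable def coreIdeal (χ : (P.Anc → Bool) → ℂ) (o₁ o₃ : List Bool)
    (s : CoreAnc C P → Bool) : ℂ :=
  sgn (o₃.headD false && s (.inl none)) / 2 *
    C.final o₁ (o₃.drop 1) (o₃.headD false) (fun a => s (.inl (some a))) * χ fun a => s (.inr a)

theorem uncompute_ideal (χ : (P.Anc → Bool) → ℂ) (o₁ o₂ o₃ : List Bool) (x : E → Bool) :
    (run (uncompute C P) o₃ ⟨coreMidMem C P o₁ o₂, coreMid C P o₁ x fun s =>
      ind (s (.inl ())) (f x) * χ fun a => s (.inr a)⟩).amp = fun s =>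
      (∏ e, sgn (C.finalMem o₁ (o₃.drop 1) (o₃.headD false) (C.corr e) && x e)) *
        coreIdeal C P χ o₁ o₃ s := by
  have h := (uncompute_run C P o₁ o₃ x (coreMidMem C P o₁ o₂) (coreMid_mem C P o₁ o₂) χ).2
  rw [show (coreMid C P o₁ x fun s => ind (s (.inl ())) (f x) * χ fun a => s (.inr a)) =
    fun s => ind (s (.inl none)) (f x) * C.state o₁ x (fun a => s (.inl (some a))) *
      χ fun a => s (.inr a) from funext fun s => by
        simp only [coreMid]
        change C.state o₁ x (fun a => s (.inl (some a))) *
          (ind (s (.inl none)) (f x) * χ fun a => s (.inr a)) = _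
        ring, h]
  rfl

theorem recordSum_uncompute (o₁ o₂ : List Bool) (x : E → Bool)
    (ψ : (Unit ⊕ P.Anc → Bool) → ℂ) :
    recordSum ((uncompute C P).countP Instr.isMeasurement) (fun o₃ => normSq
      (run (uncompute C P) o₃ ⟨coreMidMem C P o₁ o₂, coreMid C P o₁ x ψ⟩).amp) =
      normSq (C.state o₁ x) * normSq ψ := by
  rw [recordSum_normSq_run, normSq_coreMid]

theorem corrSign_mul_self {D B : Type} [Fintype D] (corr : D → Finset B) (m : B → Bool)
    (x : D → Bool) : corrSign corr m x * corrSign corr m x = 1 := by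
  simp [corrSign, ← Finset.prod_mul_distrib, sgn_mul_self]

theorem coreMid_sub (o₁ : List Bool) (x : E → Bool) (ψ ψ' : (Unit ⊕ P.Anc → Bool) → ℂ) (ω : ℂ) :
    coreMid C P o₁ x (fun s => ψ s - ω * ψ' s) =
      coreMid C P o₁ x ψ - ω • coreMid C P o₁ x ψ' := by
  funext s
  simp only [coreMid, Pi.sub_apply, Pi.smul_apply, smul_eq_mul]
  ring

/-- The real output of `P` replaces the ideal one before uncomputation. Being linear and conserving
total probability, uncomputation turns their difference into a final error of the same size. The
weights of `C.state` over the first records sum to one, which gives exactly `δ ^ 2`. -/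
theorem core_diagRealizes {γ δ : ℝ} (hP : P.Implements (phaseGate γ) δ) :
    DiagRealizes (core C P) (coreInit C P) (fun e => {.inl (C.corr e)})
      (fun x => phase γ (f x)) δ := by
  set n₁ := C.pre.countP Instr.isMeasurement with hn₁
  set n₂ := P.instrs.countP Instr.isMeasurement with hn₂
  set n₃ := (uncompute C P).countP Instr.isMeasurement with hn₃
  have hcount : (core C P).countP Instr.isMeasurement = n₁ + (n₂ + n₃) := by
    rw [core, List.countP_append, List.countP_append, countP_map_relabel, countP_map_relabel,
      countP_map_relabel]
  have hsplit : ∀ o : List Bool, o.length = n₁ + (n₂ + n₃) → ∃ o₁ o₂ o₃ : List Bool,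
      o₁.length = n₁ ∧ o₂.length = n₂ ∧ o = o₁ ++ (o₂ ++ o₃) := fun o ho =>
    ⟨o.take n₁, (o.drop n₁).take n₂, (o.drop n₁).drop n₂, by simp; omega, by simp; omega, by simp⟩
  have hbranch : ∀ o₁ o₂ o₃ x, o₁.length = n₁ → o₂.length = n₂ →
      branch (core C P) (coreInit C P) (o₁ ++ (o₂ ++ o₃)) x = (run (uncompute C P) o₃
        ⟨coreMidMem C P o₁ o₂, coreMid C P o₁ x (phaseOut P o₂ (f x))⟩).amp :=
    fun o₁ o₂ o₃ x h₁ h₂ => branch_eq _ _ _ _ _ (core_run C P o₁ o₂ o₃ x h₁ h₂).2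
  obtain ⟨χ, hχ, happrox⟩ := hP.exists_approx
  have hideal : ∀ o₁ x, recordSum n₂ (fun o₂ => recordSum n₃ fun o₃ =>
      normSq (coreIdeal C P (χ o₂) o₁ o₃)) = normSq (C.state o₁ x) := by
    intro o₁ x
    rw [← mul_one (normSq (C.state o₁ x)), ← hχ, ← recordSum_mul_left]
    refine recordSum_congr fun o₂ _ => ?_
    have h1 := normSq_sum (ket fun _ : Unit => f x) (χ o₂)
    simp only [ket_unit] at h1
    rw [normSq_ket, one_mul] at h1
    rw [← h1, ← recordSum_uncompute C P o₁ o₂ x]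
    refine recordSum_congr fun o₃ _ => ?_
    rw [uncompute_ideal, normSq_const_mul, norm_prod, Finset.prod_eq_one fun e _ => norm_sgn _,
      one_pow, one_mul]
  refine ⟨fun o x ho => ?_, fun o => coreIdeal C P (χ ((o.drop n₁).take n₂)) (o.take n₁)
    ((o.drop n₁).drop n₂), ?_, fun x => ?_⟩
  · obtain ⟨o₁, o₂, o₃, h₁, h₂, rfl⟩ := hsplit o (ho.trans hcount)
    rw [hbranch o₁ o₂ o₃ x h₁ h₂]
    exact (core_run C P o₁ o₂ o₃ x h₁ h₂).2
  -- The ideal vectors do not depend on `x`, so their norm may be computed at any basis state.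
  · rw [hcount, recordSum_add, ← C.recordSum_state fun _ => false]
    refine recordSum_congr fun o₁ h₁ => ?_
    rw [recordSum_add, ← hideal]
    refine recordSum_congr fun o₂ h₂ => recordSum_congr fun o₃ _ => ?_
    simp only [← h₁, ← h₂, List.drop_left, List.take_left]
  · rw [hcount, recordSum_add]
    calc _ = recordSum n₁ fun o₁ => normSq (C.state o₁ x) * recordSum n₂ fun o₂ =>
          normSq fun s => phaseOut P o₂ (f x) s -
            phase γ (f x) * (ind (s (.inl ())) (f x) * χ o₂ fun a => s (.inr a)) := by
          refine recordSum_congr fun o₁ h₁ => ?_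
          rw [recordSum_add, ← recordSum_mul_left]
          refine recordSum_congr fun o₂ h₂ => ?_
          rw [← recordSum_uncompute C P o₁ o₂ x]
          refine recordSum_congr fun o₃ _ => ?_
          simp only [hbranch o₁ o₂ o₃ x h₁ h₂]
          simp only [← h₁, ← h₂, List.drop_left, List.take_left]
          obtain ⟨T, hT⟩ := exists_linear_run (uncompute C P) o₃ (coreMidMem C P o₁ o₂)
          set κ := corrSign (fun e => ({.inl (C.corr e)} : Finset (CoreBit C P)))
            (memory (core C P) (o₁ ++ (o₂ ++ o₃))) x with hκ
          have hκ' : κ = ∏ e, sgn (C.finalMem o₁ (o₃.drop 1) (o₃.headD false) (C.corr e) && x e) := by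
            rw [hκ, corrSign]
            refine Finset.prod_congr rfl fun e _ => ?_
            rw [Finset.prod_singleton, (core_run C P o₁ o₂ o₃ x h₁ h₂).1]
          have hi := uncompute_ideal C P (χ o₂) o₁ o₂ o₃ x
          rw [← hκ', hT] at hi
          rw [hT, hT, coreMid_sub, map_sub, map_smul, hi]
          have hκ2 : κ * κ = 1 := corrSign_mul_self _ _ _
          have hκ1 : ‖κ‖ = 1 := norm_corrSign _ _ _
          -- Multiplying by the unit `κ` moves the correction sign from the ideal output to the real
          -- one, since `κ * κ = 1`.
          rw [← one_mul (normSq (_ - _)), ← one_pow 2, ← hκ1, ← normSq_const_mul]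
          refine congrArg normSq (funext fun s => ?_)
          simp only [Pi.sub_apply, Pi.smul_apply, smul_eq_mul]
          linear_combination (phase γ (f x) * coreIdeal C P (χ o₂) o₁ o₃ s) * hκ2
      _ ≤ recordSum n₁ fun o₁ => normSq (C.state o₁ x) * δ ^ 2 :=
          recordSum_mono fun o₁ => mul_le_mul_of_nonneg_left (happrox (f x))
            (Finset.sum_nonneg fun _ _ => by positivity)
      _ = δ ^ 2 := by rw [recordSum_mul_right, C.recordSum_state, one_mul]

theorem measureX_clock : let t := measureX.foldl Instr.tick (Clock.zero _ _)
    (∀ q, t.qubit q = 0) ∧ ∀ b, t.bit b = 0 := by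
  refine ⟨fun q => ?_, fun b => ?_⟩
  · rfl
  · cases b <;> rfl

theorem Circuit.clock_le_logicalDepth {D : Type} [Fintype D] [DecidableEq D] (V : Circuit D)
    (q : D ⊕ V.Anc) : (V.instrs.foldl Instr.tick (Clock.zero _ _)).qubit q ≤ V.logicalDepth :=
  Finset.le_sup (f := (V.instrs.foldl Instr.tick (Clock.zero _ _)).qubit) (Finset.mem_univ q)

/-- The root is ready at `1 + 2 * L`, `P` is delayed by that much, the single-qubit measurement is
free, and uncomputation adds `2 * L`. Data qubits occur only in `pre`. -/
theorem core_clock : let t := (core C P).foldl Instr.tick (Clock.zero _ _)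
    (∀ e, t.qubit (.inl e) ≤ 1) ∧ ∀ a, t.qubit (.inr a) ≤ 1 + 4 * L + P.logicalDepth := by
  intro t
  have ht : t = (core C P).foldl Instr.tick (Clock.zero _ _) := rfl
  clear_value t
  rw [core, uncompute, List.map_append, List.map_map, List.map_map, List.foldl_append,
    List.foldl_append, List.foldl_append] at ht
  obtain ⟨⟨h1, h1'⟩, ⟨a1, a1'⟩⟩ := foldl_tick_relabel (B' := CoreBit C P) (corePre C P) Sum.inl
    Sum.inl_injective 0 C.pre (Clock.zero _ _) (Clock.zero _ _)
    ⟨fun _ => Nat.zero_le _, fun _ => Nat.zero_le _⟩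
  generalize List.foldl Instr.tick (Clock.zero _ (CoreBit C P)) (C.pre.map
    (Instr.relabel (corePre C P) .inl)) = t₁ at h1 h1' a1 a1' ht
  have q1 : ∀ e, t₁.qubit (.inl e) ≤ 1 := fun e => (h1 (.inl e)).trans (C.pre_clock_data e)
  have r1 : ∀ a, t₁.qubit (.inr a) ≤ 1 + 2 * L := by
    rintro (a | a)
    · exact (h1 (.inr a)).trans (C.pre_clock_anc a)
    · rw [a1 _ (by rintro ⟨_ | _, h⟩ <;> simp at h)]
      exact Nat.zero_le _
  have b1 : ∀ b, t₁.bit b ≤ 1 + 2 * L := by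
    rintro (b | b)
    · exact (h1' b).trans (C.pre_clock_bit b)
    · rw [a1' _ (by simp)]
      exact Nat.zero_le _
  obtain ⟨⟨h2, h2'⟩, ⟨a2, a2'⟩⟩ := foldl_tick_relabel (B' := CoreBit C P) (corePhase C P)
    (Sum.inr ∘ Sum.inl) inr_comp_inl_injective (1 + 2 * L) P.instrs (Clock.zero _ _) t₁
    ⟨fun q => by rcases q with q | q <;> exact (r1 _).trans (Nat.le_add_left _ _),
      fun b => (b1 _).trans (Nat.le_add_left _ _)⟩
  generalize List.foldl Instr.tick t₁ (P.instrs.map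
    (Instr.relabel (corePhase C P) (Sum.inr ∘ Sum.inl))) = t₂ at h2 h2' a2 a2' ht
  have q2 : ∀ e, t₂.qubit (.inl e) ≤ 1 := fun e => by
    rw [a2 _ (by rintro ⟨_ | _, h⟩ <;> simp at h)]
    exact q1 e
  have p2 : ∀ q, t₂.qubit (corePhase C P q) ≤ P.logicalDepth + (1 + 2 * L) := fun q =>
    (h2 q).trans (Nat.add_le_add_right (P.clock_le_logicalDepth q) _)
  have r2 : ∀ a, t₂.qubit (.inr a) ≤ 1 + 2 * L + P.logicalDepth := by
    rintro ((_ | a) | a)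
    · exact (p2 (.inl ())).trans (by omega)
    · rw [a2 _ (by rintro ⟨_ | _, h⟩ <;> simp at h)]
      exact (r1 _).trans (by omega)
    · exact (p2 (.inr a)).trans (by omega)
  have b2 : ∀ b, t₂.bit (.inl b) ≤ 1 + 2 * L + P.logicalDepth := fun b => by
    rw [a2' _ (by simp)]
    exact (b1 _).trans (by omega)
  have b2' : t₂.bit (.inr (.inr ())) ≤ 1 + 2 * L + P.logicalDepth := by
    rw [a2' _ (by simp)]
    exact (b1 _).trans (by omega)
  obtain ⟨⟨h3, h3'⟩, ⟨a3, a3'⟩⟩ := foldl_tick_relabel (B' := CoreBit C P)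
    ((coreRoot C P).trans (Function.Embedding.inr : _ ↪ E ⊕ CoreAnc C P))
    (coreRootBit C P) (coreRootBit_injective C P) (1 + 2 * L + P.logicalDepth) measureX
    (Clock.zero _ _) t₂
    ⟨fun q => (r2 _).trans (Nat.le_add_left _ _), fun b => by
      cases b
      · exact (b2 _).trans (Nat.le_add_left _ _)
      · exact b2'.trans (Nat.le_add_left _ _)⟩
  have e3 : Instr.relabel (Function.Embedding.inr : _ ↪ E ⊕ CoreAnc C P) id ∘
      Instr.relabel (coreRoot C P) (coreRootBit C P) = Instr.relabel
        ((coreRoot C P).trans (Function.Embedding.inr : _ ↪ E ⊕ CoreAnc C P))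
        (coreRootBit C P) := funext fun I => Instr.relabel_relabel _ _ _ _ _
  have e4 : Instr.relabel (Function.Embedding.inr : _ ↪ E ⊕ CoreAnc C P) id ∘
      Instr.relabel (corePost C P) (Sum.inl : _ → CoreBit C P) = Instr.relabel
        ((corePost C P).trans (Function.Embedding.inr : _ ↪ E ⊕ CoreAnc C P))
        (Sum.inl : _ → CoreBit C P) := funext fun I => Instr.relabel_relabel _ _ _ _ _
  rw [e3, e4] at ht
  generalize List.foldl Instr.tick t₂ (measureX.map (Instr.relabel
    ((coreRoot C P).trans (Function.Embedding.inr : _ ↪ E ⊕ CoreAnc C P))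
    (coreRootBit C P))) = t₃ at h3 h3' a3 a3' ht
  have q3 : ∀ e, t₃.qubit (.inl e) ≤ 1 := fun e => by
    rw [a3 _ (by simp)]
    exact q2 e
  have r3 : ∀ a, t₃.qubit (.inr a) ≤ 1 + 2 * L + P.logicalDepth := by
    intro a
    by_cases ha : a = .inl none
    · subst ha
      have := measureX_clock.1 ()
      exact (h3 ()).trans (by omega)
    · rw [a3 _ (by rintro ⟨u, hu⟩; exact ha (Sum.inr_injective hu).symm)]
      exact r2 a
  have b3 : ∀ b, t₃.bit (.inl b) ≤ 1 + 2 * L + P.logicalDepth := by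
    intro b
    by_cases hb : b = C.pend
    · subst hb
      have := measureX_clock.2 false
      exact (h3' false).trans (by omega)
    · rw [a3' _ (by
        rintro ⟨b', hb'⟩
        cases b' <;> simp [coreRootBit] at hb'
        exact hb hb'.symm)]
      exact b2 b
  obtain ⟨⟨h4, -⟩, ⟨a4, -⟩⟩ := foldl_tick_relabel (B' := CoreBit C P)
    ((corePost C P).trans (Function.Embedding.inr : _ ↪ E ⊕ CoreAnc C P)) Sum.inl
    Sum.inl_injective (1 + 2 * L + P.logicalDepth) C.post (Clock.zero _ _) t₃
    ⟨fun q => (r3 _).trans (Nat.le_add_left _ _), fun b => (b3 _).trans (Nat.le_add_left _ _)⟩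
  rw [← ht] at h4 a4
  refine ⟨fun e => ?_, fun a => ?_⟩
  · rw [a4 _ (by simp)]
    exact q3 e
  · by_cases ha : ∃ a', a = .inl (some a')
    · obtain ⟨a', rfl⟩ := ha
      have := C.post_clock_qubit a'
      exact (h4 a').trans (by omega)
    · rw [a4 _ (by rintro ⟨a', ha'⟩; exact ha ⟨a', (Sum.inr_injective ha').symm⟩)]
      exact (r3 a).trans (by omega)

theorem core_length : (core C P).length ≤ N + P.instrs.length + 2 := by
  have := C.length_le
  simp only [core, uncompute, List.length_append, List.length_map]
  have : measureX.length = 2 := rfl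
  omega

end Core

/-! ### Clause circuits: timing and size. -/

/-- Started at time `l`, the circuit occupies data qubits only in `S` and only for one cycle, and
its ancilla qubits for `K` further cycles. -/
def Circuit.Timed {D : Type} [DecidableEq D] (V : Circuit D) (S : Finset D) (K : ℕ) : Prop :=
  ∀ (l : ℕ) (A B : Type) [DecidableEq A] [DecidableEq B] (a : V.Anc ↪ A) (g : V.B → B)
    (_ : Injective g) (t : Clock (D ⊕ A) B), (∀ d ∈ S, t.qubit (.inl d) ≤ l) →
    (∀ q, t.qubit (.inr (a q)) ≤ l) → (∀ b, t.bit (g b) ≤ l) →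
    let t' := (V.instrs.map (Instr.relabel ((Function.Embedding.refl D).sumMap a) g)).foldl
      Instr.tick t
    (∀ d ∈ S, t'.qubit (.inl d) ≤ l + 1) ∧ (∀ d ∉ S, t'.qubit (.inl d) = t.qubit (.inl d)) ∧
    (∀ q, t'.qubit (.inr (a q)) ≤ l + 1 + K) ∧
    (∀ q ∉ Set.range a, t'.qubit (.inr q) = t.qubit (.inr q)) ∧
    ∀ b ∉ Set.range g, t'.bit b = t.bit b

section

variable {D E : Type} [Fintype D] [DecidableEq D] [Fintype E] [DecidableEq E]
  {f : (E → Bool) → Bool} {L N : ℕ}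

theorem Evaluator.exists_circuit (C : Evaluator E f L N) {P : Circuit Unit} {γ δ : ℝ}
    (hP : P.Implements (phaseGate γ) δ) (ι : E ↪ D) (S : Finset D) (hι : ∀ e, ι e ∈ S) :
    ∃ (V : Circuit D) (corr : D → Finset V.B), DiagRealizes V.instrs V.init corr
      (fun x => phase γ (f fun e => x (ι e))) δ ∧ V.size ≤ 2 * N + P.size + 3 ∧
      V.Timed S (4 * L + P.logicalDepth) := by
  classical
  obtain ⟨R, _, _, res, e, h1, h2⟩ := coreInit_isSupply C P
  let V : Circuit D :=
    { R := R
      B := CoreBit C P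
      fintypeR := inferInstance
      decEqR := inferInstance
      decEqB := inferInstance
      res := res
      instrs := (core C P).map (Instr.relabel (ι.sumMap e.symm.toEmbedding) id) }
  have hinit : (fun s => coreInit C P fun a => s (e.symm a)) = V.init := by
    funext s
    rw [h1]
    simp only [Equiv.symm_apply_apply]
    rfl
  refine ⟨V, fun d => if h : ∃ a, ι a = d then {.inl (C.corr h.choose)} else ∅, ?_, ?_, ?_⟩
  · have h := (core_diagRealizes C P hP).relabel ι e (Function.Embedding.refl _)
      (fun d => if h : ∃ a, ι a = d then {.inl (C.corr h.choose)} else ∅) (fun d => ?_)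
      fun d hd => dif_neg hd
    · rw [hinit] at h
      exact h
    · have hd : ∃ a, ι a = ι d := ⟨d, rfl⟩
      rw [dif_pos hd, ι.injective hd.choose_spec, Finset.map_refl]
  · have h3 := core_length C P
    have h4 : V.instrs.length = (core C P).length := List.length_map _
    have h5 : Fintype.card V.R ≤ 1 + N + Fintype.card P.R := h2
    rw [Circuit.size, Circuit.size]
    omega
  · intro l A B _ _ a g hg t hd ha hb
    have he : V.instrs.map (Instr.relabel ((Function.Embedding.refl D).sumMap a) g) =
        (core C P).map (Instr.relabel (ι.sumMap (e.symm.toEmbedding.trans a)) g) := by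
      rw [List.map_map]
      refine List.map_congr_left fun I _ => ?_
      rw [comp_apply, Instr.relabel_relabel]
      congr 1
      ext q
      rcases q with q | q <;> rfl
    rw [he]
    obtain ⟨⟨c1, -⟩, ⟨c2, c3⟩⟩ := foldl_tick_relabel (ι.sumMap (e.symm.toEmbedding.trans a)) g hg l
      (core C P) (Clock.zero _ _) t
      ⟨fun q => by
        rcases q with q | q
        · exact (hd _ (hι q)).trans (Nat.le_add_left _ _)
        · exact (ha _).trans (Nat.le_add_left _ _),
      fun b => (hb b).trans (Nat.le_add_left _ _)⟩
    obtain ⟨k1, k2⟩ := core_clock C P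
    have hoff : ∀ d, (∀ q, ι q ≠ d) → (Sum.inl d : D ⊕ A) ∉
        Set.range (ι.sumMap (e.symm.toEmbedding.trans a)) := by
      rintro d hd ⟨q | q, hq⟩
      · exact hd q (Sum.inl_injective hq)
      · exact absurd hq (by simp)
    refine ⟨fun d hdS => ?_, fun d hdS => ?_, fun q => ?_, fun q hq => ?_, c3⟩
    · by_cases h : ∃ q, ι q = d
      · obtain ⟨q, rfl⟩ := h
        exact (c1 (.inl q)).trans ((Nat.add_le_add_right (k1 q) l).trans (by omega))
      · rw [c2 _ (hoff d (not_exists.1 h))]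
        exact (hd d hdS).trans (Nat.le_succ _)
    · exact c2 _ (hoff d fun q hq => hdS (hq ▸ hι q))
    · have h := c1 (.inr (e q))
      have h' : (ι.sumMap (e.symm.toEmbedding.trans a)) (.inr (e q)) = .inr (a q) :=
        congrArg (fun q => Sum.inr (a q)) (e.symm_apply_apply q)
      rw [h'] at h
      exact h.trans ((Nat.add_le_add_right (k2 (e q)) l).trans (by omega))
    · refine c2 _ ?_
      rintro ⟨q' | q', hq'⟩
      · exact absurd hq' (by simp)
      · exact hq ⟨e.symm q', Sum.inr_injective hq'⟩

end

theorem two_pow_clog_le (k : ℕ) : 2 ^ Nat.clog 2 k ≤ 2 * k + 1 := by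
  obtain hk | hk := Nat.lt_or_ge 1 k
  · have h := Nat.pow_pred_clog_lt_self one_lt_two hk
    have h0 : 0 < Nat.clog 2 k := Nat.clog_pos one_lt_two hk
    obtain ⟨c, hc⟩ := Nat.exists_eq_add_of_lt h0
    rw [hc] at h ⊢
    simp only [Nat.zero_add, Nat.pred_eq_sub_one, Nat.add_sub_cancel] at h
    rw [Nat.zero_add, pow_succ]
    omega
  · rw [Nat.clog_of_right_le_one hk]
    simp

/-- A clause containing a literal and its negation never fails, so `f` is constantly `false`.
Otherwise each variable occurs with one sign only, and `f` is a conjunction over the distinct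
variables, at most `k` of them. The size bound is `31 * (2 * k + 1) - 27`. -/
theorem Clause.exists_evaluator {n k : ℕ} (K : Clause n k) :
    ∃ (E : Type) (_ : Fintype E) (_ : DecidableEq E) (ι : E ↪ Fin n) (f : (E → Bool) → Bool)
      (L N : ℕ), (∀ e, ι e ∈ K.qubits) ∧
      (∀ x : Fin n → Bool, f (fun e => x (ι e)) = true ↔ ∀ i, x (K i).1 ≠ (K i).2) ∧
      L ≤ Nat.clog 2 k ∧ N ≤ 62 * k + 4 ∧ Nonempty (Evaluator E f L N) := by
  classical
  by_cases h : ∃ i i', (K i).1 = (K i').1 ∧ (K i).2 ≠ (K i').2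
  · obtain ⟨i, i', h1, h2⟩ := h
    refine ⟨Empty, inferInstance, inferInstance, ⟨Empty.elim, fun a => a.elim⟩, _, 0, 4,
      fun e => e.elim, fun x => ?_, Nat.zero_le _, Nat.le_add_left _ _, ⟨Evaluator.const false⟩⟩
    refine ⟨fun h => absurd h (by simp), fun h => ?_⟩
    have h3 := h i
    have h4 := h i'
    rw [h1] at h3
    revert h2 h3 h4
    generalize x (K i').1 = a
    generalize (K i).2 = b
    generalize (K i').2 = c
    cases a <;> cases b <;> cases c <;> simp
  · have hb : ∀ i, decide (∃ i', (K i').1 = (K i).1 ∧ (K i').2 = true) = (K i).2 := by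
      intro i
      cases hi : (K i).2
      · refine decide_eq_false fun ⟨i', h1, h2⟩ => h ⟨i, i', h1.symm, ?_⟩
        rw [hi, h2]
        exact Bool.false_ne_true
      · exact decide_eq_true ⟨i, rfl, hi⟩
    have hcard : K.qubits.card ≤ k := Finset.card_image_le.trans (by simp)
    obtain ⟨E, _, _, ι, f, N, h1, h2, h3, h4⟩ := LatticeSurgery.exists_evaluator
      (fun d => decide (∃ i', (K i').1 = d ∧ (K i').2 = true)) (Nat.clog 2 k) K.qubits
      (hcard.trans (Nat.le_pow_clog one_lt_two k))
    refine ⟨E, _, _, ι, f, Nat.clog 2 k, N, fun e => (h1 _).1 ⟨e, rfl⟩, fun x => ?_, le_rfl, ?_, h4⟩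
    · rw [h2]
      simp only [Clause.qubits, Finset.mem_image, Finset.mem_univ, true_and, forall_exists_index,
        forall_apply_eq_imp_iff, hb]
      refine forall_congr' fun i => ?_
      cases x (K i).1 <;> cases (K i).2 <;> simp
    · have := two_pow_clog_le k
      omega

theorem Circuit.Timed.mono {D : Type} [DecidableEq D] {V : Circuit D} {S : Finset D} {K K' : ℕ}
    (h : V.Timed S K) (hK : K ≤ K') : V.Timed S K' := by
  intro l A B _ _ a g hg t hd ha hb
  obtain ⟨h1, h2, h3, h4⟩ := h l A B a g hg t hd ha hb
  exact ⟨h1, h2, fun q => (h3 q).trans (by omega), h4⟩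

theorem Clause.exists_circuit {n k : ℕ} (K : Clause n k) {P : Circuit Unit} {γ δ : ℝ}
    (hP : P.Implements (phaseGate γ) δ) :
    ∃ (V : Circuit (Fin n)) (corr : Fin n → Finset V.B), DiagRealizes V.instrs V.init corr
      (fun x => Complex.exp (-Complex.I * γ * (K.value x : ℂ))) δ ∧
      V.size ≤ 124 * (k + P.size + 1) ^ 124 ∧
      V.Timed K.qubits (4 * Nat.clog 2 k + P.logicalDepth) := by
  obtain ⟨E, _, _, ι, f, L, N, h1, h2, h3, h4, ⟨C⟩⟩ := K.exists_evaluator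
  obtain ⟨V, corr, hV, hsize, htime⟩ := C.exists_circuit hP ι K.qubits h1
  have hexp : Complex.exp (-Complex.I * γ) * Complex.exp (Complex.I * γ) = 1 := by
    rw [← Complex.exp_add]
    simp
  refine ⟨V, corr, hV.phase (Complex.exp (-Complex.I * γ)) (Complex.exp (Complex.I * γ))
    (norm_phase γ true) hexp fun x => ?_, ?_, htime.mono (by omega)⟩
  · by_cases hx : ∀ i, x (K i).1 ≠ (K i).2
    · rw [(h2 x).2 hx, Clause.value, if_neg (by simpa using hx), phase, if_pos rfl, hexp]
      simp
    · rw [Bool.eq_false_iff.2 (fun h => hx ((h2 x).1 h)), Clause.value,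
        if_pos (by simpa using hx), phase]
      simp
  -- Here `2 * (62 * k + 4) + P.size + 3 = 124 * k + P.size + 11`, so the size is in fact linear.
  · calc V.size ≤ 124 * (k + P.size + 1) := by omega
      _ ≤ 124 * (k + P.size + 1) ^ 124 :=
        Nat.mul_le_mul_left _ (Nat.le_self_pow (by norm_num) _)

/-! ### Products of circuits: scheduling -/

section Product

variable {D : Type} [Fintype D] [DecidableEq D] {m : ℕ} (V : Fin m → Circuit D)
  (σ : Equiv.Perm (Fin m))

/-- The ancilla qubits of a factor, as ancilla qubits of the product. -/
def Circuit.productAnc (j : Fin m) : (V j).Anc ↪ (Circuit.product V σ).Anc :=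
  ⟨fun a => ⟨⟨j, a.1⟩, a.2⟩, by rintro ⟨r, i⟩ ⟨r', i'⟩ h; cases h; rfl⟩

/-- The classical bits of a factor, as classical bits of the product. -/
def Circuit.productBit (j : Fin m) : (V j).B → (Circuit.product V σ).B :=
  (Sigma.mk j : _ → Σ j, (V j).B)

theorem Circuit.productBit_injective (j : Fin m) : Injective (Circuit.productBit V σ j) :=
  fun _ _ h => sigma_mk_injective (β := fun j => (V j).B) h

/-- The instructions of a factor, as instructions of the product. -/
def Circuit.productPart (j : Fin m) :
    List (Instr (D ⊕ (Circuit.product V σ).Anc) (Circuit.product V σ).B) :=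
  (V j).instrs.map (Instr.relabel ((Function.Embedding.refl D).sumMap
    (Circuit.productAnc V σ j)) (Circuit.productBit V σ j))

theorem Circuit.product_instrs : (Circuit.product V σ).instrs =
    (List.ofFn σ).flatMap (Circuit.productPart V σ) := rfl

theorem Circuit.productAnc_notMem_range {i j : Fin m} (h : i ≠ j) (a : (V i).Anc) :
    Circuit.productAnc V σ i a ∉ Set.range (Circuit.productAnc V σ j) := by
  rintro ⟨a', ha'⟩
  exact h (congrArg (fun q : (Circuit.product V σ).Anc => q.1.1) ha').symm

theorem Circuit.productBit_notMem_range {i j : Fin m} (h : i ≠ j) (b : (V i).B) :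
    Circuit.productBit V σ i b ∉ Set.range (Circuit.productBit V σ j) := by
  rintro ⟨b', hb'⟩
  exact h (congrArg (fun b : Σ j, (V j).B => b.1) hb').symm

/-- The invariant is that everything a remaining factor `j` uses is free by time `ρ j`. A factor
holds its data qubits until `ρ j + 1`; a later factor that shares one lies in another part, hence
has a strictly larger `ρ`. Ancilla qubits and bits are private and never block another factor. -/
theorem Circuit.product_clock (S : Fin m → Finset D) (ρ : Fin m → ℕ) (c K : ℕ)
    (hV : ∀ j, (V j).Timed (S j) K) (hρ : ∀ j, ρ j < c)
    (hS : ∀ i j, i ≠ j → ρ i = ρ j → Disjoint (S i) (S j)) (js : List (Fin m))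
    (hjs : js.Nodup) (hs : js.Pairwise fun i j => ρ i ≤ ρ j)
    (t : Clock (D ⊕ (Circuit.product V σ).Anc) (Circuit.product V σ).B)
    (hd : ∀ j ∈ js, ∀ d ∈ S j, t.qubit (.inl d) ≤ ρ j)
    (ha : ∀ j ∈ js, ∀ a, t.qubit (.inr (Circuit.productAnc V σ j a)) ≤ ρ j)
    (hb : ∀ j ∈ js, ∀ b, t.bit (Circuit.productBit V σ j b) ≤ ρ j)
    (hq : ∀ q, t.qubit q ≤ c + K) (q : D ⊕ (Circuit.product V σ).Anc) :
    ((js.flatMap (Circuit.productPart V σ)).foldl Instr.tick t).qubit q ≤ c + K := by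
  induction js generalizing t with
  | nil => exact hq q
  | cons j js ih =>
    rw [List.flatMap_cons, List.foldl_append]
    obtain ⟨h1, h2, h3, h4, h5⟩ := hV j (ρ j) _ _ (Circuit.productAnc V σ j)
      (Circuit.productBit V σ j) (Circuit.productBit_injective V σ j) t (hd j (by simp))
      (ha j (by simp)) (hb j (by simp))
    have hj : ∀ i ∈ js, i ≠ j := fun i hi h => (List.nodup_cons.1 hjs).1 (h ▸ hi)
    have hle : ∀ i ∈ js, ρ j ≤ ρ i := (List.pairwise_cons.1 hs).1
    refine ih (List.nodup_cons.1 hjs).2 (List.pairwise_cons.1 hs).2 _ (fun i hi d hdi => ?_)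
      (fun i hi a => ?_) (fun i hi b => ?_) fun q => ?_
    · by_cases hdj : d ∈ S j
      -- Sorting gives `ρ j ≤ ρ i`; sharing the qubit `d` excludes equality, so one cycle is
      -- available.
      · have hne : ρ j ≠ ρ i := fun h =>
          Finset.disjoint_left.1 (hS j i (hj i hi).symm h) hdj hdi
        exact (h1 d hdj).trans (lt_of_le_of_ne (hle i hi) hne)
      · exact (h2 d hdj).trans_le (hd i (List.mem_cons_of_mem _ hi) d hdi)
    · exact (h4 _ (Circuit.productAnc_notMem_range V σ (hj i hi) a)).trans_le
        (ha i (List.mem_cons_of_mem _ hi) a)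
    · exact (h5 _ (Circuit.productBit_notMem_range V σ (hj i hi) b)).trans_le
        (hb i (List.mem_cons_of_mem _ hi) b)
    · have hc := hρ j
      rcases q with d | q
      · by_cases hdj : d ∈ S j
        · exact (h1 d hdj).trans (by omega)
        · exact (h2 d hdj).trans_le (hq _)
      · by_cases hqj : q ∈ Set.range (Circuit.productAnc V σ j)
        · obtain ⟨a, rfl⟩ := hqj
          exact (h3 a).trans (by omega)
        · exact (h4 q hqj).trans_le (hq _)

theorem Circuit.logicalDepth_product_sort_le (S : Fin m → Finset D) (ρ : Fin m → ℕ) (c K : ℕ)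
    (hV : ∀ j, (V j).Timed (S j) K) (hρ : ∀ j, ρ j < c)
    (hS : ∀ i j, i ≠ j → ρ i = ρ j → Disjoint (S i) (S j)) :
    (Circuit.product V (Tuple.sort ρ)).logicalDepth ≤ c + K := by
  refine Finset.sup_le fun q _ => ?_
  rw [Circuit.product_instrs]
  refine Circuit.product_clock V _ S ρ c K hV hρ hS _
    (List.nodup_ofFn.2 (Tuple.sort ρ).injective) ?_ _ (fun _ _ _ _ => Nat.zero_le _)
    (fun _ _ _ => Nat.zero_le _) (fun _ _ _ => Nat.zero_le _) (fun _ => Nat.zero_le _) q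
  rw [List.pairwise_ofFn]
  exact fun i j hij => Tuple.monotone_sort ρ hij.le

end Product

theorem exists_part_index {m : ℕ} (parts : Finpartition (Finset.univ : Finset (Fin m))) :
    ∃ ρ : Fin m → ℕ, (∀ j, ρ j < parts.parts.card) ∧
      ∀ i j, ρ i = ρ j → ∃ S ∈ parts.parts, i ∈ S ∧ j ∈ S := by
  refine ⟨fun j => parts.parts.equivFin ⟨parts.part j, parts.part_mem.2 (Finset.mem_univ j)⟩,
    fun j => Fin.is_lt _, fun i j h => ?_⟩
  have h1 := parts.parts.equivFin.injective (Fin.val_injective h)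
  have h2 : parts.part i = parts.part j := congrArg Subtype.val h1
  exact ⟨parts.part i, parts.part_mem.2 (Finset.mem_univ i), parts.mem_part_self.2 (Finset.mem_univ i),
    h2 ▸ parts.mem_part_self.2 (Finset.mem_univ j)⟩

/-! ### Products of circuits: semantics -/

/-- The triangle inequality for families of vectors indexed by measurement records. -/
theorem recordSum_normSq_add_le {Y : Type} [Fintype Y] {n : ℕ} {F G : List Bool → Y → ℂ}
    {a b : ℝ} (ha : 0 ≤ a) (hb : 0 ≤ b) (hF : recordSum n (fun o => normSq (F o)) ≤ a ^ 2)
    (hG : recordSum n (fun o => normSq (G o)) ≤ b ^ 2) :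
    recordSum n (fun o => normSq fun y => F o y + G o y) ≤ (a + b) ^ 2 := by
  have key : ∀ H : List Bool → Y → ℂ, recordSum n (fun o => normSq (H o)) =
      ∑ p : (Fin n → Bool) × Y, ‖H (List.ofFn p.1) p.2‖ ^ 2 := fun H => by
    rw [Fintype.sum_prod_type]
    rfl
  rw [key] at hF hG ⊢
  have hc := Finset.sum_mul_sq_le_sq_mul_sq Finset.univ
    (fun p : (Fin n → Bool) × Y => ‖F (List.ofFn p.1) p.2‖) fun p => ‖G (List.ofFn p.1) p.2‖
  have hc' : (∑ p : (Fin n → Bool) × Y, ‖F (List.ofFn p.1) p.2‖ * ‖G (List.ofFn p.1) p.2‖)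
      ≤ a * b := by
    refine abs_le_of_sq_le_sq' ?_ (mul_nonneg ha hb) |>.2
    rw [mul_pow]
    exact hc.trans (mul_le_mul hF hG (Finset.sum_nonneg fun _ _ => by positivity)
      (by positivity))
  calc ∑ p : (Fin n → Bool) × Y, ‖F (List.ofFn p.1) p.2 + G (List.ofFn p.1) p.2‖ ^ 2
      ≤ ∑ p : (Fin n → Bool) × Y, (‖F (List.ofFn p.1) p.2‖ ^ 2 +
          2 * (‖F (List.ofFn p.1) p.2‖ * ‖G (List.ofFn p.1) p.2‖) +
          ‖G (List.ofFn p.1) p.2‖ ^ 2) := by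
        refine Finset.sum_le_sum fun p _ => ?_
        refine (pow_le_pow_left₀ (norm_nonneg _) (norm_add_le _ _) 2).trans_eq ?_
        ring
    _ ≤ (a + b) ^ 2 := by
        rw [Finset.sum_add_distrib, Finset.sum_add_distrib, ← Finset.mul_sum]
        nlinarith

section Append

variable {D A₁ A₂ B₁ B₂ : Type} [Fintype D] [DecidableEq D] [Fintype A₁] [DecidableEq A₁]
  [Fintype A₂] [DecidableEq A₂] [DecidableEq B₁] [DecidableEq B₂]

/-- Both circuits keep the data in the basis state `x`, so branch vectors multiply. With corrected
branches `bᵢ`, the error is `(b₁ - u₁χ₁) b₂ + u₁χ₁ (b₂ - u₂χ₂)`. The cofactors have total weight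
one, and the triangle inequality adds `δ₁` and `δ₂`. -/
theorem DiagRealizes.append {l₁ : List (Instr (D ⊕ A₁) B₁)} {l₂ : List (Instr (D ⊕ A₂) B₂)}
    {init₁ : (A₁ → Bool) → ℂ} {init₂ : (A₂ → Bool) → ℂ} {corr₁ : D → Finset B₁}
    {corr₂ : D → Finset B₂} {u₁ u₂ : (D → Bool) → ℂ} {δ₁ δ₂ : ℝ}
    (h₁ : DiagRealizes l₁ init₁ corr₁ u₁ δ₁) (h₂ : DiagRealizes l₂ init₂ corr₂ u₂ δ₂)
    (hi₂ : normSq init₂ = 1) (hu : ∀ x, ‖u₁ x‖ = 1)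
    (hδ₁ : 0 ≤ δ₁) (hδ₂ : 0 ≤ δ₂) :
    DiagRealizes
      (l₁.map (Instr.relabel ((Function.Embedding.refl D).sumMap
        (Function.Embedding.inl : A₁ ↪ A₁ ⊕ A₂)) (Sum.inl : B₁ → B₁ ⊕ B₂)) ++
      l₂.map (Instr.relabel ((Function.Embedding.refl D).sumMap
        (Function.Embedding.inr : A₂ ↪ A₁ ⊕ A₂)) (Sum.inr : B₂ → B₁ ⊕ B₂)))
      (fun s => init₁ (fun a => s (.inl a)) * init₂ fun a => s (.inr a))
      (fun d => (corr₁ d).disjSum (corr₂ d)) (fun x => u₁ x * u₂ x) (δ₁ + δ₂) := by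
  set n₁ := l₁.countP Instr.isMeasurement with hn₁
  set n₂ := l₂.countP Instr.isMeasurement with hn₂
  set l := l₁.map (Instr.relabel ((Function.Embedding.refl D).sumMap
        (Function.Embedding.inl : A₁ ↪ A₁ ⊕ A₂)) (Sum.inl : B₁ → B₁ ⊕ B₂)) ++
      l₂.map (Instr.relabel ((Function.Embedding.refl D).sumMap
        (Function.Embedding.inr : A₂ ↪ A₁ ⊕ A₂)) (Sum.inr : B₂ → B₁ ⊕ B₂)) with hl
  set init : (A₁ ⊕ A₂ → Bool) → ℂ :=
    fun s => init₁ (fun a => s (.inl a)) * init₂ fun a => s (.inr a) with hinit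
  have hcount : l.countP Instr.isMeasurement = n₁ + n₂ := by
    rw [hl, List.countP_append, countP_map_relabel, countP_map_relabel]
  have hsplit : ∀ o : List Bool, o.length = n₁ + n₂ → ∃ o₁ o₂ : List Bool,
      o₁.length = n₁ ∧ o₂.length = n₂ ∧ o = o₁ ++ o₂ := fun o ho =>
    ⟨o.take n₁, o.drop n₁, by simp; omega, by simp; omega, by simp⟩
  have hrun : ∀ o₁ o₂ x, o₁.length = n₁ → o₂.length = n₂ →
      ((∀ b, memory l (o₁ ++ o₂) (.inl b) = memory l₁ o₁ b) ∧
      (∀ b, memory l (o₁ ++ o₂) (.inr b) = memory l₂ o₂ b)) ∧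
      (run l (o₁ ++ o₂) (start (B₁ ⊕ B₂) init x)).amp = fun s => ket x (fun d => s (.inl d)) *
        (branch l₁ init₁ o₁ x (fun a => s (.inr (.inl a))) *
          branch l₂ init₂ o₂ x fun a => s (.inr (.inr a))) := by
    intro o₁ o₂ x ho₁ ho₂
    have k1 := run_relabel ((Function.Embedding.refl D).sumMap
      (Function.Embedding.inl : A₁ ↪ A₁ ⊕ A₂)) (Sum.inl : B₁ → B₁ ⊕ B₂) Sum.inl_injective
      (fun s => init₂ fun a => s (.inr (.inr a))) (by rintro s (d | a) v <;> simp) l₁ o₁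
      (start B₁ init₁ x) (start (B₁ ⊕ B₂) init x)
      ⟨fun _ => rfl, fun s => (mul_assoc _ _ _).symm⟩
    rw [← run_start_mem (init := init) (x := x), hl,
      run_append_append _ _ _ _ _ (by rw [ho₁, countP_map_relabel])]
    generalize run (l₁.map (Instr.relabel ((Function.Embedding.refl D).sumMap
      (Function.Embedding.inl : A₁ ↪ A₁ ⊕ A₂)) (Sum.inl : B₁ → B₁ ⊕ B₂))) o₁
      (start (B₁ ⊕ B₂) init x) = c at k1 ⊢
    obtain ⟨⟨m1, a1⟩, f1⟩ := k1
    have k2 := run_relabel ((Function.Embedding.refl D).sumMap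
      (Function.Embedding.inr : A₂ ↪ A₁ ⊕ A₂)) (Sum.inr : B₂ → B₁ ⊕ B₂) Sum.inr_injective
      (fun s => branch l₁ init₁ o₁ x fun a => s (.inr (.inl a)))
      (by rintro s (d | a) v <;> simp) l₂ o₂
      (start B₂ init₂ x) c
      ⟨fun b => f1 _ (by simp), fun s => by
        rw [a1, h₁.amp_eq o₁ x ho₁]
        change ket x (fun d => s (.inl d)) *
          branch l₁ init₁ o₁ x (fun a => s (.inr (.inl a))) *
          init₂ (fun a => s (.inr (.inr a))) = ket x (fun d => s (.inl d)) *
          init₂ (fun a => s (.inr (.inr a))) * branch l₁ init₁ o₁ x fun a => s (.inr (.inl a))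
        ring⟩
    obtain ⟨⟨m2, a2⟩, f2⟩ := k2
    refine ⟨⟨fun b => ?_, fun b => ?_⟩, funext fun s => ?_⟩
    · rw [f2 _ (by simp), m1, run_start_mem]
    · rw [m2, run_start_mem]
    · rw [a2, h₂.amp_eq o₂ x ho₂]
      change ket x (fun d => s (.inl d)) *
          branch l₂ init₂ o₂ x (fun a => s (.inr (.inr a))) *
          branch l₁ init₁ o₁ x (fun a => s (.inr (.inl a))) = _
      ring
  have hbranch : ∀ o₁ o₂ x, o₁.length = n₁ → o₂.length = n₂ → branch l init (o₁ ++ o₂) x =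
      fun y : A₁ ⊕ A₂ → Bool => branch l₁ init₁ o₁ x (fun a => y (.inl a)) *
        branch l₂ init₂ o₂ x fun a => y (.inr a) :=
    fun o₁ o₂ x ho₁ ho₂ => branch_eq _ _ _ _ (fun y : A₁ ⊕ A₂ → Bool =>
      branch l₁ init₁ o₁ x (fun a => y (.inl a)) *
        branch l₂ init₂ o₂ x fun a => y (.inr a)) (hrun o₁ o₂ x ho₁ ho₂).2
  have hsign : ∀ o₁ o₂ x, o₁.length = n₁ → o₂.length = n₂ →
      corrSign (fun d => (corr₁ d).disjSum (corr₂ d)) (memory l (o₁ ++ o₂)) x =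
      corrSign corr₁ (memory l₁ o₁) x * corrSign corr₂ (memory l₂ o₂) x := by
    intro o₁ o₂ x ho₁ ho₂
    obtain ⟨m1, m2⟩ := (hrun o₁ o₂ x ho₁ ho₂).1
    simp only [corrSign, Finset.prod_disjSum, Finset.prod_mul_distrib, m1, m2]
  obtain ⟨χ₁, n1, e1⟩ := h₁.exists_approx
  obtain ⟨χ₂, n2, e2⟩ := h₂.exists_approx
  have hprod : ∀ (F : List Bool → (A₁ → Bool) → ℂ) (G : List Bool → (A₂ → Bool) → ℂ),
      recordSum (n₁ + n₂) (fun o => normSq fun y : A₁ ⊕ A₂ → Bool =>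
        F (o.take n₁) (fun a => y (.inl a)) * G (o.drop n₁) fun a => y (.inr a)) =
      recordSum n₁ (fun o => normSq (F o)) * recordSum n₂ fun o => normSq (G o) := by
    intro F G
    rw [recordSum_add, ← recordSum_mul_right]
    refine recordSum_congr fun o₁ ho₁ => ?_
    rw [← recordSum_mul_left]
    refine recordSum_congr fun o₂ _ => ?_
    rw [← normSq_sum]
    simp only [← ho₁, List.take_left, List.drop_left]
  refine ⟨fun o x ho => ?_, fun o y => χ₁ (o.take n₁) (fun a => y (.inl a)) *
    χ₂ (o.drop n₁) fun a => y (.inr a), ?_, fun x => ?_⟩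
  · obtain ⟨o₁, o₂, ho₁, ho₂, rfl⟩ := hsplit o (ho.trans hcount)
    rw [hbranch o₁ o₂ x ho₁ ho₂]
    exact (hrun o₁ o₂ x ho₁ ho₂).2
  · rw [hcount, hprod χ₁ χ₂, n1, n2, one_mul]
  · rw [hcount]
    have t1 := (hprod (fun o y => corrSign corr₁ (memory l₁ o) x * branch l₁ init₁ o x y -
      u₁ x * χ₁ o y) fun o y => corrSign corr₂ (memory l₂ o) x * branch l₂ init₂ o x y)
    have t2 := (hprod (fun o y => u₁ x * χ₁ o y) fun o y =>
      corrSign corr₂ (memory l₂ o) x * branch l₂ init₂ o x y - u₂ x * χ₂ o y)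
    simp only [normSq_const_mul, norm_corrSign, hu, one_pow, one_mul] at t1 t2
    rw [h₂.recordSum_branch hi₂, mul_one] at t1
    rw [n1, one_mul] at t2
    refine le_of_eq_of_le (recordSum_congr fun o ho => ?_)
      (recordSum_normSq_add_le hδ₁ hδ₂ (t1.trans_le (e1 x)) (t2.trans_le (e2 x)))
    obtain ⟨o₁, o₂, ho₁, ho₂, rfl⟩ := hsplit o ho
    rw [hbranch o₁ o₂ x ho₁ ho₂, hsign o₁ o₂ x ho₁ ho₂]
    refine congrArg normSq (funext fun y => ?_)
    simp only [← ho₁, List.take_left, List.drop_left]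
    ring

end Append

section Product

variable {D : Type} [Fintype D] [DecidableEq D] {m : ℕ} (V : Fin m → Circuit D)
  (σ : Equiv.Perm (Fin m))

theorem DiagRealizes.nil : DiagRealizes (D := D) (A := Empty) (B := Empty) [] (fun _ => 1)
    (fun _ => ∅) (fun _ => 1) 0 := by
  have h : ∀ o x, branch (D := D) (A := Empty) (B := Empty) [] (fun _ => 1) o x = fun _ => 1 :=
    fun o x => branch_eq _ _ _ _ _ rfl
  refine ⟨fun o x _ => ?_, fun _ _ => 1, ?_, fun x => ?_⟩
  · rw [h]
    rfl
  · simp [recordSum_zero, normSq]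
  · simp [recordSum_zero, normSq, h, corrSign]

/-- Induction over a partial list of factors needs ancilla and bit types of its own, which are
embedded into those of the full product. Only for the complete list is the embedding of ancilla
qubits onto. -/
theorem Circuit.product_prefix {corr : ∀ j, D → Finset (V j).B} {u : Fin m → (D → Bool) → ℂ}
    {δ : ℝ} (hδ : 0 ≤ δ)
    (h : ∀ j, DiagRealizes (V j).instrs (V j).init (corr j) (u j) δ)
    (hu : ∀ j x, ‖u j x‖ = 1) (js : List (Fin m)) (hjs : js.Nodup) :
    ∃ (A B : Type) (_ : Fintype A) (_ : DecidableEq A) (_ : DecidableEq B)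
      (l : List (Instr (D ⊕ A) B)) (init : (A → Bool) → ℂ) (corr : D → Finset B)
      (a : A ↪ (Circuit.product V σ).Anc) (g : B ↪ (Circuit.product V σ).B),
      DiagRealizes l init corr (fun x => (js.map fun j => u j x).prod) (js.length * δ) ∧
      normSq init = 1 ∧
      js.flatMap (Circuit.productPart V σ) =
        l.map (Instr.relabel ((Function.Embedding.refl D).sumMap a) g) ∧
      (∀ q, q ∈ Set.range a ↔ q.1.1 ∈ js) ∧ (∀ b, b ∈ Set.range g → b.1 ∈ js) ∧
      ∀ s : (Circuit.product V σ).Anc → Bool, (init fun q => s (a q)) =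
        (js.map fun j => (V j).init fun q => s (Circuit.productAnc V σ j q)).prod := by
  induction js with
  | nil =>
    refine ⟨Empty, Empty, inferInstance, inferInstance, inferInstance, [], fun _ => 1, fun _ => ∅,
      ⟨Empty.elim, fun a => a.elim⟩, ⟨Empty.elim, fun a => a.elim⟩, ?_, ?_, rfl, ?_, ?_, ?_⟩
    · simpa using DiagRealizes.nil
    · simp [normSq]
    · simp
    · simp
    · simp
  | cons j js ih =>
    obtain ⟨A, B, _, _, _, l, init, corr', a, g, k1, k2, k3, k4, k5, k6⟩ :=
      ih (List.nodup_cons.1 hjs).2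
    have hj := (List.nodup_cons.1 hjs).1
    have ha : Injective (Sum.elim (Circuit.productAnc V σ j) a) := by
      refine (Circuit.productAnc V σ j).injective.sumElim a.injective fun q q' hq => hj ?_
      have := (k4 _).1 ⟨q', hq.symm⟩
      exact this
    have hg : Injective (Sum.elim (Circuit.productBit V σ j) g) := by
      refine (Circuit.productBit_injective V σ j).sumElim g.injective fun q q' hq => hj ?_
      have := k5 _ ⟨q', hq.symm⟩
      exact this
    have hi : normSq (V j).init = 1 := (IsSupply.circuit (V j)).normSq
    have k := (h j).append k1 k2 (hu j) hδ (by positivity)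
    have e : ((j :: js).length : ℝ) * δ = δ + js.length * δ := by
      rw [List.length_cons]
      push_cast
      ring
    rw [e]
    refine ⟨(V j).Anc ⊕ A, (V j).B ⊕ B, inferInstance, inferInstance, inferInstance, _, _, _,
      ⟨_, ha⟩, ⟨_, hg⟩, k, ?_, ?_, fun q => ?_, fun b hb => ?_, fun s => ?_⟩
    · rw [normSq_sum, hi, k2, one_mul]
    · rw [List.flatMap_cons, k3, List.map_append, List.map_map, List.map_map]
      congr 1
      · refine List.map_congr_left fun I _ => ?_
        rw [comp_apply, Instr.relabel_relabel]
        congr 1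
        ext q
        rcases q with q | q <;> rfl
      · refine List.map_congr_left fun I _ => ?_
        rw [comp_apply, Instr.relabel_relabel]
        congr 1
        ext q
        rcases q with q | q <;> rfl
    · rw [List.mem_cons, ← k4]
      constructor
      · rintro ⟨q | q, rfl⟩
        · exact .inl rfl
        · exact .inr ⟨q, rfl⟩
      · rintro (hq | ⟨q, rfl⟩)
        · obtain ⟨⟨j', r⟩, i⟩ := q
          obtain rfl : j' = j := hq
          exact ⟨.inl ⟨r, i⟩, rfl⟩
        · exact ⟨.inr q, rfl⟩
    · rw [List.mem_cons]
      obtain ⟨b | b, rfl⟩ := hb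
      · exact .inl rfl
      · exact .inr (k5 _ ⟨b, rfl⟩)
    · rw [List.map_cons, List.prod_cons, ← k6]
      rfl

theorem Circuit.exists_diagRealizes_product {corr : ∀ j, D → Finset (V j).B}
    {u : Fin m → (D → Bool) → ℂ} {δ : ℝ} (hδ : 0 ≤ δ)
    (h : ∀ j, DiagRealizes (V j).instrs (V j).init (corr j) (u j) δ)
    (hu : ∀ j x, ‖u j x‖ = 1) :
    ∃ corr : D → Finset (Circuit.product V σ).B, DiagRealizes (Circuit.product V σ).instrs
      (Circuit.product V σ).init corr (fun x => ∏ j, u j x) (m * δ) := by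
  obtain ⟨A, B, _, _, _, l, init, corr', a, g, k1, k2, k3, k4, -, k6⟩ :=
    Circuit.product_prefix V σ hδ h hu (List.ofFn σ) (List.nodup_ofFn.2 σ.injective)
  -- Each index occurs in the list of values of `σ`, so all ancilla qubits are reached. Unused
  -- classical bits do no harm.
  have ha : Bijective a := ⟨a.injective, fun q =>
    (k4 q).2 (List.mem_ofFn.2 ⟨σ.symm q.1.1, σ.apply_symm_apply _⟩)⟩
  have hprod : ∀ F : Fin m → ℂ, ((List.ofFn σ).map F).prod = ∏ j, F j := fun F => by
    rw [List.map_ofFn, List.prod_ofFn]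
    exact Equiv.prod_comp σ F
  refine ⟨fun d => (corr' d).map g, ?_⟩
  have k := k1.relabel (Function.Embedding.refl D) (Equiv.ofBijective a ha).symm g
    (fun d => (corr' d).map g) (fun _ => rfl) fun d hd => absurd ⟨d, rfl⟩ hd
  have hinit : (fun s => init fun q => s ((Equiv.ofBijective a ha).symm.symm q)) =
      (Circuit.product V σ).init := by
    funext s
    refine (k6 s).trans ?_
    rw [hprod]
    exact (Fintype.prod_sigma fun r : Σ j, (V j).R =>
      ((V r.1).res r.2).amplitude fun i => s ⟨r, i⟩).symm
  have hl : l.map (Instr.relabel ((Function.Embedding.refl D).sumMap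
      (Equiv.ofBijective a ha).symm.symm.toEmbedding) g) = (Circuit.product V σ).instrs := by
    rw [Circuit.product_instrs, k3]
    rfl
  rw [hinit, hl] at k
  simp only [hprod, List.length_ofFn] at k
  exact k

end Product

end LatticeSurgery

/-! ### The main theorem. -/

theorem mainTheorem3 :
    ∃ A : ℕ, ∀ (n m k : ℕ) (γ δ : ℝ) (_hδ : 0 ≤ δ)
      (C : Fin m → LatticeSurgery.Clause n k)
      (parts : Finpartition (Finset.univ : Finset (Fin m)))
      (_hparts : ∀ S ∈ parts.parts, ∀ i ∈ S, ∀ j ∈ S, i ≠ j →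
        Disjoint (C i).qubits (C j).qubits)
      (P : LatticeSurgery.Circuit Unit)
      (_hP : P.Implements (LatticeSurgery.phaseGate γ) δ)
      (nP : ℕ) (_hnP : P.logicalDepth = nP),
      ∃ (V : Fin m → LatticeSurgery.Circuit (Fin n)) (σ : Equiv.Perm (Fin m)),
        (∀ j, (V j).ZEquivalent (LatticeSurgery.clauseUnitary γ (C j)) δ ∧
          (V j).size ≤ A * (k + P.size + 1) ^ A) ∧
        (LatticeSurgery.Circuit.product V σ).ZEquivalent (LatticeSurgery.phaser γ C) (m * δ) ∧
        (LatticeSurgery.Circuit.product V σ).logicalDepth ≤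
          parts.parts.card + nP + 4 * Nat.clog 2 k := by
  refine ⟨124, fun n m k γ δ hδ C parts hparts P hP nP hnP => ?_⟩
  choose V corr hV hsize htime using fun j => (C j).exists_circuit hP
  obtain ⟨ρ, hρ, hρ'⟩ := LatticeSurgery.exists_part_index parts
  have hnorm : ∀ j x, ‖Complex.exp (-Complex.I * γ * ((C j).value x : ℂ))‖ = 1 := fun j x => by
    have h : -Complex.I * γ * ((C j).value x : ℂ) =
        ((-(γ * (C j).value x) : ℝ) : ℂ) * Complex.I := by
      push_cast
      ring
    rw [h, Complex.norm_exp_ofReal_mul_I]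
  -- The factors are composed in the order of their part numbers.
  refine ⟨V, Tuple.sort ρ, fun j => ⟨(hV j).zEquivalent, hsize j⟩, ?_, ?_⟩
  · obtain ⟨corr', h⟩ :=
      LatticeSurgery.Circuit.exists_diagRealizes_product V (Tuple.sort ρ) hδ hV hnorm
    -- The product of the clause phases becomes the exponential of their sum, the diagonal of the
    -- phaser.
    simp only [← Complex.exp_sum, ← Finset.mul_sum] at h
    exact h.zEquivalent
  · refine (LatticeSurgery.Circuit.logicalDepth_product_sort_le V (fun j => (C j).qubits) ρ
      parts.parts.card _ htime hρ fun i j hij h => ?_).trans (by omega)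
    obtain ⟨S, hS, hi, hj⟩ := hρ' i j h
    exact hparts S hS i hi j hj hij
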